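/- Let $\mathscr{C}$ be the monoidal category of finite dimensional modules over the complex Lie algebra $\mathfrak{sl}_3=\mathfrak{sl}_3(\mathbb{C})$, with tensor product over $\mathbb{C}$. Let $\mathrm{F}=\mathbb{C}^3$ be the natural module and $\mathrm{F}^*$ its dual. A $\mathscr{C}$-module category is a $\mathbb{C}$-linear additive category $\mathcal{M}$ with a left action of $\mathscr{C}$ (with coherent associativity and unit isomorphisms) whose action bifunctor $\mathscr{C}\times\mathcal{M}\to\mathcal{M}$ is $\mathbb{C}$-bilinear on morphisms. It is *locally finitary* if $\mathcal{M}$ is idempotent split and Krull--Schmidt, has at most countably many indecomposable objects up to isomorphism, and all its morphism spaces are finite dimensional. It is *admissible* if, in addition, $\mathcal{M}$ has weak kernels. It is *simple* if $\mathcal{M}$ is non-zero and its only two-sided ideals stable under the action of $\mathscr{C}$ are the zero ideal and $\mathcal{M}$ itself. For a locally finitary $\mathcal{M}$ with representatives $\{X_i\}_{i\in I}$ of the isomorphism classes of indecomposable objects, and for $\theta\in\mathscr{C}$, let $\Gamma_\theta$ be the oriented graph with vertex set $I$ in which the number of edges from $j$ to $i$ is the multiplicity of $X_i$ as a direct summand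 of $\theta(X_j)$. The *graph* of $\mathcal{M}$ is $\Gamma_{\mathrm{F}}$ and the *dual graph* of $\mathcal{M}$ is $\Gamma_{\mathrm{F}^*}$. **Theorem.** Let $\mathcal{M}$ be an admissible simple $\mathscr{C}$-module category whose graph is isomorphic to the graph, and whose dual graph is isomorphic to the dual graph, of the left regular $\mathscr{C}$-module category ${}_{\mathscr{C}}\mathscr{C}$ (that is, $\mathscr{C}$ acting on itself by tensoring from the left). Then $\mathcal{M}$ is equivalent to ${}_{\mathscr{C}}\mathscr{C}$ as a $\mathscr{C}$-module category: there is a $\mathbb{C}$-linear functor between them that is an equivalence of categories and a (strong) $\mathscr{C}$-module functor. -/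

import Mathlib

open CategoryTheory CategoryTheory.Limits CategoryTheory.MonoidalCategory
open scoped CategoryTheory.MonoidalCategory.MonoidalLeftAction TensorProduct

noncomputable section

/-! ### Finite dimensional modules over a complex Lie algebra -/

/-- A finite dimensional module over the complex Lie algebra `L`. -/
structure FDLieMod (L : Type) [LieRing L] [LieAlgebra ℂ L] : Type 1 where
  carrier : Type
  [addCommGroup : AddCommGroup carrier]
  [module : Module ℂ carrier]
  [lieRingModule : LieRingModule L carrier]
  [lieModule : LieModule ℂ L carrier]
  [finiteDimensional : FiniteDimensional ℂ carrier]

namespace FDLieMod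

variable {L : Type} [LieRing L] [LieAlgebra ℂ L]

instance : CoeSort (FDLieMod L) Type := ⟨FDLieMod.carrier⟩

attribute [instance] addCommGroup module lieRingModule lieModule finiteDimensional

/-- Morphisms are the homomorphisms of Lie modules. -/
instance : Category (FDLieMod L) where
  Hom V W := V →ₗ⁅ℂ,L⁆ W
  id V := LieModuleHom.id
  comp f g := LieModuleHom.comp g f

/-- The homomorphism of Lie modules underlying a morphism. -/
def toLie {V W : FDLieMod L} (f : V ⟶ W) : V →ₗ⁅ℂ,L⁆ W := f

/-- The morphism given by a homomorphism of Lie modules. -/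
def ofLie {V W : FDLieMod L} (f : V →ₗ⁅ℂ,L⁆ W) : V ⟶ W := f

theorem hom_ext {V W : FDLieMod L} {f g : V ⟶ W} (h : ∀ v, toLie f v = toLie g v) : f = g :=
  LieModuleHom.ext h

/-- The isomorphism given by an equivalence of Lie modules. -/
def isoOfEquiv {V W : FDLieMod L} (e : V ≃ₗ⁅ℂ,L⁆ W) : V ≅ W where
  hom := ofLie e
  inv := ofLie e.symm
  hom_inv_id := hom_ext fun v => e.symm_apply_apply v
  inv_hom_id := hom_ext fun v => e.apply_symm_apply v

instance : Preadditive (FDLieMod L) where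
  homGroup V W := inferInstanceAs (AddCommGroup (V →ₗ⁅ℂ,L⁆ W))
  add_comp _ _ _ f f' g := hom_ext fun v => map_add (toLie g) (toLie f v) (toLie f' v)
  comp_add _ _ _ _ _ _ := rfl

theorem toLie_sum {V W : FDLieMod L} {ι : Type} (s : Finset ι) (f : ι → (V ⟶ W)) (v : V) :
    toLie (∑ i ∈ s, f i) v = ∑ i ∈ s, toLie (f i) v :=
  map_sum ({ toFun := fun g => toLie g v, map_zero' := rfl, map_add' := fun _ _ => rfl } :
    (V ⟶ W) →+ W) f s

instance : Linear ℂ (FDLieMod L) where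
  homModule V W := inferInstanceAs (Module ℂ (V →ₗ⁅ℂ,L⁆ W))
  smul_comp _ _ _ r f g := hom_ext fun v => map_smul (toLie g) r (toLie f v)
  comp_smul _ _ _ _ _ _ := rfl

/-- The direct sum of finitely many modules. -/
def directSum {n : ℕ} (V : Fin n → FDLieMod L) : FDLieMod L where
  carrier := DirectSum (Fin n) fun i => V i
  finiteDimensional := inferInstance

instance : HasFiniteBiproducts (FDLieMod L) where
  out n :=
    { has_biproduct := fun V => hasBiproduct_of_total
        { pt := directSum V
          π := fun j => ofLie (DirectSum.lieModuleComponent ℂ (Fin n) L (fun i => V i) j)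
          ι := fun j => ofLie (DirectSum.lieModuleOf ℂ (Fin n) L (fun i => V i) j)
          ι_π := by
            intro i j
            split_ifs with h
            · subst h
              exact hom_ext fun v =>
                DirectSum.component.lof_self ℂ (M := fun i => (V i).carrier) i v
            · exact hom_ext fun v =>
                (DirectSum.component.of ℂ (M := fun i => (V i).carrier) j i v).trans (dif_neg h) }
        (by
          refine hom_ext fun v => ?_
          refine (toLie_sum Finset.univ _ v).trans ?_
          exact DirectSum.sum_univ_of (β := fun i => (V i).carrier) v) }

/-- The module `ℂ` with the zero action. -/
def triv : FDLieMod L where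
  carrier := TrivialLieModule ℂ L ℂ
  finiteDimensional := inferInstanceAs (FiniteDimensional ℂ ℂ)

/-- The dual module, `x` acting on functionals by `(x f)(v) = -f (x v)`. -/
def dual (V : FDLieMod L) : FDLieMod L where
  carrier := V →ₗ[ℂ] ℂ

/-- The tensor product over `ℂ`, `x` acting by `x ⊗ 1 + 1 ⊗ x`. -/
def tensor (V W : FDLieMod L) : FDLieMod L where
  carrier := TensorProduct ℂ V W

theorem map_lie_of_tmul {V W X : FDLieMod L} (f : TensorProduct ℂ V W →ₗ[ℂ] X)
    (h : ∀ (x : L) (v : V) (w : W),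
      f (⁅x, v⁆ ⊗ₜ[ℂ] w) + f (v ⊗ₜ[ℂ] ⁅x, w⁆) = ⁅x, f (v ⊗ₜ[ℂ] w)⁆)
    (x : L) (t : TensorProduct ℂ V W) : f ⁅x, t⁆ = ⁅x, f t⁆ := by
  induction t with
  | zero => simp
  | add a b ha hb => rw [lie_add, map_add, ha, hb, map_add, lie_add]
  | tmul v w => rw [TensorProduct.LieModule.lie_tmul_right, map_add, h]

/-- `(U ⊗ V) ⊗ W ≅ U ⊗ (V ⊗ W)`, the usual isomorphism of vector spaces. -/
def assocEquiv (U V W : FDLieMod L) :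
    tensor (tensor U V) W ≃ₗ⁅ℂ,L⁆ tensor U (tensor V W) :=
  { (TensorProduct.assoc ℂ U V W : _ ≃ₗ[ℂ] _) with
    map_lie' := by
      intro x t
      refine map_lie_of_tmul (V := tensor U V) (W := W) (X := tensor U (tensor V W))
        (TensorProduct.assoc ℂ U V W).toLinearMap ?_ x t
      intro x t w
      induction t using TensorProduct.induction_on with
      | zero =>
        change TensorProduct.assoc ℂ U V W (⁅x, (0 : TensorProduct ℂ U V)⁆ ⊗ₜ[ℂ] w) +
          TensorProduct.assoc ℂ U V W ((0 : TensorProduct ℂ U V) ⊗ₜ[ℂ] ⁅x, w⁆) =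
          ⁅x, TensorProduct.assoc ℂ U V W ((0 : TensorProduct ℂ U V) ⊗ₜ[ℂ] w)⁆
        simp
      | add a b ha hb =>
        change TensorProduct.assoc ℂ U V W (⁅x, a⁆ ⊗ₜ[ℂ] w) +
          TensorProduct.assoc ℂ U V W (a ⊗ₜ[ℂ] ⁅x, w⁆) =
          ⁅x, TensorProduct.assoc ℂ U V W (a ⊗ₜ[ℂ] w)⁆ at ha
        change TensorProduct.assoc ℂ U V W (⁅x, b⁆ ⊗ₜ[ℂ] w) +
          TensorProduct.assoc ℂ U V W (b ⊗ₜ[ℂ] ⁅x, w⁆) =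
          ⁅x, TensorProduct.assoc ℂ U V W (b ⊗ₜ[ℂ] w)⁆ at hb
        change TensorProduct.assoc ℂ U V W (⁅x, a + b⁆ ⊗ₜ[ℂ] w) +
          TensorProduct.assoc ℂ U V W ((a + b) ⊗ₜ[ℂ] ⁅x, w⁆) =
          ⁅x, TensorProduct.assoc ℂ U V W ((a + b) ⊗ₜ[ℂ] w)⁆
        rw [lie_add, TensorProduct.add_tmul, TensorProduct.add_tmul, TensorProduct.add_tmul,
          map_add, map_add, map_add, lie_add, ← ha, ← hb]
        abel
      | tmul u v =>
        change TensorProduct.assoc ℂ U V W (⁅x, u ⊗ₜ[ℂ] v⁆ ⊗ₜ[ℂ] w) +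
          TensorProduct.assoc ℂ U V W ((u ⊗ₜ[ℂ] v) ⊗ₜ[ℂ] ⁅x, w⁆) =
          ⁅x, u ⊗ₜ[ℂ] (v ⊗ₜ[ℂ] w)⁆
        simp only [TensorProduct.LieModule.lie_tmul_right, TensorProduct.add_tmul, map_add,
          TensorProduct.assoc_tmul, TensorProduct.tmul_add]
        abel }

/-- `ℂ ⊗ V ≅ V`, the usual isomorphism of vector spaces. -/
def lidEquiv (V : FDLieMod L) : tensor triv V ≃ₗ⁅ℂ,L⁆ V :=
  { (TensorProduct.lid ℂ V : _ ≃ₗ[ℂ] _) with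
    map_lie' := by
      intro x t
      refine map_lie_of_tmul (V := triv) (W := V) (X := V)
        (TensorProduct.lid ℂ V).toLinearMap ?_ x t
      intro x c v
      change (0 : ℂ) • v + (show ℂ from c) • ⁅x, v⁆ = ⁅x, (show ℂ from c) • v⁆
      rw [zero_smul, zero_add, lie_smul] }

/-- `V ⊗ ℂ ≅ V`, the usual isomorphism of vector spaces. -/
def ridEquiv (V : FDLieMod L) : tensor V triv ≃ₗ⁅ℂ,L⁆ V :=
  { (TensorProduct.rid ℂ V : _ ≃ₗ[ℂ] _) with
    map_lie' := by
      intro x t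
      refine map_lie_of_tmul (V := V) (W := triv) (X := V)
        (TensorProduct.rid ℂ V).toLinearMap ?_ x t
      intro x v c
      change (show ℂ from c) • ⁅x, v⁆ + (0 : ℂ) • v = ⁅x, (show ℂ from c) • v⁆
      rw [zero_smul, add_zero, lie_smul] }

instance : MonoidalCategoryStruct (FDLieMod L) where
  tensorObj := tensor
  whiskerLeft V {W X} f :=
    ofLie (V := tensor V W) (W := tensor V X)
      (TensorProduct.LieModule.map (LieModuleHom.id (M := V)) (toLie f))
  whiskerRight {V W} f X :=
    ofLie (V := tensor V X) (W := tensor W X)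
      (TensorProduct.LieModule.map (toLie f) (LieModuleHom.id (M := X)))
  tensorHom {V W X Y} f g :=
    ofLie (V := tensor V X) (W := tensor W Y)
      (TensorProduct.LieModule.map (toLie f) (toLie g))
  tensorUnit := triv
  associator U V W := isoOfEquiv (assocEquiv U V W)
  leftUnitor V := isoOfEquiv (lidEquiv V)
  rightUnitor V := isoOfEquiv (ridEquiv V)

/-- The pure tensor `v ⊗ w`, as an element of the object `V ⊗ W`. -/
def tmul {V W : FDLieMod L} (v : V) (w : W) : (V ⊗ W : FDLieMod L) :=
  (v ⊗ₜ[ℂ] w : TensorProduct ℂ V W)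

theorem tensor_induction {V W : FDLieMod L} {p : (V ⊗ W : FDLieMod L) → Prop}
    (zero : p 0) (tm : ∀ v w, p (tmul v w)) (add : ∀ a b, p a → p b → p (a + b)) (t) : p t :=
  TensorProduct.induction_on (motive := p) t zero tm add

theorem tensor_hom_ext {U V W : FDLieMod L} {f g : U ⊗ V ⟶ W}
    (h : ∀ (u : U) (v : V), toLie f (tmul u v) = toLie g (tmul u v)) : f = g :=
  hom_ext (tensor_induction (by simp) h fun a b ha hb => by simp only [map_add, ha, hb])

theorem tensor_hom_ext₃ {U V W X : FDLieMod L} {f g : (U ⊗ V) ⊗ W ⟶ X}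
    (h : ∀ u v w, toLie f (tmul (tmul u v) w) = toLie g (tmul (tmul u v) w)) : f = g := by
  refine tensor_hom_ext fun t w => ?_
  refine tensor_induction (p := fun t => toLie f (tmul t w) = toLie g (tmul t w)) ?_
    (fun u v => h u v w) ?_ t
  · rw [show tmul (0 : (U ⊗ V : FDLieMod L)) w = 0 from TensorProduct.zero_tmul _ _]
    simp
  · intro a b ha hb
    rw [show tmul (a + b) w = tmul a w + tmul b w from TensorProduct.add_tmul _ _ _]
    simp only [map_add, ha, hb]

theorem tensor_hom_ext₄ {U V W X Y : FDLieMod L} {f g : ((U ⊗ V) ⊗ W) ⊗ X ⟶ Y}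
    (h : ∀ u v w x, toLie f (tmul (tmul (tmul u v) w) x) =
      toLie g (tmul (tmul (tmul u v) w) x)) : f = g := by
  refine tensor_hom_ext₃ fun t w x => ?_
  refine tensor_induction
    (p := fun t => toLie f (tmul (tmul t w) x) = toLie g (tmul (tmul t w) x)) ?_
    (fun u v => h u v w x) ?_ t
  · rw [show tmul (0 : (U ⊗ V : FDLieMod L)) w = 0 from TensorProduct.zero_tmul _ _,
      show tmul (0 : ((U ⊗ V) ⊗ W : FDLieMod L)) x = 0 from TensorProduct.zero_tmul _ _]
    simp
  · intro a b ha hb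
    rw [show tmul (a + b) w = tmul a w + tmul b w from TensorProduct.add_tmul _ _ _,
      show tmul (tmul a w + tmul b w) x = tmul (tmul a w) x + tmul (tmul b w) x from
        TensorProduct.add_tmul _ _ _]
    simp only [map_add, ha, hb]

instance : MonoidalCategory (FDLieMod L) where
  tensorHom_def _ _ := tensor_hom_ext fun _ _ => rfl
  id_tensorHom_id _ _ := tensor_hom_ext fun _ _ => rfl
  tensorHom_comp_tensorHom _ _ _ _ := tensor_hom_ext fun _ _ => rfl
  whiskerLeft_id _ _ := tensor_hom_ext fun _ _ => rfl
  id_whiskerRight _ _ := tensor_hom_ext fun _ _ => rfl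
  associator_naturality _ _ _ := tensor_hom_ext₃ fun _ _ _ => rfl
  leftUnitor_naturality f := tensor_hom_ext fun c v =>
    (map_smul (toLie f) (show ℂ from c) v).symm
  rightUnitor_naturality f := tensor_hom_ext fun v c =>
    (map_smul (toLie f) (show ℂ from c) v).symm
  pentagon _ _ _ _ := tensor_hom_ext₄ fun _ _ _ _ => rfl
  triangle _ _ := tensor_hom_ext₃ fun v c w =>
    TensorProduct.tmul_smul (show ℂ from c) v w |>.trans
      (TensorProduct.smul_tmul' (show ℂ from c) v w)

end FDLieMod

/-! ### The Lie algebra `𝔰𝔩₃` and its natural module -/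

/-- The Lie algebra of traceless complex `3 × 3` matrices. -/
abbrev Sl3 : Type := LieAlgebra.SpecialLinear.sl (Fin 3) ℂ

/-- The monoidal category of finite dimensional `𝔰𝔩₃`-modules. -/
abbrev FinSl3 : Type 1 := FDLieMod Sl3

/-- The natural module `ℂ³`, matrices acting on column vectors. -/
def natF : FinSl3 where
  carrier := Fin 3 → ℂ

/-! ### Module categories -/

section ModuleCategories

attribute [local instance] hasBinaryBiproducts_of_finite_biproducts

variable (C : Type*) [Category* C] [MonoidalCategory C] [Preadditive C] [Linear ℂ C]
variable (M : Type*) [Category* M] [Preadditive M] [Linear ℂ M]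

/-- The action bifunctor `C × M ⥤ M` is `ℂ`-bilinear on morphisms. -/
class IsBilinearAction [MonoidalLeftAction C M] : Prop where
  actionHomRight_add (c : C) {X Y : M} (f g : X ⟶ Y) : c ⊴ₗ (f + g) = c ⊴ₗ f + c ⊴ₗ g
  actionHomRight_smul (c : C) {X Y : M} (r : ℂ) (f : X ⟶ Y) : c ⊴ₗ (r • f) = r • (c ⊴ₗ f)
  add_actionHomLeft {c d : C} (f g : c ⟶ d) (X : M) : (f + g) ⊵ₗ X = f ⊵ₗ X + g ⊵ₗ X
  smul_actionHomLeft {c d : C} (r : ℂ) (f : c ⟶ d) (X : M) : (r • f) ⊵ₗ X = r • (f ⊵ₗ X)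

/-- Isomorphism of indecomposable objects. -/
def indecSetoid [HasFiniteBiproducts M] : Setoid {X : M // Indecomposable X} :=
  (isIsomorphicSetoid M).comap Subtype.val

/-- Isomorphism classes of indecomposable objects. -/
def IndecClass [HasFiniteBiproducts M] : Type _ := Quotient (indecSetoid M)

variable {M} in
/-- A chosen representative of an isomorphism class of indecomposable objects. -/
def IndecClass.rep [HasFiniteBiproducts M] (i : IndecClass M) : M := (Quotient.out i).1

/-- Every object is a finite direct sum of objects with local endomorphism rings. -/
def IsKrullSchmidt [HasFiniteBiproducts M] : Prop :=
  ∀ X : M, ∃ (n : ℕ) (Y : Fin n → M), (∀ i, IsLocalRing (End (Y i))) ∧ Nonempty (X ≅ ⨁ Y)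

/-- The conditions on the underlying category of a locally finitary module category. -/
structure IsLocallyFinitary [HasFiniteBiproducts M] : Prop where
  idempotentComplete : IsIdempotentComplete M
  krullSchmidt : IsKrullSchmidt M
  countable : Countable (IndecClass M)
  finiteDimensional (X Y : M) : FiniteDimensional ℂ (X ⟶ Y)

/-- Admissible: locally finitary with weak kernels. -/
structure IsAdmissible [HasFiniteBiproducts M] : Prop extends IsLocallyFinitary M where
  hasWeakKernels : HasWeakKernels M

/-- A two-sided ideal of a `ℂ`-linear category. -/
structure CatIdeal where
  homs (X Y : M) : Submodule ℂ (X ⟶ Y)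
  precomp_mem {X Y Z : M} (g : X ⟶ Y) {f : Y ⟶ Z} (hf : f ∈ homs Y Z) : g ≫ f ∈ homs X Z
  postcomp_mem {X Y Z : M} {f : X ⟶ Y} (hf : f ∈ homs X Y) (g : Y ⟶ Z) : f ≫ g ∈ homs X Z

variable {M} in
/-- The ideal is stable under the action of all objects of `C`. -/
def CatIdeal.IsStable [MonoidalLeftAction C M] (I : CatIdeal M) : Prop :=
  ∀ (c : C) {X Y : M} (f : X ⟶ Y), f ∈ I.homs X Y → c ⊴ₗ f ∈ I.homs (c ⊙ₗ X) (c ⊙ₗ Y)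

/-- Simple: non-zero, and the only `C`-stable ideals are zero and the whole category. -/
structure IsSimpleModuleCategory [MonoidalLeftAction C M] : Prop where
  nonzero : ∃ X : M, ¬ IsZero X
  eq_bot_or_eq_top (I : CatIdeal M) (hI : I.IsStable C) :
    (∀ X Y : M, I.homs X Y = ⊥) ∨ (∀ X Y : M, I.homs X Y = ⊤)

variable {M} in
/-- The multiplicity of `X` as a direct summand of `Y`: the largest `n` such that `Xⁿ` is
a direct summand of `Y`. -/
def summandMultiplicity [HasFiniteBiproducts M] (X Y : M) : ℕ :=
  sSup {n : ℕ | ∃ Z : M, Nonempty (Y ≅ (⨁ fun _ : Fin n => X) ⊞ Z)}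

variable {C} in
/-- The action matrix `[c]`: its `(i, j)` entry is the multiplicity of `X_i` in `c X_j`. -/
def actionMatrix [HasFiniteBiproducts M] [MonoidalLeftAction C M] (c : C) :
    Matrix (IndecClass M) (IndecClass M) ℕ :=
  fun i j => summandMultiplicity i.rep (c ⊙ₗ j.rep)

/-- An oriented graph with vertex set `V` and finitely many edges from any vertex to any other:
`edges a b` is the number of edges from `a` to `b`. -/
structure OrientedMultigraph (V : Type*) where
  edges : V → V → ℕ

/-- Isomorphism of oriented graphs. -/
def OrientedMultigraph.Isomorphic {V W : Type*} (Γ : OrientedMultigraph V)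
    (Δ : OrientedMultigraph W) : Prop :=
  ∃ σ : V ≃ W, ∀ a b, Δ.edges (σ a) (σ b) = Γ.edges a b

variable {C} in
/-- The graph `Γ_c`, with `[c]_{i,j}` edges from `j` to `i`. -/
def actionGraph [HasFiniteBiproducts M] [MonoidalLeftAction C M] (c : C) :
    OrientedMultigraph (IndecClass M) where
  edges j i := actionMatrix M c i j

/-- Equivalence of `C`-module categories: a `ℂ`-linear functor that is an equivalence of
categories and carries the structure of a (strong) `C`-module functor. -/
def ModuleCategoriesEquivalent (N : Type*) [Category* N] [Preadditive N] [Linear ℂ N]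
    [MonoidalLeftAction C M] [MonoidalLeftAction C N] : Prop :=
  ∃ Φ : M ⥤ N, Φ.IsEquivalence ∧ Φ.Additive ∧ Φ.Linear ℂ ∧ Nonempty (Φ.LeftLinear C)

end ModuleCategories

/-- The graph of a module category over finite dimensional `𝔰𝔩₃`-modules. -/
def moduleGraph (M : Type*) [Category* M] [Preadditive M] [HasFiniteBiproducts M]
    [MonoidalLeftAction FinSl3 M] : OrientedMultigraph (IndecClass M) :=
  actionGraph M natF

/-- The dual graph of a module category over finite dimensional `𝔰𝔩₃`-modules. -/
def moduleDualGraph (M : Type*) [Category* M] [Preadditive M] [HasFiniteBiproducts M]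
    [MonoidalLeftAction FinSl3 M] : OrientedMultigraph (IndecClass M) :=
  actionGraph M natF.dual

end

/-! The category of finite dimensional `Sl3`-modules is semisimple, its simple objects have duals,
and every simple object is a summand of some tensor power of `natF`. These facts turn the graph into
enough information to reconstruct the module category.

Let `σ` be the graph isomorphism and let X be the indecomposable object matching the trivial module.
The equivalence will be the module functor V ↦ V X. Iterating the graph, the n-th tensor power of F
acts on X with the same multiplicities, transported by `σ`, as those of the power itself. So both
have equally many indecomposable summands. A simple V cannot annihilate X, because the trivial
module is a summand of V* ⊗ V; hence each simple summand of the power contributes at least one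
summand, and equality of the counts forces exactly one. Thus V X is indecomposable for every simple
V (`exists_indecMult_actionObj_eq_single`), and its class defines a map `π`. The maps `π` and `σ`
have the same image on the simple constituents of each tensor power. This gives surjectivity of `π`,
and injectivity on each such set; duality upgrades the latter to global injectivity.

Full faithfulness comes from simplicity of the module category. The stable ideal generated by a
nonzero r : V X ⟶ W X contains the identity of the object 1 X (1 the trivial module), so some simple
K makes 1 X split off through K r. Then K is dual to both V and W, so V ≅ W
(`eq_of_actionObj_hom_ne_zero`). When V = W, compressing K r to the unique copy of 1 X in K V X and
comparing eigenvalues shows that r is invertible (`isIso_of_actionObj_end_ne_zero`); over ℂ the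
endomorphisms of V X are therefore scalars (`actRight_map_bijective`).

The representation theory is built from highest weight vectors. Weyl's theorem
(`sSup_irreducible_eq_top`) uses that the Casimir eigenvalue separates a dominant weight from the
dominant weights strictly below it. -/

noncomputable section

attribute [local instance] hasBinaryBiproducts_of_finite_biproducts

/-! ### Objects with local endomorphism rings -/

section LocalObjects

variable {M : Type*} [Category* M] [Preadditive M]

/-- Normalizing by the inverse writes 1 as a sum of two elements of a local ring. This is the form
in which locality is used: it makes radical morphisms a subspace and lets a splitting pass to one
term of a sum. -/
theorem isIso_or_isIso_of_isIso_add {X Y : M} [IsLocalRing (End X)] {f g : X ⟶ Y}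
    {b : Y ⟶ X} (h : IsIso ((f + g) ≫ b)) : IsIso (f ≫ b) ∨ IsIso (g ≫ b) := by
  have hs : (show End X from f ≫ b ≫ inv ((f + g) ≫ b)) +
      (show End X from g ≫ b ≫ inv ((f + g) ≫ b)) = 1 := by
    change f ≫ b ≫ inv ((f + g) ≫ b) + g ≫ b ≫ inv ((f + g) ≫ b) = 𝟙 X
    rw [← Preadditive.add_comp, ← Category.assoc]
    exact IsIso.hom_inv_id ((f + g) ≫ b)
  rcases IsLocalRing.isUnit_or_isUnit_of_add_one hs with h1 | h1 <;>
    rw [isUnit_iff_isIso, ← Category.assoc] at h1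
  · exact Or.inl (IsIso.of_isIso_comp_right _ (inv ((f + g) ≫ b)))
  · exact Or.inr (IsIso.of_isIso_comp_right _ (inv ((f + g) ≫ b)))

theorem not_isIso_zero_end (X : M) [IsLocalRing (End X)] : ¬ IsIso (0 : X ⟶ X) := fun h =>
  zero_ne_one (α := End X) (by
    change (0 : X ⟶ X) = 𝟙 X
    rw [← IsIso.hom_inv_id (0 : X ⟶ X), zero_comp])

/-- A retract of an object with local endomorphism ring is isomorphic to it. -/
theorem isIso_of_isIso_comp {X Y : M} [IsLocalRing (End X)] [IsLocalRing (End Y)]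
    (a : X ⟶ Y) (b : Y ⟶ X) (h : IsIso (a ≫ b)) : IsIso a := by
  let e : Y ⟶ Y := b ≫ inv (a ≫ b) ≫ a
  have hae : a ≫ e = a := by
    change a ≫ b ≫ inv (a ≫ b) ≫ a = a
    rw [← Category.assoc, ← Category.assoc, IsIso.hom_inv_id, Category.id_comp]
  have hee : e ≫ e = e := by
    change (b ≫ inv (a ≫ b) ≫ a) ≫ e = e
    rw [Category.assoc, Category.assoc, hae]
  have hs : (show End Y from e) + (show End Y from 𝟙 Y - e) = 1 := by
    change e + (𝟙 Y - e) = 𝟙 Y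
    abel
  rcases IsLocalRing.isUnit_or_isUnit_of_add_one hs with h1 | h1 <;> rw [isUnit_iff_isIso] at h1
  · have h1' : IsIso e := h1
    have he : e = 𝟙 Y := by rw [← cancel_epi e, hee, Category.comp_id]
    refine ⟨b ≫ inv (a ≫ b), ?_, ?_⟩
    · rw [← Category.assoc, IsIso.hom_inv_id]
    · rw [Category.assoc]; exact he
  · have h1' : IsIso (𝟙 Y - e) := h1
    have he : e = 0 := by
      rw [← cancel_mono (𝟙 Y - e), Preadditive.comp_sub, hee, Category.comp_id, sub_self, zero_comp]
    have ha : a = 0 := by rw [← hae, he, comp_zero]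
    rw [ha, zero_comp] at h
    exact (not_isIso_zero_end X h).elim

theorem isLocalRing_end_of_iso {X Y : M} (e : X ≅ Y) [IsLocalRing (End X)] :
    IsLocalRing (End Y) where
  exists_pair_ne := by
    refine ⟨0, 1, fun h => not_isIso_zero_end X ?_⟩
    have h' : (0 : Y ⟶ Y) = 𝟙 Y := h
    have : (0 : X ⟶ X) = 𝟙 X := by
      rw [← e.hom_inv_id, ← Category.comp_id e.hom, ← h', comp_zero, zero_comp]
    rw [this]; infer_instance
  isUnit_or_isUnit_of_add_one {a b} h := by
    have hab : (show Y ⟶ Y from a) + (show Y ⟶ Y from b) = 𝟙 Y := h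
    have hs : (show End X from e.hom ≫ a ≫ e.inv) + (show End X from e.hom ≫ b ≫ e.inv) = 1 := by
      change e.hom ≫ a ≫ e.inv + e.hom ≫ b ≫ e.inv = 𝟙 X
      rw [← Preadditive.comp_add, ← Preadditive.add_comp, hab]; simp
    simp only [isUnit_iff_isIso]
    rcases IsLocalRing.isUnit_or_isUnit_of_add_one hs with h1 | h1 <;> rw [isUnit_iff_isIso] at h1
    · left
      have h1' : IsIso (e.hom ≫ (show Y ⟶ Y from a) ≫ e.inv) := h1
      have := IsIso.of_isIso_comp_left e.hom ((show Y ⟶ Y from a) ≫ e.inv)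
      exact IsIso.of_isIso_comp_right _ e.inv
    · right
      have h1' : IsIso (e.hom ≫ (show Y ⟶ Y from b) ≫ e.inv) := h1
      have := IsIso.of_isIso_comp_left e.hom ((show Y ⟶ Y from b) ≫ e.inv)
      exact IsIso.of_isIso_comp_right _ e.inv

variable [HasFiniteBiproducts M]

/-- The projectors onto two summands add up to 1, so one of them is invertible; since it kills the
other summand, that summand is zero. -/
theorem indecomposable_of_isLocalRing_end (X : M) [IsLocalRing (End X)] : Indecomposable X := by
  refine ⟨fun h => not_isIso_zero_end X ?_, fun Y Z e => ?_⟩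
  · rw [h.eq_of_src 0 (𝟙 X)]; infer_instance
  · let p : X ⟶ X := e.hom ≫ biprod.fst ≫ biprod.inl ≫ e.inv
    let q : X ⟶ X := e.hom ≫ biprod.snd ≫ biprod.inr ≫ e.inv
    have hs : (show End X from p) + (show End X from q) = 1 := by
      change e.hom ≫ biprod.fst ≫ biprod.inl ≫ e.inv + e.hom ≫ biprod.snd ≫ biprod.inr ≫ e.inv = 𝟙 X
      rw [← Preadditive.comp_add, ← Category.assoc biprod.fst, ← Category.assoc biprod.snd,
        ← Preadditive.add_comp, biprod.total]; simp
    rcases IsLocalRing.isUnit_or_isUnit_of_add_one hs with h1 | h1 <;> rw [isUnit_iff_isIso] at h1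
    · right
      have h1' : IsIso p := h1
      have hz : (biprod.inr ≫ e.inv) ≫ p = 0 := by simp [p]
      have h0 : biprod.inr ≫ e.inv = (0 : Z ⟶ X) := by
        rw [← cancel_mono p, hz, zero_comp]
      rw [IsZero.iff_id_eq_zero]
      have : 𝟙 Z = (biprod.inr ≫ e.inv) ≫ e.hom ≫ (biprod.snd : Y ⊞ Z ⟶ Z) := by simp
      rw [this, h0, zero_comp]
    · left
      have h1' : IsIso q := h1
      have hz : (biprod.inl ≫ e.inv) ≫ q = 0 := by simp [q]
      have h0 : biprod.inl ≫ e.inv = (0 : Y ⟶ X) := by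
        rw [← cancel_mono q, hz, zero_comp]
      rw [IsZero.iff_id_eq_zero]
      have : 𝟙 Y = (biprod.inl ≫ e.inv) ≫ e.hom ≫ (biprod.fst : Y ⊞ Z ⟶ Y) := by simp
      rw [this, h0, zero_comp]

/-- A biproduct over `Fin (n + 1)` splits off its first summand. -/
def biproductFinSuccIso {n : ℕ} (Y : Fin (n + 1) → M) :
    (⨁ Y) ≅ Y 0 ⊞ (⨁ fun k : Fin n => Y k.succ) where
  hom := biprod.lift (biproduct.π Y 0) (biproduct.lift fun k => biproduct.π Y k.succ)
  inv := biprod.desc (biproduct.ι Y 0) (biproduct.desc fun k => biproduct.ι Y k.succ)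
  hom_inv_id := by
    rw [biprod.lift_desc, biproduct.lift_desc, ← biproduct.total, Fin.sum_univ_succ]
  inv_hom_id := by
    ext
    · simp
    · simp [(Fin.succ_ne_zero _).symm]
    · simp [Fin.succ_ne_zero]
    · simp [biproduct.ι_π]

theorem isZero_biproduct_fin_zero (Y : Fin 0 → M) : IsZero (⨁ Y) := by
  rw [IsZero.iff_id_eq_zero]
  exact biproduct.hom_ext _ _ fun j => j.elim0

end LocalObjects

/-! ### Multiplicities in Krull–Schmidt categories -/

section Multiplicity

variable {M : Type*} [Category* M] [Preadditive M] [Linear ℂ M]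

/-- The radical morphisms out of an object with local endomorphism ring. -/
def radHom (X Y : M) [IsLocalRing (End X)] : Submodule ℂ (X ⟶ Y) where
  carrier := {f | ∀ g : Y ⟶ X, ¬ IsIso (f ≫ g)}
  zero_mem' g := by rw [zero_comp]; exact not_isIso_zero_end X
  add_mem' {a b} ha hb g h := (isIso_or_isIso_of_isIso_add h).elim (ha g) (hb g)
  smul_mem' c f hf g h := hf (c • g) (by rwa [Linear.comp_smul, ← Linear.smul_comp])

theorem mem_radHom {X Y : M} [IsLocalRing (End X)] {f : X ⟶ Y} :
    f ∈ radHom X Y ↔ ∀ g : Y ⟶ X, ¬ IsIso (f ≫ g) := Iff.rfl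

theorem comp_mem_radHom {X Y Z : M} [IsLocalRing (End X)] {f : X ⟶ Y} (hf : f ∈ radHom X Y)
    (g : Y ⟶ Z) : f ≫ g ∈ radHom X Z := fun k => by
  rw [Category.assoc]; exact hf _

/-- The multiplicity of an object with local endomorphism ring in another object. -/
def localMult (X Y : M) [IsLocalRing (End X)] : ℕ := Module.finrank ℂ ((X ⟶ Y) ⧸ radHom X Y)

theorem localMult_congr {X Y Z : M} [IsLocalRing (End X)] (e : Y ≅ Z) :
    localMult X Y = localMult X Z := by
  refine (Submodule.Quotient.equiv (radHom X Y) (radHom X Z) (Linear.homCongr ℂ (Iso.refl X) e) ?_).finrank_eq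
  ext f
  constructor
  · rintro ⟨g, hg, rfl⟩
    have : Linear.homCongr ℂ (Iso.refl X) e g = g ≫ e.hom := by simp [Linear.homCongr_apply]
    exact this ▸ comp_mem_radHom hg e.hom
  · intro hf
    exact ⟨f ≫ e.inv, comp_mem_radHom hf e.inv, by
      have : Linear.homCongr ℂ (Iso.refl X) e (f ≫ e.inv) = f := by simp [Linear.homCongr_apply]
      exact this⟩

theorem localMult_eq_zero {X Y : M} [IsLocalRing (End X)] [IsLocalRing (End Y)]
    (h : IsEmpty (X ≅ Y)) : localMult X Y = 0 := by
  have : radHom X Y = ⊤ := by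
    rw [eq_top_iff]
    intro f _ g hg
    have := isIso_of_isIso_comp f g hg
    exact h.elim (asIso f)
  rw [localMult, this]
  have := Submodule.Quotient.subsingleton_iff.2 (rfl : (⊤ : Submodule ℂ (X ⟶ Y)) = ⊤)
  exact Module.finrank_zero_of_subsingleton

theorem localMult_of_isZero {X Y : M} [IsLocalRing (End X)] (h : IsZero Y) :
    localMult X Y = 0 := by
  have : Subsingleton (X ⟶ Y) := ⟨fun f g => h.eq_of_tgt f g⟩
  have : Subsingleton ((X ⟶ Y) ⧸ radHom X Y) := (Submodule.mkQ_surjective _).subsingleton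
  exact Module.finrank_zero_of_subsingleton

section FiniteHoms

variable [hfd : ∀ X Y : M, Module.Finite ℂ (X ⟶ Y)]

/-- Every endomorphism of a nonzero object has an eigenvalue. -/
theorem exists_not_isIso_sub_smul (X : M) [Nontrivial (End X)] (f : X ⟶ X) :
    ∃ c : ℂ, ¬ IsIso (f - c • 𝟙 X) := by
  have : FiniteDimensional ℂ (End X) := hfd X X
  obtain ⟨c, hc⟩ := spectrum.nonempty_of_isAlgClosed_of_finiteDimensional ℂ (show End X from f)
  refine ⟨c, fun h => ?_⟩
  rw [spectrum.mem_iff] at hc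
  apply hc
  rw [← IsUnit.neg_iff, neg_sub, isUnit_iff_isIso]
  rw [Algebra.algebraMap_eq_smul_one]
  exact h

/-- Subtracting an eigenvalue makes any endomorphism radical, so the residue field is ℂ. This is why
the dimension of Hom modulo radical counts copies. -/
theorem localMult_self (X : M) [IsLocalRing (End X)] : localMult X X = 1 := by
  refine finrank_eq_one (Submodule.Quotient.mk (𝟙 X)) ?_ ?_
  · rw [Ne, Submodule.Quotient.mk_eq_zero]
    intro h
    refine h (𝟙 X) ?_
    rw [Category.comp_id]
    infer_instance
  · intro w
    obtain ⟨f, rfl⟩ := Submodule.Quotient.mk_surjective _ w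
    obtain ⟨c, hc⟩ := exists_not_isIso_sub_smul X f
    refine ⟨c, ?_⟩
    rw [← Submodule.Quotient.mk_smul]
    symm
    rw [Submodule.Quotient.eq]
    intro g hg
    exact hc (isIso_of_isIso_comp _ g hg)

variable [HasFiniteBiproducts M]

/-- The radical is componentwise: an automorphism of X through Y ⊞ Z is a sum of maps through Y and
through Z, one of which is invertible. -/
theorem localMult_biprod (X Y Z : M) [IsLocalRing (End X)] :
    localMult X (Y ⊞ Z) = localMult X Y + localMult X Z := by
  let φ : (X ⟶ Y ⊞ Z) →ₗ[ℂ] ((X ⟶ Y) ⧸ radHom X Y) × ((X ⟶ Z) ⧸ radHom X Z) :=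
    LinearMap.prod ((radHom X Y).mkQ ∘ₗ Linear.rightComp ℂ X (biprod.fst : Y ⊞ Z ⟶ Y))
      ((radHom X Z).mkQ ∘ₗ Linear.rightComp ℂ X (biprod.snd : Y ⊞ Z ⟶ Z))
  have hφ : Function.Surjective φ := by
    rintro ⟨y, z⟩
    obtain ⟨f, rfl⟩ := Submodule.Quotient.mk_surjective _ y
    obtain ⟨g, rfl⟩ := Submodule.Quotient.mk_surjective _ z
    exact ⟨biprod.lift f g, by simp [φ]⟩
  have hk : LinearMap.ker φ = radHom X (Y ⊞ Z) := by
    ext f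
    simp only [φ, LinearMap.mem_ker, LinearMap.prod_apply, Function.prod, Prod.mk_eq_zero,
      LinearMap.comp_apply, Submodule.mkQ_apply, Submodule.Quotient.mk_eq_zero,
      Linear.rightComp_apply]
    constructor
    · rintro ⟨h1, h2⟩ g hg
      have : IsIso ((f ≫ biprod.fst ≫ biprod.inl + f ≫ biprod.snd ≫ biprod.inr) ≫ g) := by
        rwa [← Preadditive.comp_add, biprod.total, Category.comp_id]
      rcases isIso_or_isIso_of_isIso_add this with h | h
      · exact h1 (biprod.inl ≫ g) (by simpa using h)
      · exact h2 (biprod.inr ≫ g) (by simpa using h)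
    · exact fun h => ⟨comp_mem_radHom h _, comp_mem_radHom h _⟩
  rw [localMult, ← hk, (φ.quotKerEquivOfSurjective hφ).finrank_eq, Module.finrank_prod]
  rfl

theorem localMult_biproduct_const (X : M) [IsLocalRing (End X)] (n : ℕ) :
    localMult X (⨁ fun _ : Fin n => X) = n := by
  induction n with
  | zero => exact localMult_of_isZero (isZero_biproduct_fin_zero _)
  | succ n ih =>
    rw [localMult_congr (biproductFinSuccIso _), localMult_biprod, localMult_self, ih, add_comm]

end FiniteHoms

end Multiplicity

/-! ### Multiplicity vectors of objects and their additivity -/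

section KrullSchmidt

variable {M : Type*} [Category* M] [Preadditive M] [HasFiniteBiproducts M]

theorem IndecClass.indecomposable_rep (i : IndecClass M) : Indecomposable i.rep :=
  (Quotient.out i).2

theorem IndecClass.eq_of_iso {i j : IndecClass M} (e : i.rep ≅ j.rep) : i = j :=
  Quotient.out_equiv_out.1 (show (indecSetoid M) _ _ from ⟨e⟩)

theorem IndecClass.exists_iso {X : M} (hX : Indecomposable X) :
    ∃ i : IndecClass M, Nonempty (X ≅ i.rep) :=
  ⟨Quotient.mk (indecSetoid M) ⟨X, hX⟩,
    (indecSetoid M).symm (Quotient.mk_out (s := indecSetoid M) ⟨X, hX⟩)⟩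

variable [hks : Fact (IsKrullSchmidt M)]

theorem isLocalRing_end_of_indecomposable {X : M} (hX : Indecomposable X) :
    IsLocalRing (End X) := by
  obtain ⟨n, Y, hY, ⟨e⟩⟩ := hks.out X
  rcases n with _ | n
  · exact (hX.1 ((isZero_biproduct_fin_zero Y).of_iso e)).elim
  · have := hY 0
    rcases hX.2 _ _ (e ≪≫ biproductFinSuccIso Y) with h | h
    · exact ((indecomposable_of_isLocalRing_end (Y 0)).1 h).elim
    · exact isLocalRing_end_of_iso (isoBiprodZero h ≪≫ (biproductFinSuccIso Y).symm ≪≫ e.symm)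

instance (i : IndecClass M) : IsLocalRing (End i.rep) :=
  isLocalRing_end_of_indecomposable i.indecomposable_rep

/-- Induction over decompositions into indecomposable objects. -/
theorem krullSchmidt_induction {P : M → Prop} (iso : ∀ X Y, (X ≅ Y) → P X → P Y)
    (zero : ∀ X, IsZero X → P X) (add : ∀ (i : IndecClass M) Y, P Y → P (i.rep ⊞ Y)) (X : M) :
    P X := by
  obtain ⟨n, Y, hY, ⟨e⟩⟩ := hks.out X
  refine iso _ _ e.symm ?_
  clear e
  induction n with
  | zero => exact zero _ (isZero_biproduct_fin_zero Y)
  | succ n ih =>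
    have := hY 0
    obtain ⟨i, ⟨f⟩⟩ := IndecClass.exists_iso (indecomposable_of_isLocalRing_end (Y 0))
    exact iso _ _ (biprod.mapIso f.symm (Iso.refl _) ≪≫ (biproductFinSuccIso Y).symm)
      (add i _ (ih _ fun k => hY k.succ))

variable [Linear ℂ M]

variable [hfd : ∀ X Y : M, Module.Finite ℂ (X ⟶ Y)]

theorem localMult_rep_rep [DecidableEq (IndecClass M)] (i j : IndecClass M) :
    localMult i.rep j.rep = if j = i then 1 else 0 := by
  split_ifs with h
  · subst h; exact localMult_self _
  · exact localMult_eq_zero ⟨fun e => h (IndecClass.eq_of_iso e).symm⟩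

theorem finite_support_localMult (Y : M) :
    (Function.support fun i : IndecClass M => localMult i.rep Y).Finite := by
  classical
  induction Y using krullSchmidt_induction with
  | iso X Y e h => simpa only [localMult_congr e] using h
  | zero X h => simp [localMult_of_isZero h]
  | add i Y h =>
    refine (h.union (Set.finite_singleton i)).subset fun j hj => ?_
    simp only [Function.mem_support, localMult_biprod, localMult_rep_rep] at hj
    by_cases hij : i = j
    · right; exact hij.symm
    · left; simpa [hij] using hj

/-- The multiplicities of all indecomposable objects in a given object. -/
def indecMult (Y : M) : IndecClass M →₀ ℕ :=
  Finsupp.ofSupportFinite (fun i => localMult i.rep Y) (finite_support_localMult Y)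

theorem indecMult_apply (Y : M) (i : IndecClass M) : indecMult Y i = localMult i.rep Y := rfl

theorem indecMult_congr {Y Z : M} (e : Y ≅ Z) : indecMult Y = indecMult Z :=
  Finsupp.ext fun _ => localMult_congr e

theorem indecMult_of_isZero {Y : M} (h : IsZero Y) : indecMult Y = 0 :=
  Finsupp.ext fun _ => localMult_of_isZero h

theorem indecMult_biprod (Y Z : M) : indecMult (Y ⊞ Z) = indecMult Y + indecMult Z :=
  Finsupp.ext fun _ => localMult_biprod _ _ _

theorem indecMult_rep (i : IndecClass M) : indecMult i.rep = Finsupp.single i 1 := by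
  classical
  exact Finsupp.ext fun j => by
    rw [indecMult_apply, localMult_rep_rep, Finsupp.single_apply]

theorem isZero_of_indecMult_eq_zero {Y : M} (h : indecMult Y = 0) : IsZero Y := by
  revert h
  induction Y using krullSchmidt_induction with
  | iso X Y e h => rw [← indecMult_congr e]; exact fun hx => (h hx).of_iso e.symm
  | zero X h => exact fun _ => h
  | add j Y h =>
    rw [indecMult_biprod, indecMult_rep]
    exact fun h0 => absurd (DFunLike.congr_fun h0 j) (by simp)

/-- An object of length one is isomorphic to the corresponding indecomposable object. -/
theorem nonempty_iso_of_indecMult {Y : M} {i : IndecClass M}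
    (h : indecMult Y = Finsupp.single i 1) : Nonempty (Y ≅ i.rep) := by
  revert h
  induction Y using krullSchmidt_induction with
  | iso X Y e h =>
    rw [← indecMult_congr e]
    exact fun hi => (h hi).map fun f => e.symm ≪≫ f
  | zero X h =>
    intro hi
    rw [indecMult_of_isZero h] at hi
    exact absurd (DFunLike.congr_fun hi i) (by simp)
  | add j Y h =>
    rw [indecMult_biprod, indecMult_rep]
    intro hi
    have h1 := DFunLike.congr_fun hi j
    simp only [Finsupp.add_apply, Finsupp.single_eq_same] at h1
    have hij : i = j := by
      by_contra hne
      rw [Finsupp.single_eq_of_ne (fun h => hne h.symm)] at h1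
      omega
    subst hij
    exact ⟨(isoBiprodZero (isZero_of_indecMult_eq_zero (by simpa using hi))).symm⟩

/-- A retract of an object occurs in it with positive multiplicity. -/
theorem indecMult_ne_zero_of_retract {Y : M} {i : IndecClass M} (a : i.rep ⟶ Y) (b : Y ⟶ i.rep)
    (h : IsIso (a ≫ b)) : indecMult Y i ≠ 0 := by
  intro h0
  rw [indecMult_apply, localMult, Module.finrank_zero_iff,
    Submodule.Quotient.subsingleton_iff] at h0
  have : a ∈ radHom i.rep Y := h0 ▸ Submodule.mem_top
  exact this b h

theorem exists_retract_of_indecMult_ne_zero {Y : M} {i : IndecClass M} (h : indecMult Y i ≠ 0) :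
    ∃ (a : i.rep ⟶ Y) (b : Y ⟶ i.rep), a ≫ b = 𝟙 _ := by
  have : radHom i.rep Y ≠ ⊤ := fun ht => h (by
    rw [indecMult_apply, localMult, Module.finrank_zero_iff, Submodule.Quotient.subsingleton_iff]
    exact ht)
  obtain ⟨a, -, ha⟩ := SetLike.exists_of_lt (lt_top_iff_ne_top.2 this)
  rw [mem_radHom] at ha
  push Not at ha
  obtain ⟨b, hb⟩ := ha
  exact ⟨a, b ≫ inv (a ≫ b), by rw [← Category.assoc, IsIso.hom_inv_id]⟩

theorem exists_iso_biproduct_localMult (i : IndecClass M) (Y : M) :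
    ∃ Z : M, Nonempty (Y ≅ (⨁ fun _ : Fin (localMult i.rep Y) => i.rep) ⊞ Z) := by
  classical
  induction Y using krullSchmidt_induction with
  | iso X Y e h =>
    rw [← localMult_congr e]
    obtain ⟨Z, ⟨f⟩⟩ := h
    exact ⟨Z, ⟨e.symm ≪≫ f⟩⟩
  | zero X h =>
    rw [localMult_of_isZero h]
    exact ⟨X, ⟨isoZeroBiprod (isZero_biproduct_fin_zero _)⟩⟩
  | add j Y h =>
    obtain ⟨Z, ⟨f⟩⟩ := h
    by_cases hji : j = i
    · subst hji
      rw [localMult_biprod, localMult_self, add_comm]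
      refine ⟨Z, ⟨biprod.mapIso (Iso.refl _) f ≪≫ (biprod.associator _ _ _).symm ≪≫
        biprod.mapIso (biproductFinSuccIso fun _ => j.rep).symm (Iso.refl _)⟩⟩
    · rw [localMult_biprod, localMult_rep_rep, if_neg hji, zero_add]
      refine ⟨j.rep ⊞ Z, ⟨biprod.mapIso (Iso.refl _) f ≪≫ (biprod.associator _ _ _).symm ≪≫
        biprod.mapIso (biprod.braiding _ _) (Iso.refl _) ≪≫ biprod.associator _ _ _⟩⟩

/-- This identifies the entries of the action matrices, defined by suprema, with an invariant that
is additive on biproducts. -/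
theorem summandMultiplicity_rep (i : IndecClass M) (Y : M) :
    summandMultiplicity i.rep Y = indecMult Y i := by
  refine IsGreatest.csSup_eq ⟨exists_iso_biproduct_localMult i Y, ?_⟩
  rintro n ⟨Z, ⟨e⟩⟩
  rw [indecMult_apply, localMult_congr e, localMult_biprod, localMult_biproduct_const]
  exact Nat.le_add_right _ _

attribute [local instance] preservesBinaryBiproducts_of_preservesBiproducts in
/-- The multiplicities in the image of an object under an additive functor. -/
theorem indecMult_functor {C : Type*} [Category* C] [Preadditive C] [HasFiniteBiproducts C]
    [Linear ℂ C] [Fact (IsKrullSchmidt C)] [∀ X Y : C, Module.Finite ℂ (X ⟶ Y)]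
    (Φ : C ⥤ M) [Φ.Additive] (Y : C) :
    indecMult (Φ.obj Y) = (indecMult Y).sum fun i k => k • indecMult (Φ.obj i.rep) := by
  induction Y using krullSchmidt_induction with
  | iso X Y e h => rw [← indecMult_congr e, ← indecMult_congr (Φ.mapIso e), h]
  | zero X h =>
    rw [indecMult_of_isZero h, indecMult_of_isZero (Φ.map_isZero h), Finsupp.sum_zero_index]
  | add i Y h =>
    rw [indecMult_congr (Φ.mapBiprod _ _), indecMult_biprod, indecMult_biprod, indecMult_rep,
      Finsupp.sum_add_index' (by simp) (fun _ _ _ => add_smul _ _ _), h,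
      Finsupp.sum_single_index (by simp), one_smul]

end KrullSchmidt

end

noncomputable section

/-! ### Generalized eigenvectors -/

section Eigen

variable {V : Type*} [AddCommGroup V] [Module ℂ V]

/-- The commutation relation says that `e` intertwines h - τ with h - (τ + c), hence also their
powers. -/
theorem mem_maxGenEigenspace_of_shift {h e : Module.End ℂ V} {c τ : ℂ}
    (hc : h * e - e * h = c • e) {v : V} (hv : v ∈ h.maxGenEigenspace τ) :
    e v ∈ h.maxGenEigenspace (τ + c) := by
  rw [Module.End.mem_maxGenEigenspace] at hv ⊢
  obtain ⟨k, hk⟩ := hv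
  refine ⟨k, ?_⟩
  have hs : SemiconjBy e (h - τ • (1 : Module.End ℂ V)) (h - (τ + c) • (1 : Module.End ℂ V)) := by
    rw [SemiconjBy, mul_sub, sub_mul, add_smul, mul_smul_comm, mul_one, add_mul, smul_mul_assoc,
      smul_mul_assoc, one_mul, ← hc]
    abel
  have := (hs.pow_right k).eq
  rw [← Module.End.mul_apply, ← this, Module.End.mul_apply, hk, map_zero]

/-- A generalized eigenvector in the span of eigenvectors is in the span of those with the same
eigenvalue. -/
theorem mem_span_of_mem_maxGenEigenspace (T : Module.End ℂ V) {S : Set V}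
    (hS : ∀ w ∈ S, ∃ t : ℂ, T w = t • w) {k : V} (hk : k ∈ Submodule.span ℂ S) {τ : ℂ}
    (hτ : k ∈ T.maxGenEigenspace τ) :
    k ∈ Submodule.span ℂ {w | w ∈ S ∧ w ≠ 0 ∧ T w = τ • w} := by
  have hle : Submodule.span ℂ S ≤ Submodule.span ℂ {w | w ∈ S ∧ w ≠ 0 ∧ T w = τ • w} ⊔
      ⨆ t, ⨆ (_ : t ≠ τ), T.maxGenEigenspace t := by
    rw [Submodule.span_le]
    intro w hw
    obtain ⟨t, ht⟩ := hS w hw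
    by_cases h0 : w = 0
    · rw [h0]; exact zero_mem _
    by_cases htτ : t = τ
    · subst htτ
      exact Submodule.mem_sup_left (Submodule.subset_span ⟨hw, h0, ht⟩)
    · refine Submodule.mem_sup_right (Submodule.mem_iSup_of_mem t
        (Submodule.mem_iSup_of_mem htτ ?_))
      exact Module.End.eigenspace_le_maxGenEigenspace (Module.End.mem_eigenspace_iff.2 ht)
  have hle' : Submodule.span ℂ {w | w ∈ S ∧ w ≠ 0 ∧ T w = τ • w} ≤ T.maxGenEigenspace τ := by
    rw [Submodule.span_le]
    rintro w ⟨-, -, hw⟩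
    exact Module.End.eigenspace_le_maxGenEigenspace (Module.End.mem_eigenspace_iff.2 hw)
  obtain ⟨k₁, hk₁, k₂, hk₂, rfl⟩ := Submodule.mem_sup.1 (hle hk)
  have h2 : k₂ ∈ T.maxGenEigenspace τ := by
    simpa using sub_mem hτ (hle' hk₁)
  have := (Module.End.independent_maxGenEigenspace T) τ
  rw [Submodule.disjoint_def.1 this k₂ h2 hk₂, add_zero]
  exact hk₁

/-- An eigenvector modulo an invariant subspace lifts to a generalized eigenvector. -/
theorem exists_sub_mem_maxGenEigenspace [FiniteDimensional ℂ V] (T : Module.End ℂ V)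
    {N : Submodule ℂ V} (hN : ∀ u ∈ N, T u ∈ N) {τ : ℂ} {v : V} (hv : T v - τ • v ∈ N) :
    ∃ u ∈ N, v - u ∈ T.maxGenEigenspace τ := by
  let R : Module.End ℂ V := T - τ • 1
  have hR : ∀ u ∈ N, R u ∈ N := fun u hu => N.sub_mem (hN u hu) (N.smul_mem τ hu)
  let R' : Module.End ℂ N := R.restrict hR
  have hR' : ∀ (k : ℕ) (u : N), ((R' ^ k) u : V) = (R ^ k) u := by
    intro k
    induction k with
    | zero => intro u; rfl
    | succ k ih => intro u; rw [pow_succ, pow_succ, Module.End.mul_apply, ih]; rfl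
  -- Fitting decomposition of T - τ on N: write (T - τ) v = x + y with x killed by a power and y in
  -- the range. Correcting v by a preimage u of y leaves only the nilpotent part.
  have hcod := R'.isCompl_iSup_ker_pow_iInf_range_pow.codisjoint.eq_top
  have hmem : (⟨R v, hv⟩ : N) ∈ (⨆ n, LinearMap.ker (R' ^ n)) ⊔ ⨅ n, LinearMap.range (R' ^ n) := by
    rw [hcod]; trivial
  obtain ⟨x, hx, y, hy, hxy⟩ := Submodule.mem_sup.1 hmem
  obtain ⟨u, hu⟩ : y ∈ LinearMap.range (R' ^ 1) := (Submodule.mem_iInf _).1 hy 1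
  obtain ⟨n, hn⟩ : ∃ n, x ∈ LinearMap.ker (R' ^ n) := by
    rwa [Submodule.mem_iSup_of_directed] at hx
    exact Monotone.directed_le fun a b hab z hz => by
      obtain ⟨c, rfl⟩ := Nat.exists_eq_add_of_le hab
      rw [LinearMap.mem_ker] at hz ⊢
      rw [add_comm, pow_add, Module.End.mul_apply, hz, map_zero]
  refine ⟨u, u.2, ?_⟩
  rw [Module.End.mem_maxGenEigenspace]
  refine ⟨n + 1, ?_⟩
  change (R ^ (n + 1)) (v - u) = 0
  have h1 : R (v - u) = x := by
    rw [map_sub]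
    have h2 := congrArg Subtype.val hxy
    have h3 := congrArg Subtype.val hu
    rw [hR'] at h3
    simp only [pow_one] at h3
    rw [h3]
    change (x : V) + y = R v at h2
    rw [← h2]; abel
  rw [pow_succ, Module.End.mul_apply, h1, ← hR', LinearMap.mem_ker.1 hn]
  rfl

end Eigen

/-! ### Semisimplicity on the kernel of a raising operator -/

section Raising

open Polynomial

variable {V : Type*} [AddCommGroup V] [Module ℂ V] {e f h : Module.End ℂ V}

theorem aeval_X_sub_C_eq (h : Module.End ℂ V) (c : ℂ) : aeval h (X - C c) = h - c • 1 := by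
  rw [map_sub, aeval_X, aeval_C, Algebra.algebraMap_eq_smul_one]

/-- The usual 𝔰𝔩₂ formula, but with v only in the kernel of e and not assumed to be an eigenvector
of h. -/
theorem raise_lower_pow_succ (hef : e * f - f * e = h) (hhf : h * f - f * h = (-2 : ℂ) • f)
    (k : ℕ) {v : V} (hv : e v = 0) :
    e ((f ^ (k + 1)) v) = ((k : ℂ) + 1) • (f ^ k) (h v - (k : ℂ) • v) := by
  have hef' : ∀ w, e (f w) = f (e w) + h w := fun w => by
    have := LinearMap.congr_fun hef w
    simp only [LinearMap.sub_apply, Module.End.mul_apply] at this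
    rw [← this]; abel
  have hhf' : ∀ w, h (f w) = f (h w) - (2 : ℂ) • f w := fun w => by
    have := LinearMap.congr_fun hhf w
    simp only [LinearMap.sub_apply, Module.End.mul_apply, LinearMap.smul_apply] at this
    rw [sub_eq_iff_eq_add.1 this]; module
  have hp : ∀ k : ℕ, h ((f ^ k) v) = (f ^ k) (h v) - (2 * (k : ℂ)) • (f ^ k) v := by
    intro k
    induction k with
    | zero => simp
    | succ k ih =>
      rw [pow_succ', Module.End.mul_apply, hhf', ih, Module.End.mul_apply, map_sub, map_smul]
      push_cast
      module
  induction k with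
  | zero => simp [hef', hv]
  | succ k ih =>
    rw [pow_succ', Module.End.mul_apply, hef', ih, hp, pow_succ' f k, Module.End.mul_apply]
    simp only [map_sub, map_smul, Module.End.mul_apply]
    push_cast
    module

theorem raise_pow_lower_pow (hef : e * f - f * e = h) (hhf : h * f - f * h = (-2 : ℂ) • f)
    (hhe : h * e - e * h = (2 : ℂ) • e) (n : ℕ) {v : V} (hv : e v = 0) :
    (e ^ n) ((f ^ n) v) =
      (n.factorial : ℂ) • aeval h (∏ k ∈ Finset.range n, (X - C (k : ℂ))) v := by
  induction n generalizing v with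
  | zero => simp
  | succ n ih =>
    have hv' : e (h v - (n : ℂ) • v) = 0 := by
      have := LinearMap.congr_fun hhe v
      simp only [LinearMap.sub_apply, Module.End.mul_apply, LinearMap.smul_apply, hv, map_zero,
        smul_zero, zero_sub, neg_eq_zero] at this
      rw [map_sub, map_smul, hv, this, smul_zero, sub_zero]
    rw [pow_succ e, Module.End.mul_apply, raise_lower_pow_succ hef hhf n hv, map_smul, ih hv',
      Finset.prod_range_succ, map_mul, Module.End.mul_apply, smul_smul, Nat.factorial_succ,
      aeval_X_sub_C_eq]
    push_cast
    rfl

/-- Some power f ^ n with n > a kills v, so `raise_pow_lower_pow` shows that v is annihilated by a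
polynomial in h with only simple roots, a among them. A generalized eigenvector for a is then a
genuine one. -/
theorem eigen_of_raise_eq_zero [FiniteDimensional ℂ V] (hef : e * f - f * e = h)
    (hhf : h * f - f * h = (-2 : ℂ) • f) (hhe : h * e - e * h = (2 : ℂ) • e) {a : ℕ} {v : V}
    (hv : e v = 0) (hva : v ∈ h.maxGenEigenspace (a : ℂ)) : h v = (a : ℂ) • v := by
  have hfn : ∀ n : ℕ, (f ^ n) v ∈ h.maxGenEigenspace ((a : ℂ) + (-2) * n) := by
    intro n
    induction n with
    | zero => simpa using hva
    | succ n ih =>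
      have := mem_maxGenEigenspace_of_shift hhf ih
      rw [pow_succ', Module.End.mul_apply]
      convert this using 2
      push_cast
      ring
  -- The vectors f ^ n v have distinct generalized eigenvalues a - 2n, of which only finitely many
  -- occur. The bound a < n guarantees that X - a is among the factors.
  obtain ⟨n, hna, hn⟩ : ∃ n, a < n ∧ (f ^ n) v = 0 := by
    by_contra! hcon
    have hfin : {μ : ℂ | h.HasEigenvalue μ}.Finite := Module.End.finite_hasEigenvalue h
    have hinj : Function.Injective fun n : ℕ => (a : ℂ) + (-2) * ((n + (a + 1) : ℕ) : ℂ) := by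
      intro m n hmn
      simpa using hmn
    refine Set.infinite_range_of_injective hinj (hfin.subset ?_)
    rintro _ ⟨n, rfl⟩
    have h1 := hcon (n + (a + 1)) (by omega)
    have h2 := hfn (n + (a + 1))
    by_contra h3
    have h4 : h.maxGenEigenspace ((a : ℂ) + (-2) * ((n + (a + 1) : ℕ) : ℂ)) = ⊥ := by
      by_contra h5
      apply h3
      rw [Set.mem_ofPred_eq]
      exact Module.End.HasUnifEigenvalue.lt (k := ⊤) (by simp) h5
    rw [h4] at h2
    exact h1 (by simpa using h2)
  have key := raise_pow_lower_pow hef hhf hhe n hv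
  rw [hn, map_zero, eq_comm, smul_eq_zero_iff_right (by exact_mod_cast n.factorial_ne_zero)] at key
  let q : ℂ[X] := ∏ k ∈ (Finset.range n).erase a, (X - C (k : ℂ))
  rw [← Finset.prod_erase_mul _ _ (Finset.mem_range.2 hna), map_mul, Module.End.mul_apply] at key
  change aeval h q _ = 0 at key
  obtain ⟨j, hj⟩ := (Module.End.mem_maxGenEigenspace _ _ _).1 hva
  have hcop : IsCoprime q ((X - C (a : ℂ)) ^ j) := by
    refine IsCoprime.pow_right (IsCoprime.prod_left fun k hk => ?_)
    refine isCoprime_X_sub_C_of_isUnit_sub (sub_ne_zero.2 ?_).isUnit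
    exact_mod_cast (Finset.mem_erase.1 hk).1
  obtain ⟨r, s, hrs⟩ := hcop
  have hw : aeval h (X - C (a : ℂ)) v = h v - (a : ℂ) • v := by
    rw [aeval_X_sub_C_eq]; rfl
  have hX : aeval h ((X - C (a : ℂ)) ^ j) = (h - (a : ℂ) • (1 : Module.End ℂ V)) ^ j := by
    rw [map_pow, aeval_X_sub_C_eq]
  have hj' : aeval h ((X - C (a : ℂ)) ^ j) (aeval h (X - C (a : ℂ)) v) = 0 := by
    rw [← Module.End.mul_apply, ← map_mul, mul_comm, map_mul, Module.End.mul_apply, hX, hj,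
      map_zero]
  have := LinearMap.congr_fun (congrArg (aeval h) hrs) (aeval h (X - C (a : ℂ)) v)
  rw [map_add, map_mul, map_mul, LinearMap.add_apply, Module.End.mul_apply, Module.End.mul_apply,
    key, hj', map_zero, map_zero, add_zero, map_one, Module.End.one_apply, hw] at this
  exact sub_eq_zero.1 this.symm

end Raising

end

noncomputable section

/-! ### Traceless matrix units -/

/-- The traceless part of the matrix unit `E i j`. -/
def tracelessUnit (i j : Fin 3) : Sl3 :=
  ⟨Matrix.single i j 1 - (if i = j then (1 / 3 : ℂ) else 0) • 1, by
    change Matrix.trace (_ : Matrix (Fin 3) (Fin 3) ℂ) = 0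
    rw [Matrix.trace_sub, Matrix.trace_smul, Matrix.trace_one]
    by_cases h : i = j
    · subst h; simp
    · simp [h]⟩

theorem tracelessUnit_val (i j : Fin 3) :
    (tracelessUnit i j).1 = Matrix.single i j 1 - (if i = j then (1 / 3 : ℂ) else 0) • 1 := rfl

/-- Scalar matrices are central, and the scalar corrections on the right cancel when both deltas
fire, so the relations of 𝔤𝔩₃ persist. -/
theorem lie_tracelessUnit (i j k l : Fin 3) :
    ⁅tracelessUnit i j, tracelessUnit k l⁆ =
      (if j = k then tracelessUnit i l else 0) - (if l = i then tracelessUnit k j else 0) := by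
  apply Subtype.ext
  have h1 : ((if j = k then tracelessUnit i l else 0 : Sl3) : Matrix (Fin 3) (Fin 3) ℂ) =
      if j = k then (tracelessUnit i l).1 else 0 := by split_ifs <;> rfl
  have h2 : ((if l = i then tracelessUnit k j else 0 : Sl3) : Matrix (Fin 3) (Fin 3) ℂ) =
      if l = i then (tracelessUnit k j).1 else 0 := by split_ifs <;> rfl
  change (tracelessUnit i j).1 * (tracelessUnit k l).1 - (tracelessUnit k l).1 * (tracelessUnit i j).1 =
    ((if j = k then tracelessUnit i l else 0 : Sl3) : Matrix (Fin 3) (Fin 3) ℂ) -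
    ((if l = i then tracelessUnit k j else 0 : Sl3) : Matrix (Fin 3) (Fin 3) ℂ)
  rw [h1, h2]
  simp only [tracelessUnit_val, sub_mul, mul_sub, smul_mul_assoc, mul_smul_comm, one_mul, mul_one]
  have hs : ∀ a b c d : Fin 3, (Matrix.single a b (1 : ℂ)) * Matrix.single c d (1 : ℂ) =
      if b = c then Matrix.single a d 1 else 0 := by
    intro a b c d
    split_ifs with h
    · subst h; simp
    · simp [h]
  rw [hs, hs]
  by_cases hjk : j = k <;> by_cases hli : l = i
  · subst hjk hli; simp only [if_true, eq_comm (a := j) (b := l)]; module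
  · subst hjk; simp only [if_true, hli, if_false, eq_comm (a := i) (b := l)]; module
  · subst hli; simp only [if_true, hjk, if_false, eq_comm (a := k) (b := j)]; module
  · simp only [hjk, hli, if_false]; module

theorem eq_sum_tracelessUnit (x : Sl3) : x = ∑ i, ∑ j, x.1 i j • tracelessUnit i j := by
  apply Subtype.ext
  have htr : x.1.trace = 0 := x.2
  have : ((∑ i, ∑ j, x.1 i j • tracelessUnit i j : Sl3) : Matrix (Fin 3) (Fin 3) ℂ) =
      ∑ i, ∑ j, x.1 i j • (tracelessUnit i j).1 := by
    simp
  rw [this]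
  simp only [tracelessUnit_val, smul_sub, Finset.sum_sub_distrib, Matrix.smul_single, smul_eq_mul,
    mul_one]
  rw [← Matrix.matrix_eq_sum_single x.1]
  simp only [ite_smul, zero_smul, smul_ite, smul_zero, Finset.sum_ite_eq, Finset.mem_univ, if_true]
  rw [← Finset.sum_smul]
  rw [Matrix.trace] at htr
  simp only [Matrix.diag_apply] at htr
  rw [htr, zero_smul, sub_zero]

theorem tracelessUnit_sum : tracelessUnit 0 0 + tracelessUnit 1 1 + tracelessUnit 2 2 = 0 := by
  apply Subtype.ext
  ext i j
  change ((tracelessUnit 0 0).1 + (tracelessUnit 1 1).1 + (tracelessUnit 2 2).1) i j = 0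
  simp only [tracelessUnit_val]
  fin_cases i <;> fin_cases j <;> simp <;> norm_num

/-! ### The Casimir operator and stability under Chevalley generators -/

section Modules

variable {V : Type*} [AddCommGroup V] [Module ℂ V] [LieRingModule Sl3 V] [LieModule ℂ Sl3 V]

/-- The Casimir operator. -/
def casimir (V : Type*) [AddCommGroup V] [Module ℂ V] [LieRingModule Sl3 V] [LieModule ℂ Sl3 V] :
    Module.End ℂ V :=
  ∑ i, ∑ j, LieModule.toEnd ℂ Sl3 V (tracelessUnit i j) * LieModule.toEnd ℂ Sl3 V (tracelessUnit j i)

theorem casimir_apply (v : V) :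
    casimir V v = ∑ i, ∑ j, ⁅tracelessUnit i j, ⁅tracelessUnit j i, v⁆⁆ := by
  simp [casimir]

/-- The tensor ∑ E i j ⊗ E j i is invariant: the commutator with E k l yields four single sums that
cancel in pairs. -/
theorem casimir_lie (x : Sl3) (v : V) : casimir V ⁅x, v⁆ = ⁅x, casimir V v⁆ := by
  have key : ∀ k l, casimir V ⁅tracelessUnit k l, v⁆ = ⁅tracelessUnit k l, casimir V v⁆ := by
    intro k l
    simp only [casimir_apply, lie_sum]
    have : ∀ i j, ⁅tracelessUnit k l, ⁅tracelessUnit i j, ⁅tracelessUnit j i, v⁆⁆⁆ =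
        (if l = i then ⁅tracelessUnit k j, ⁅tracelessUnit j i, v⁆⁆ else 0) -
        (if j = k then ⁅tracelessUnit i l, ⁅tracelessUnit j i, v⁆⁆ else 0) +
        ((if l = j then ⁅tracelessUnit i j, ⁅tracelessUnit k i, v⁆⁆ else 0) -
        (if i = k then ⁅tracelessUnit i j, ⁅tracelessUnit j l, v⁆⁆ else 0)) +
        ⁅tracelessUnit i j, ⁅tracelessUnit j i, ⁅tracelessUnit k l, v⁆⁆⁆ := by
      intro i j
      rw [leibniz_lie, leibniz_lie (tracelessUnit k l) (tracelessUnit j i), lie_tracelessUnit,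
        lie_tracelessUnit, lie_add, sub_lie, sub_lie, lie_sub]
      split_ifs <;> (try simp only [zero_lie, lie_zero]) <;> abel
    simp only [this, Finset.sum_add_distrib, Finset.sum_sub_distrib, Finset.sum_ite_eq,
      Finset.sum_ite_eq', Finset.mem_univ, if_true]
    rw [Finset.sum_comm (f := fun i j => if l = i then ⁅tracelessUnit k j, ⁅tracelessUnit j i, v⁆⁆ else 0),
      Finset.sum_comm (f := fun i j => if i = k then ⁅tracelessUnit i j, ⁅tracelessUnit j l, v⁆⁆ else 0)]
    simp only [Finset.sum_ite_eq, Finset.sum_ite_eq', Finset.mem_univ, if_true]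
    abel
  conv_lhs => rw [eq_sum_tracelessUnit x]
  conv_rhs => rw [eq_sum_tracelessUnit x]
  simp only [sum_lie, smul_lie, map_sum, map_smul, key]

/-- A subspace stable under the Chevalley generators is a Lie submodule. -/
def lieSubmoduleOfChevalley (N : Submodule ℂ V) (h₁ : ∀ v ∈ N, ⁅tracelessUnit 0 1, v⁆ ∈ N)
    (h₂ : ∀ v ∈ N, ⁅tracelessUnit 1 2, v⁆ ∈ N) (h₃ : ∀ v ∈ N, ⁅tracelessUnit 1 0, v⁆ ∈ N)
    (h₄ : ∀ v ∈ N, ⁅tracelessUnit 2 1, v⁆ ∈ N) : LieSubmodule ℂ Sl3 V where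
  __ := N
  lie_mem {x v} hv := by
    have hbr : ∀ x y : Sl3, (∀ v ∈ N, ⁅x, v⁆ ∈ N) → (∀ v ∈ N, ⁅y, v⁆ ∈ N) →
        ∀ v ∈ N, ⁅⁅x, y⁆, v⁆ ∈ N := fun x y hx hy v hv => by
      rw [lie_lie]; exact N.sub_mem (hx _ (hy _ hv)) (hy _ (hx _ hv))
    -- Brackets of the generators give E 0 2, E 2 0 up to sign conventions of the formula, and the
    -- two simple coroots.
    have h5 := hbr _ _ h₁ h₂
    have h6 := hbr _ _ h₄ h₃
    have h7 := hbr _ _ h₁ h₃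
    have h8 := hbr _ _ h₂ h₄
    rw [lie_tracelessUnit] at h5 h6 h7 h8
    simp only [if_true, reduceIte, sub_zero, Fin.isValue, show (2 : Fin 3) ≠ 0 by decide,
      show (0 : Fin 3) ≠ 2 by decide] at h5 h6 h7 h8
    have h00 : ∀ v ∈ N, ⁅tracelessUnit 0 0, v⁆ ∈ N := fun v hv => by
      -- The coefficients are a row of the inverse Cartan matrix; the identity uses that the three
      -- diagonal units sum to zero.
      have : tracelessUnit 0 0 = (2 / 3 : ℂ) • (tracelessUnit 0 0 - tracelessUnit 1 1) +
          (1 / 3 : ℂ) • (tracelessUnit 1 1 - tracelessUnit 2 2) := by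
        rw [← sub_eq_zero, show tracelessUnit 0 0 - ((2 / 3 : ℂ) • (tracelessUnit 0 0 - tracelessUnit 1 1) +
          (1 / 3 : ℂ) • (tracelessUnit 1 1 - tracelessUnit 2 2)) =
          (1 / 3 : ℂ) • (tracelessUnit 0 0 + tracelessUnit 1 1 + tracelessUnit 2 2) by module,
          tracelessUnit_sum, smul_zero]
      rw [this, add_lie, smul_lie, smul_lie]
      exact N.add_mem (N.smul_mem _ (h7 _ hv)) (N.smul_mem _ (h8 _ hv))
    have h11 : ∀ v ∈ N, ⁅tracelessUnit 1 1, v⁆ ∈ N := fun v hv => by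
      rw [show tracelessUnit 1 1 = tracelessUnit 0 0 - (tracelessUnit 0 0 - tracelessUnit 1 1) by abel,
        sub_lie]
      exact N.sub_mem (h00 _ hv) (h7 _ hv)
    have h22 : ∀ v ∈ N, ⁅tracelessUnit 2 2, v⁆ ∈ N := fun v hv => by
      rw [show tracelessUnit 2 2 = tracelessUnit 1 1 - (tracelessUnit 1 1 - tracelessUnit 2 2) by abel,
        sub_lie]
      exact N.sub_mem (h11 _ hv) (h8 _ hv)
    change v ∈ N at hv
    change ⁅x, v⁆ ∈ N
    rw [eq_sum_tracelessUnit x, sum_lie]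
    refine N.sum_mem fun i _ => ?_
    rw [sum_lie]
    refine N.sum_mem fun j _ => ?_
    rw [smul_lie]
    refine N.smul_mem _ ?_
    fin_cases i <;> fin_cases j
    exacts [h00 _ hv, h₁ _ hv, h5 _ hv, h₃ _ hv, h11 _ hv, h₂ _ hv, h6 _ hv, h₄ _ hv, h22 _ hv]

end Modules

end

noncomputable section

/-! ### Primitive vectors -/

local notation "e₁" => tracelessUnit 0 1
local notation "e₂" => tracelessUnit 1 2
local notation "f₁" => tracelessUnit 1 0
local notation "f₂" => tracelessUnit 2 1
local notation "h₁" => (tracelessUnit 0 0 - tracelessUnit 1 1)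
local notation "h₂" => (tracelessUnit 1 1 - tracelessUnit 2 2)

theorem lie_e₁_f₁ : ⁅e₁, f₁⁆ = h₁ := by simp [lie_tracelessUnit]
theorem lie_e₂_f₂ : ⁅e₂, f₂⁆ = h₂ := by simp [lie_tracelessUnit]
theorem lie_e₁_f₂ : ⁅e₁, f₂⁆ = 0 := by simp [lie_tracelessUnit]
theorem lie_e₂_f₁ : ⁅e₂, f₁⁆ = 0 := by simp [lie_tracelessUnit]
theorem lie_h₁_e₁ : ⁅h₁, e₁⁆ = (2 : ℂ) • e₁ := by
  simp only [sub_lie, lie_tracelessUnit]; simp [two_smul]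
theorem lie_h₁_e₂ : ⁅h₁, e₂⁆ = (-1 : ℂ) • e₂ := by
  simp only [sub_lie, lie_tracelessUnit]; simp
theorem lie_h₂_e₁ : ⁅h₂, e₁⁆ = (-1 : ℂ) • e₁ := by
  simp only [sub_lie, lie_tracelessUnit]; simp
theorem lie_h₂_e₂ : ⁅h₂, e₂⁆ = (2 : ℂ) • e₂ := by
  simp only [sub_lie, lie_tracelessUnit]; simp [two_smul]
theorem lie_h₁_f₁ : ⁅h₁, f₁⁆ = (-2 : ℂ) • f₁ := by
  simp only [sub_lie, lie_tracelessUnit]; simp; module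
theorem lie_h₁_f₂ : ⁅h₁, f₂⁆ = (1 : ℂ) • f₂ := by
  simp only [sub_lie, lie_tracelessUnit]; simp
theorem lie_h₂_f₁ : ⁅h₂, f₁⁆ = (1 : ℂ) • f₁ := by
  simp only [sub_lie, lie_tracelessUnit]; simp
theorem lie_h₂_f₂ : ⁅h₂, f₂⁆ = (-2 : ℂ) • f₂ := by
  simp only [sub_lie, lie_tracelessUnit]; simp; module
theorem lie_h₁_h₂ : ⁅h₁, h₂⁆ = 0 := by
  simp only [sub_lie, lie_sub, lie_tracelessUnit]; simp

theorem tracelessUnit_ne_zero {i j : Fin 3} (hij : i ≠ j) : tracelessUnit i j ≠ 0 := by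
  intro h
  have := congrFun (congrFun (congrArg Subtype.val h) i) j
  rw [tracelessUnit_val, if_neg hij] at this
  simp at this

theorem isSl2Triple_h₁ : IsSl2Triple h₁ e₁ f₁ where
  h_ne_zero h := by
    have := lie_h₁_e₁
    rw [h, zero_lie] at this
    exact tracelessUnit_ne_zero (by decide) ((smul_eq_zero_iff_right two_ne_zero).1 this.symm)
  lie_e_f := lie_e₁_f₁
  lie_h_e_nsmul := by rw [lie_h₁_e₁]; module
  lie_h_f_nsmul := by rw [lie_h₁_f₁]; module

theorem isSl2Triple_h₂ : IsSl2Triple h₂ e₂ f₂ where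
  h_ne_zero h := by
    have := lie_h₂_e₂
    rw [h, zero_lie] at this
    exact tracelessUnit_ne_zero (by decide) ((smul_eq_zero_iff_right two_ne_zero).1 this.symm)
  lie_e_f := lie_e₂_f₂
  lie_h_e_nsmul := by rw [lie_h₂_e₂]; module
  lie_h_f_nsmul := by rw [lie_h₂_f₂]; module

section Modules

variable {V : Type*} [AddCommGroup V] [Module ℂ V] [LieRingModule Sl3 V] [LieModule ℂ Sl3 V]

/-- A nonzero vector of weight `(a, b)` killed by the raising operators. -/
structure IsPrimitive (v : V) (a b : ℂ) : Prop where
  ne_zero : v ≠ 0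
  lie_e₁ : ⁅e₁, v⁆ = 0
  lie_e₂ : ⁅e₂, v⁆ = 0
  lie_h₁ : ⁅h₁, v⁆ = a • v
  lie_h₂ : ⁅h₂, v⁆ = b • v

omit [LieModule ℂ Sl3 V] in
theorem IsPrimitive.map {W : Type*} [AddCommGroup W] [Module ℂ W] [LieRingModule Sl3 W]
    [LieModule ℂ Sl3 W] {v : V} {a b : ℂ} (hv : IsPrimitive v a b) (φ : V →ₗ⁅ℂ,Sl3⁆ W)
    (h0 : φ v ≠ 0) : IsPrimitive (φ v) a b where
  ne_zero := h0
  lie_e₁ := by rw [← LieModuleHom.map_lie, hv.lie_e₁, map_zero]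
  lie_e₂ := by rw [← LieModuleHom.map_lie, hv.lie_e₂, map_zero]
  lie_h₁ := by rw [← LieModuleHom.map_lie, hv.lie_h₁, map_smul]
  lie_h₂ := by rw [← LieModuleHom.map_lie, hv.lie_h₂, map_smul]

theorem IsPrimitive.exists_nat [FiniteDimensional ℂ V] {v : V} {a b : ℂ}
    (hv : IsPrimitive v a b) : ∃ m n : ℕ, a = m ∧ b = n := by
  have h1 : isSl2Triple_h₁.HasPrimitiveVectorWith v a := ⟨hv.ne_zero, hv.lie_h₁, hv.lie_e₁⟩
  have h2 : isSl2Triple_h₂.HasPrimitiveVectorWith v b := ⟨hv.ne_zero, hv.lie_h₂, hv.lie_e₂⟩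
  obtain ⟨m, hm⟩ := h1.exists_nat
  obtain ⟨n, hn⟩ := h2.exists_nat
  exact ⟨m, n, hm, hn⟩

/-- Every nonzero finite dimensional module contains a primitive vector. -/
theorem exists_isPrimitive (V : Type*) [AddCommGroup V] [Module ℂ V] [LieRingModule Sl3 V]
    [LieModule ℂ Sl3 V] [FiniteDimensional ℂ V] [Nontrivial V] :
    ∃ (v : V) (m n : ℕ), IsPrimitive v (m : ℂ) (n : ℂ) := by
  let T : Module.End ℂ V := LieModule.toEnd ℂ Sl3 V (h₁ + h₂)
  -- Both simple raising operators increase the eigenvalue of h₁ + h₂ by exactly 1, so they kill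
  -- this eigenspace. A common eigenvector is then found with h₁, which commutes with h₁ + h₂.
  obtain ⟨c, hc, hc'⟩ : ∃ c, T.HasEigenvalue c ∧ ¬ T.HasEigenvalue (c + 1) := by
    obtain ⟨c₀, hc₀⟩ := Module.End.exists_eigenvalue T
    by_contra! hcon
    have hall : ∀ n : ℕ, T.HasEigenvalue (c₀ + n) := by
      intro n
      induction n with
      | zero => simpa using hc₀
      | succ n ih => have := hcon _ ih; rwa [add_assoc, ← Nat.cast_succ] at this
    have hinj : Function.Injective fun n : ℕ => c₀ + (n : ℂ) := fun m n h => by simpa using h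
    exact Set.infinite_range_of_injective hinj ((Module.End.finite_hasEigenvalue T).subset
      (by rintro _ ⟨n, rfl⟩; exact hall n))
  have he : ∀ x : Sl3, ⁅h₁ + h₂, x⁆ = x → ∀ v ∈ T.eigenspace c, ⁅x, v⁆ = 0 := by
    intro x hx v hv
    by_contra hne
    refine hc' (Module.End.hasEigenvalue_of_hasEigenvector (x := ⁅x, v⁆) ⟨?_, hne⟩)
    rw [Module.End.mem_eigenspace_iff] at hv ⊢
    change ⁅h₁ + h₂, v⁆ = c • v at hv
    change ⁅h₁ + h₂, ⁅x, v⁆⁆ = _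
    rw [leibniz_lie, hx, hv, lie_smul]
    module
  have hs1 : ⁅h₁ + h₂, e₁⁆ = e₁ := by rw [add_lie, lie_h₁_e₁, lie_h₂_e₁]; module
  have hs2 : ⁅h₁ + h₂, e₂⁆ = e₂ := by rw [add_lie, lie_h₁_e₂, lie_h₂_e₂]; module
  have hst : ∀ v ∈ T.eigenspace c, LieModule.toEnd ℂ Sl3 V h₁ v ∈ T.eigenspace c := by
    intro v hv
    rw [Module.End.mem_eigenspace_iff] at hv ⊢
    change ⁅h₁ + h₂, v⁆ = c • v at hv
    change ⁅h₁ + h₂, ⁅h₁, v⁆⁆ = c • ⁅h₁, v⁆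
    rw [leibniz_lie, hv, add_lie, lie_self, ← lie_skew, lie_h₁_h₂, lie_smul]
    simp
  have : Nontrivial (T.eigenspace c) := (Submodule.nontrivial_iff_ne_bot).2 hc
  obtain ⟨a, ha⟩ := Module.End.exists_eigenvalue ((LieModule.toEnd ℂ Sl3 V h₁).restrict hst)
  obtain ⟨v, hv⟩ := ha.exists_hasEigenvector
  have hv1 : ⁅h₁, (v : V)⁆ = a • (v : V) := congrArg Subtype.val hv.apply_eq_smul
  have hv2 : ⁅h₁ + h₂, (v : V)⁆ = c • (v : V) := Module.End.mem_eigenspace_iff.1 v.2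
  have hp : IsPrimitive (v : V) a (c - a) :=
    { ne_zero := fun h => hv.2 (Subtype.ext h)
      lie_e₁ := he _ hs1 _ v.2
      lie_e₂ := he _ hs2 _ v.2
      lie_h₁ := hv1
      lie_h₂ := by rw [add_lie, hv1] at hv2; rw [sub_smul, ← hv2]; abel }
  obtain ⟨m, n, hm, hn⟩ := hp.exists_nat
  rw [hn, hm] at hp
  exact ⟨v, m, n, hp⟩

/-- The eigenvalue of the Casimir operator on a primitive vector of weight `(a, b)`. -/
def casimirValue (a b : ℂ) : ℂ := (2 / 3) * (a ^ 2 + a * b + b ^ 2) + 2 * (a + b)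

/-- Moving raising operators to the right replaces E i j E j i by E i i - E j j for i < j; the
diagonal units act by scalars determined by the weight and trace zero. -/
theorem IsPrimitive.casimir_eq {v : V} {a b : ℂ} (hv : IsPrimitive v a b) :
    casimir V v = casimirValue a b • v := by
  have hs : ⁅tracelessUnit 0 0, v⁆ + ⁅tracelessUnit 1 1, v⁆ + ⁅tracelessUnit 2 2, v⁆ = 0 := by
    rw [← add_lie, ← add_lie, tracelessUnit_sum, zero_lie]
  have h1 := hv.lie_h₁
  have h2 := hv.lie_h₂
  rw [sub_lie] at h1 h2
  have e0 : ⁅tracelessUnit 0 0, v⁆ = ((2 * a + b) / 3) • v := by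
    rw [show ((2 * a + b) / 3) • v = (2 / 3 : ℂ) • (a • v) + (1 / 3 : ℂ) • (b • v) by module,
      ← h1, ← h2, ← sub_eq_zero]
    rw [← smul_zero (A := V) (1 / 3 : ℂ), ← hs]
    module
  have e1 : ⁅tracelessUnit 1 1, v⁆ = ((b - a) / 3) • v := by
    rw [show ⁅tracelessUnit 1 1, v⁆ = ⁅tracelessUnit 0 0, v⁆ - a • v by rw [← h1]; abel, e0]
    module
  have e2 : ⁅tracelessUnit 2 2, v⁆ = (-(a + 2 * b) / 3) • v := by
    rw [show ⁅tracelessUnit 2 2, v⁆ = ⁅tracelessUnit 1 1, v⁆ - b • v by rw [← h2]; abel, e1]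
    module
  have e3 : ⁅tracelessUnit 0 2, v⁆ = 0 := by
    have : tracelessUnit 0 2 = ⁅e₁, e₂⁆ := by simp [lie_tracelessUnit]
    rw [this, lie_lie, hv.lie_e₁, hv.lie_e₂, lie_zero, lie_zero, sub_zero]
  have hc : ∀ i j, ⁅tracelessUnit i j, v⁆ = 0 → ⁅tracelessUnit i j, ⁅tracelessUnit j i, v⁆⁆ =
      ⁅tracelessUnit i i, v⁆ - ⁅tracelessUnit j j, v⁆ := by
    intro i j h
    rw [leibniz_lie, h, lie_zero, add_zero, lie_tracelessUnit]
    simp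
  rw [casimir_apply]
  simp only [Fin.sum_univ_three]
  rw [hc 0 1 hv.lie_e₁, hc 1 2 hv.lie_e₂, hc 0 2 e3, hv.lie_e₁, hv.lie_e₂, e3]
  simp only [e0, e1, e2, lie_smul, lie_zero, casimirValue]
  module

/-- The vectors obtained from `v` by applying `m` times `f₁` and `n` times `f₂`, in any order. -/
inductive IsLowering (v : V) : ℕ → ℕ → V → Prop
  | nil : IsLowering v 0 0 v
  | lower₁ {m n : ℕ} {w : V} (h : IsLowering v m n w) : IsLowering v (m + 1) n ⁅f₁, w⁆
  | lower₂ {m n : ℕ} {w : V} (h : IsLowering v m n w) : IsLowering v m (n + 1) ⁅f₂, w⁆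

theorem IsLowering.weight {v : V} {a b : ℂ} (hv : IsPrimitive v a b) {m n : ℕ} {w : V}
    (hw : IsLowering v m n w) :
    ⁅h₁, w⁆ = (a - 2 * m + n) • w ∧ ⁅h₂, w⁆ = (b + m - 2 * n) • w := by
  induction hw with
  | nil =>
    rw [hv.lie_h₁, hv.lie_h₂]
    exact ⟨by simp, by simp⟩
  | lower₁ h ih =>
    rw [leibniz_lie h₁, leibniz_lie h₂, ih.1, ih.2, lie_h₁_f₁, lie_h₂_f₁]
    simp only [smul_lie, lie_smul]
    push_cast
    exact ⟨by module, by module⟩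
  | lower₂ h ih =>
    rw [leibniz_lie h₁, leibniz_lie h₂, ih.1, ih.2, lie_h₁_f₂, lie_h₂_f₂]
    simp only [smul_lie, lie_smul]
    push_cast
    exact ⟨by module, by module⟩

theorem IsLowering.casimir_eq {v : V} {a b : ℂ} (hv : IsPrimitive v a b) {m n : ℕ} {w : V}
    (hw : IsLowering v m n w) : casimir V w = casimirValue a b • w := by
  induction hw with
  | nil => exact hv.casimir_eq
  | lower₁ h ih => rw [casimir_lie, ih, lie_smul]
  | lower₂ h ih => rw [casimir_lie, ih, lie_smul]

/-- The span of all vectors obtained from `v` by applying lowering operators. -/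
def loweringSpan (v : V) : Submodule ℂ V := Submodule.span ℂ {w | ∃ m n, IsLowering v m n w}

theorem lie_mem_loweringSpan_of {v : V} {x : Sl3}
    (hx : ∀ m n w, IsLowering v m n w → ⁅x, w⁆ ∈ loweringSpan v) :
    ∀ w ∈ loweringSpan v, ⁅x, w⁆ ∈ loweringSpan v := by
  intro w hw
  induction hw using Submodule.span_induction with
  | mem w h => obtain ⟨m, n, h⟩ := h; exact hx m n w h
  | zero => rw [lie_zero]; exact zero_mem _
  | add a b _ _ ha hb => rw [lie_add]; exact add_mem ha hb
  | smul c a _ ha => rw [lie_smul]; exact Submodule.smul_mem _ _ ha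

theorem f₁_mem_loweringSpan {v : V} : ∀ w ∈ loweringSpan v, ⁅f₁, w⁆ ∈ loweringSpan v :=
  lie_mem_loweringSpan_of fun _ _ _ h => Submodule.subset_span ⟨_, _, h.lower₁⟩

theorem f₂_mem_loweringSpan {v : V} : ∀ w ∈ loweringSpan v, ⁅f₂, w⁆ ∈ loweringSpan v :=
  lie_mem_loweringSpan_of fun _ _ _ h => Submodule.subset_span ⟨_, _, h.lower₂⟩

theorem IsPrimitive.e₁_mem {v : V} {a b : ℂ} (hv : IsPrimitive v a b) :
    ∀ w ∈ loweringSpan v, ⁅e₁, w⁆ ∈ loweringSpan v :=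
  lie_mem_loweringSpan_of fun m n w h => by
    induction h with
    | nil => rw [hv.lie_e₁]; exact zero_mem _
    | lower₁ h ih =>
      rw [leibniz_lie, lie_e₁_f₁, (h.weight hv).1]
      exact add_mem (Submodule.smul_mem _ _ (Submodule.subset_span ⟨_, _, h⟩))
        (f₁_mem_loweringSpan _ ih)
    | lower₂ h ih =>
      rw [leibniz_lie, lie_e₁_f₂, zero_lie, zero_add]
      exact f₂_mem_loweringSpan _ ih

theorem IsPrimitive.e₂_mem {v : V} {a b : ℂ} (hv : IsPrimitive v a b) :
    ∀ w ∈ loweringSpan v, ⁅e₂, w⁆ ∈ loweringSpan v :=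
  lie_mem_loweringSpan_of fun m n w h => by
    induction h with
    | nil => rw [hv.lie_e₂]; exact zero_mem _
    | lower₁ h ih =>
      rw [leibniz_lie, lie_e₂_f₁, zero_lie, zero_add]
      exact f₁_mem_loweringSpan _ ih
    | lower₂ h ih =>
      rw [leibniz_lie, lie_e₂_f₂, (h.weight hv).2]
      exact add_mem (Submodule.smul_mem _ _ (Submodule.subset_span ⟨_, _, h⟩))
        (f₂_mem_loweringSpan _ ih)

/-- The Lie submodule generated by a primitive vector. -/
def IsPrimitive.cyclic {v : V} {a b : ℂ} (hv : IsPrimitive v a b) : LieSubmodule ℂ Sl3 V :=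
  lieSubmoduleOfChevalley (loweringSpan v) hv.e₁_mem hv.e₂_mem f₁_mem_loweringSpan
    f₂_mem_loweringSpan

theorem IsPrimitive.mem_cyclic {v : V} {a b : ℂ} (hv : IsPrimitive v a b) : v ∈ hv.cyclic :=
  Submodule.subset_span ⟨0, 0, IsLowering.nil⟩

theorem IsPrimitive.cyclic_le {v : V} {a b : ℂ} (hv : IsPrimitive v a b)
    {N : LieSubmodule ℂ Sl3 V} (h : v ∈ N) : hv.cyclic ≤ N := by
  intro w hw
  refine Submodule.span_le (p := N.toSubmodule).2 ?_ hw
  rintro w ⟨m, n, hw⟩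
  induction hw with
  | nil => exact h
  | lower₁ _ ih => exact N.lie_mem ih
  | lower₂ _ ih => exact N.lie_mem ih

/-- A dominant weight below another one with the same Casimir eigenvalue is equal to it. -/
theorem eq_zero_of_casimirValue_eq {a b a' b' m n : ℕ} (ha : (a' : ℂ) = a - 2 * m + n)
    (hb : (b' : ℂ) = b + m - 2 * n) (hc : casimirValue a b = casimirValue a' b') :
    m = 0 ∧ n = 0 := by
  -- With λ - μ = mα₁ + nα₂, the difference of Casimir values is (λ - μ, λ + μ + 2ρ). For dominant λ
  -- and μ both terms are non-negative with positive cofactors of m and n.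
  have key : ((m * (a + a' + 2) + n * (b + b' + 2) : ℕ) : ℂ) = 0 := by
    push_cast
    rw [casimirValue, casimirValue, ha, hb] at hc
    rw [ha, hb]
    linear_combination hc
  rw [Nat.cast_eq_zero] at key
  constructor
  · have : m * (a + a' + 2) = 0 := by omega
    rcases Nat.mul_eq_zero.1 this with h | h <;> omega
  · have : n * (b + b' + 2) = 0 := by omega
    rcases Nat.mul_eq_zero.1 this with h | h <;> omega

/-- An operator whose eigenvalues separate the integral weights. -/
def weightOp (V : Type*) [AddCommGroup V] [Module ℂ V] [LieRingModule Sl3 V] [LieModule ℂ Sl3 V] :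
    Module.End ℂ V := LieModule.toEnd ℂ Sl3 V (h₁ + Complex.I • h₂)

theorem weightOp_apply (v : V) : weightOp V v = ⁅h₁, v⁆ + Complex.I • ⁅h₂, v⁆ := by
  simp [weightOp]

theorem IsLowering.weightOp_eq {v : V} {a b : ℂ} (hv : IsPrimitive v a b) {m n : ℕ} {w : V}
    (hw : IsLowering v m n w) :
    weightOp V w = ((a - 2 * m + n) + Complex.I * (b + m - 2 * n)) • w := by
  rw [weightOp_apply, (hw.weight hv).1, (hw.weight hv).2]
  module

theorem intCast_add_I_mul_inj {a b c d : ℤ} (h : (a : ℂ) + Complex.I * b = c + Complex.I * d) :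
    a = c ∧ b = d := by
  have h1 := congrArg Complex.re h
  have h2 := congrArg Complex.im h
  simp at h1 h2
  exact ⟨by exact_mod_cast h1, by exact_mod_cast h2⟩

/-- A nonzero lowering of a primitive vector whose weight is dominant and whose Casimir eigenvalue
is that of the weight is the primitive vector. -/
theorem IsLowering.eq_zero_of_weight {v : V} {a b : ℕ} (hv : IsPrimitive v (a : ℂ) (b : ℂ))
    {m n p q : ℕ} {w : V} (hw : IsLowering v m n w) (hw0 : w ≠ 0) {a' b' : ℕ}
    (ht : weightOp V w = (((a' : ℂ) + 2 * p - q) + Complex.I * (b' - p + 2 * q)) • w)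
    (hc : casimir V w = casimirValue a' b' • w) : m + p = 0 ∧ n + q = 0 := by
  rw [hw.weightOp_eq hv] at ht
  rw [hw.casimir_eq hv] at hc
  have ht' := smul_left_injective ℂ hw0 ht
  have hc' := smul_left_injective ℂ hw0 hc
  -- The weight of w is (a', b') + pα₁ + qα₂, so (a', b') lies (m + p)α₁ + (n + q)α₂ below (a, b).
  have h := intCast_add_I_mul_inj (a := a - 2 * m + n) (b := b + m - 2 * n)
    (c := a' + 2 * p - q) (d := b' - p + 2 * q) (by push_cast; exact ht')
  refine eq_zero_of_casimirValue_eq (a := a) (b := b) (a' := a') (b' := b') ?_ ?_ hc'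
  · have : (a' : ℤ) = a - 2 * (m + p : ℕ) + (n + q : ℕ) := by push_cast; omega
    exact_mod_cast this
  · have : (b' : ℤ) = b + (m + p : ℕ) - 2 * (n + q : ℕ) := by push_cast; omega
    exact_mod_cast this

theorem IsPrimitive.casimir_eq_of_mem_cyclic {v : V} {a b : ℂ} (hv : IsPrimitive v a b) {w : V}
    (hw : w ∈ hv.cyclic) : casimir V w = casimirValue a b • w := by
  change w ∈ loweringSpan v at hw
  induction hw using Submodule.span_induction with
  | mem w h => obtain ⟨m, n, h⟩ := h; exact h.casimir_eq hv
  | zero => simp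
  | add a b _ _ ha hb => rw [map_add, ha, hb, smul_add]
  | smul c a _ ha => rw [map_smul, ha, smul_comm]

/-- The submodule generated by a primitive vector is irreducible. -/
theorem IsPrimitive.isAtom_cyclic [FiniteDimensional ℂ V] {v : V} {a b : ℂ}
    (hv : IsPrimitive v a b) : IsAtom hv.cyclic := by
  obtain ⟨a, b, rfl, rfl⟩ := hv.exists_nat
  have hne : hv.cyclic ≠ ⊥ := fun h => hv.ne_zero (by
    have := hv.mem_cyclic
    rw [h] at this
    simpa using this)
  refine ⟨hne, fun K hK => ?_⟩
  by_contra hK0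
  have : Nontrivial K := (LieSubmodule.nontrivial_iff_ne_bot ℂ Sl3 V).2 hK0
  obtain ⟨k, m', n', hk⟩ := exists_isPrimitive K
  have hk' : IsPrimitive (k : V) (m' : ℂ) (n' : ℂ) :=
    hk.map K.incl fun h => hk.ne_zero (Subtype.ext h)
  have hkv : (k : V) ∈ hv.cyclic := hK.le k.2
  have hspan := mem_span_of_mem_maxGenEigenspace (weightOp V)
    (S := {w | ∃ m n, IsLowering v m n w})
    (by rintro w ⟨m, n, hw⟩; exact ⟨_, hw.weightOp_eq hv⟩) hkv (τ := (m' : ℂ) + Complex.I * n')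
    (Module.End.eigenspace_le_maxGenEigenspace (Module.End.mem_eigenspace_iff.2 (by
      rw [weightOp_apply, hk'.lie_h₁, hk'.lie_h₂]; module)))
  have hcas : casimirValue (a : ℂ) b = casimirValue m' n' := by
    have h1 := hv.casimir_eq_of_mem_cyclic hkv
    rw [hk'.casimir_eq] at h1
    exact (smul_left_injective ℂ hk'.ne_zero h1).symm
  -- A primitive vector in a nonzero submodule has the Casimir value of v and a weight below that of
  -- v, so its weight is that of v. Only v itself among the lowerings has this weight.
  have hsub : {w | w ∈ {w | ∃ m n, IsLowering v m n w} ∧ w ≠ 0 ∧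
      weightOp V w = ((m' : ℂ) + Complex.I * n') • w} ⊆ {v} := by
    rintro w ⟨⟨m, n, hw⟩, hw0, ht⟩
    have h0 := hw.eq_zero_of_weight hv hw0 (p := 0) (q := 0) (a' := m') (b' := n')
      (by simpa using ht) (by rw [hw.casimir_eq hv, hcas])
    obtain ⟨rfl, rfl⟩ : m = 0 ∧ n = 0 := by omega
    cases hw
    rfl
  obtain ⟨c, hc⟩ := Submodule.mem_span_singleton.1 (Submodule.span_mono hsub hspan)
  have hc0 : c ≠ 0 := by
    rintro rfl
    rw [zero_smul] at hc
    exact hk'.ne_zero hc.symm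
  have hvK : v ∈ K := by
    have := K.smul_mem c⁻¹ k.2
    rwa [← hc, smul_smul, inv_mul_cancel₀ hc0, one_smul] at this
  exact absurd (hv.cyclic_le hvK) hK.not_ge

end Modules

end

noncomputable section

/-! ### Complete reducibility -/

section Modules

variable {V : Type*} [AddCommGroup V] [Module ℂ V] [LieRingModule Sl3 V] [LieModule ℂ Sl3 V]

theorem map_casimir {W : Type*} [AddCommGroup W] [Module ℂ W] [LieRingModule Sl3 W]
    [LieModule ℂ Sl3 W] (φ : V →ₗ⁅ℂ,Sl3⁆ W) (v : V) : φ (casimir V v) = casimir W (φ v) := by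
  simp only [casimir_apply, map_sum, LieModuleHom.map_lie]

theorem toEnd_comm (x y : Sl3) : LieModule.toEnd ℂ Sl3 V x * LieModule.toEnd ℂ Sl3 V y -
    LieModule.toEnd ℂ Sl3 V y * LieModule.toEnd ℂ Sl3 V x = LieModule.toEnd ℂ Sl3 V ⁅x, y⁆ :=
  LinearMap.ext fun v => (lie_lie x y v).symm

theorem commute_casimir_toEnd (x : Sl3) : Commute (casimir V) (LieModule.toEnd ℂ Sl3 V x) :=
  LinearMap.ext fun v => casimir_lie x v

/-- The lowerings of primitive vectors with natural weights. -/
def loweringSet (V : Type*) [AddCommGroup V] [Module ℂ V] [LieRingModule Sl3 V]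
    [LieModule ℂ Sl3 V] : Set V :=
  {w | ∃ (p : V) (a b m n : ℕ), IsPrimitive p (a : ℂ) (b : ℂ) ∧ IsLowering p m n w}

/-- Each irreducible submodule contains a primitive vector and is generated by it. The sum of the
irreducibles is thus spanned by genuine eigenvectors of both the weight and the Casimir operator. -/
theorem sSup_atoms_le_span [FiniteDimensional ℂ V] :
    (sSup {K : LieSubmodule ℂ Sl3 V | IsAtom K}).toSubmodule ≤
      Submodule.span ℂ (loweringSet V) := by
  rw [LieSubmodule.sSup_toSubmodule]
  refine sSup_le ?_
  rintro _ ⟨K, hK, rfl⟩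
  have : Nontrivial K := (LieSubmodule.nontrivial_iff_ne_bot ℂ Sl3 V).2 hK.1
  obtain ⟨k, a, b, hk⟩ := exists_isPrimitive K
  have hk' : IsPrimitive (k : V) (a : ℂ) (b : ℂ) :=
    hk.map K.incl fun h => hk.ne_zero (Subtype.ext h)
  have hle : hk'.cyclic ≤ K := hk'.cyclic_le k.2
  have heq : hk'.cyclic = K := (hK.le_iff.1 hle).resolve_left hk'.isAtom_cyclic.1
  rw [← heq]
  refine Submodule.span_mono ?_
  rintro w ⟨m, n, hw⟩
  exact ⟨k, a, b, m, n, hk', hw⟩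

theorem mem_span_of_weight {k : V} (hk : k ∈ Submodule.span ℂ (loweringSet V)) {τ c : ℂ}
    (hτ : k ∈ (weightOp V).maxGenEigenspace τ) (hc : k ∈ (casimir V).maxGenEigenspace c) :
    k ∈ Submodule.span ℂ {w | w ∈ loweringSet V ∧ w ≠ 0 ∧ weightOp V w = τ • w ∧
      casimir V w = c • w} := by
  have h1 := mem_span_of_mem_maxGenEigenspace (weightOp V)
    (by rintro w ⟨p, a, b, m, n, hp, hw⟩; exact ⟨_, hw.weightOp_eq hp⟩) hk hτ
  have h2 := mem_span_of_mem_maxGenEigenspace (casimir V)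
    (by rintro w ⟨⟨p, a, b, m, n, hp, hw⟩, -⟩; exact ⟨_, hw.casimir_eq hp⟩) h1 hc
  refine Submodule.span_mono ?_ h2
  rintro w ⟨⟨h1, h2, h3⟩, -, h4⟩
  exact ⟨h1, h2, h3, h4⟩

theorem eq_of_mem_loweringSet {w : V} {a b : ℕ} (hw : w ∈ loweringSet V) (hw0 : w ≠ 0)
    (ht : weightOp V w = ((a : ℂ) + Complex.I * b) • w)
    (hc : casimir V w = casimirValue a b • w) : IsPrimitive w (a : ℂ) (b : ℂ) := by
  obtain ⟨p, a', b', m, n, hp, hw⟩ := hw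
  have h0 := hw.eq_zero_of_weight hp hw0 (p := 0) (q := 0) (a' := a) (b' := b)
    (by simpa using ht) hc
  obtain ⟨rfl, rfl⟩ : m = 0 ∧ n = 0 := by omega
  have ht' := hw.weightOp_eq hp
  rw [ht] at ht'
  have h := intCast_add_I_mul_inj (a := a) (b := b) (c := a') (d := b')
    (by simpa using smul_left_injective ℂ hw0 ht')
  cases hw
  obtain ⟨rfl, rfl⟩ : a = a' ∧ b = b' := by omega
  exact hp

/-- A finite dimensional module is the sum of its irreducible submodules. -/
theorem sSup_irreducible_eq_top [FiniteDimensional ℂ V] :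
    sSup {K : LieSubmodule ℂ Sl3 V | IsAtom K} = ⊤ := by
  by_contra hne
  set N := sSup {K : LieSubmodule ℂ Sl3 V | IsAtom K} with hN
  have hNspan : ∀ u ∈ N, u ∈ Submodule.span ℂ (loweringSet V) := fun u hu => sSup_atoms_le_span hu
  have hNcyc : ∀ {p : V} {a b : ℂ}, IsPrimitive p a b → p ∈ N := fun hp =>
    (le_sSup hp.isAtom_cyclic : hp.cyclic ≤ N) hp.mem_cyclic
  clear_value N
  have : Nontrivial (V ⧸ N) := Submodule.Quotient.nontrivial_iff.2
    fun h => hne (LieSubmodule.toSubmodule_injective (by simpa using h))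
  have : FiniteDimensional ℂ (V ⧸ N) := inferInstanceAs (FiniteDimensional ℂ (V ⧸ N.toSubmodule))
  -- The contradiction will come from lifting this primitive vector to a primitive vector of V,
  -- which must already lie in N.
  obtain ⟨v', a, b, hv'⟩ := exists_isPrimitive (V ⧸ N)
  obtain ⟨v, rfl⟩ := LieSubmodule.Quotient.surjective_mk' N v'
  have hq : ∀ {x y : V}, LieSubmodule.Quotient.mk' N x = LieSubmodule.Quotient.mk' N y →
      x - y ∈ N := fun {x y} h => by
    rw [← LieSubmodule.Quotient.mk_eq_zero, map_sub, h, sub_self]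
  have hq' : ∀ {x y : V}, x - y ∈ N →
      LieSubmodule.Quotient.mk' N x = LieSubmodule.Quotient.mk' N y := fun {x y} h => by
    rwa [← LieSubmodule.Quotient.mk_eq_zero, map_sub, sub_eq_zero] at h
  have hcomm : Commute (weightOp V) (casimir V) := (commute_casimir_toEnd _).symm
  -- a lift that is a generalized eigenvector of both operators
  obtain ⟨u, huN, hu⟩ := exists_sub_mem_maxGenEigenspace (weightOp V) (N := N.toSubmodule)
    (fun u hu => N.lie_mem hu) (τ := (a : ℂ) + Complex.I * b) (v := v) (by
      refine hq ?_
      rw [weightOp_apply, map_add, map_smul, LieModuleHom.map_lie, LieModuleHom.map_lie,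
        hv'.lie_h₁, hv'.lie_h₂, map_smul]
      module)
  have hcasN : ∀ u ∈ N, casimir V u ∈ N := fun u hu => by
    rw [casimir_apply]
    exact sum_mem fun i _ => sum_mem fun j _ => N.lie_mem (N.lie_mem hu)
  have hvu : LieSubmodule.Quotient.mk' N (v - u) = LieSubmodule.Quotient.mk' N v :=
    hq' (by simpa using huN)
  -- The second correction is made inside the generalized weight space, so that the first property
  -- survives.
  obtain ⟨u', hu'N, hu'⟩ := exists_sub_mem_maxGenEigenspace (casimir V)
    (N := N.toSubmodule ⊓ (weightOp V).maxGenEigenspace ((a : ℂ) + Complex.I * b))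
    (fun u hu => ⟨hcasN u hu.1, Module.End.mapsTo_maxGenEigenspace_of_comm hcomm _ hu.2⟩)
    (τ := casimirValue a b) (v := v - u)
    ⟨hq (by rw [map_casimir, hvu, map_smul, hvu, hv'.casimir_eq]),
      sub_mem (Module.End.mapsTo_maxGenEigenspace_of_comm hcomm _ hu) (Submodule.smul_mem _ _ hu)⟩
  set w := v - u - u' with hw
  have hwv : LieSubmodule.Quotient.mk' N w = LieSubmodule.Quotient.mk' N v :=
    (hq' (by rw [hw, sub_sub_cancel_left]; exact N.neg_mem hu'N.1)).trans hvu
  have hwT : w ∈ (weightOp V).maxGenEigenspace ((a : ℂ) + Complex.I * b) := sub_mem hu hu'N.2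
  have hwC : w ∈ (casimir V).maxGenEigenspace (casimirValue a b) := hu'
  clear_value w
  rw [← hwv] at hv'
  have hlie : ∀ x : Sl3, ⁅x, w⁆ ∈ (casimir V).maxGenEigenspace (casimirValue a b) := fun x =>
    Module.End.mapsTo_maxGenEigenspace_of_comm (commute_casimir_toEnd x) _ hwC
  -- For x raising weights by pα₁ + qα₂, the vector ⁅x, w⁆ lies in N, with raised weight but with
  -- the Casimir value of (a, b). No nonzero lowering in N has this combination, so ⁅x, w⁆ vanishes.
  have hkill : ∀ (x : Sl3) (p q : ℕ), ⁅x, LieSubmodule.Quotient.mk' N w⁆ = 0 → p + q ≠ 0 →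
      ⁅tracelessUnit 0 0 - tracelessUnit 1 1 +
        Complex.I • (tracelessUnit 1 1 - tracelessUnit 2 2), x⁆ =
        ((2 * p - q : ℂ) + Complex.I * (-p + 2 * q)) • x → ⁅x, w⁆ = 0 := by
    intro x p q hx hpq hshift
    have h1 : ⁅x, w⁆ ∈ N := by
      rwa [← LieSubmodule.Quotient.mk_eq_zero, LieModuleHom.map_lie]
    have h2 : ⁅x, w⁆ ∈ (weightOp V).maxGenEigenspace
        (((a : ℂ) + 2 * p - q) + Complex.I * (b - p + 2 * q)) := by
      have := mem_maxGenEigenspace_of_shift (h := weightOp V) (e := LieModule.toEnd ℂ Sl3 V x)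
        (c := (2 * p - q : ℂ) + Complex.I * (-p + 2 * q))
        (by rw [weightOp, toEnd_comm, hshift, map_smul]) hwT
      rw [LieModule.toEnd_apply_apply] at this
      convert this using 2
      ring
    have h3 := mem_span_of_weight (hNspan _ h1) h2 (hlie x)
    have hempty : {w | w ∈ loweringSet V ∧ w ≠ 0 ∧ weightOp V w =
        (((a : ℂ) + 2 * p - q) + Complex.I * (b - p + 2 * q)) • w ∧
        casimir V w = casimirValue a b • w} = ∅ := by
      rw [Set.eq_empty_iff_forall_notMem]
      rintro y ⟨⟨z, a', b', m, n, hz, hy⟩, hy0, hyT, hyC⟩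
      have := hy.eq_zero_of_weight hz hy0 hyT hyC
      omega
    rw [hempty, Submodule.span_empty] at h3
    exact h3
  have he1 : ⁅tracelessUnit 0 1, w⁆ = 0 := hkill _ 1 0 hv'.lie_e₁ (by simp) (by
    rw [add_lie, smul_lie, lie_h₁_e₁, lie_h₂_e₁]
    push_cast
    module)
  have he2 : ⁅tracelessUnit 1 2, w⁆ = 0 := hkill _ 0 1 hv'.lie_e₂ (by simp) (by
    rw [add_lie, smul_lie, lie_h₁_e₂, lie_h₂_e₂]
    push_cast
    module)
  -- Applied to the coroots: the defect ⁅x, w⁆ - t • w lies in N with weight and Casimir value of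
  -- (a, b), hence is a combination of primitive vectors. So x - t kills it, and w is killed by the
  -- square.
  have hsemi : ∀ (x : Sl3) (t : ℂ), ⁅x, LieSubmodule.Quotient.mk' N w⁆ =
      t • LieSubmodule.Quotient.mk' N w → Commute (weightOp V) (LieModule.toEnd ℂ Sl3 V x) →
      (∀ y : V, IsPrimitive y (a : ℂ) (b : ℂ) → ⁅x, y⁆ = t • y) →
      w ∈ (LieModule.toEnd ℂ Sl3 V x).maxGenEigenspace t := by
    intro x t hx hxT hprim
    have h1 : ⁅x, w⁆ - t • w ∈ N := hq (by rw [LieModuleHom.map_lie, map_smul, hx])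
    have h2 : ⁅x, w⁆ - t • w ∈ (weightOp V).maxGenEigenspace ((a : ℂ) + Complex.I * b) :=
      sub_mem (Module.End.mapsTo_maxGenEigenspace_of_comm hxT _ hwT) (Submodule.smul_mem _ _ hwT)
    have h3 := mem_span_of_weight (hNspan _ h1) h2 (sub_mem (hlie x) (Submodule.smul_mem _ _ hwC))
    have h4 : ⁅x, w⁆ - t • w ∈ (LieModule.toEnd ℂ Sl3 V x).eigenspace t := by
      refine Submodule.span_le.2 ?_ h3
      rintro y ⟨hy, hy0, hyT, hyC⟩
      exact Module.End.mem_eigenspace_iff.2 (hprim y (eq_of_mem_loweringSet hy hy0 hyT hyC))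
    rw [Module.End.mem_eigenspace_iff] at h4
    rw [Module.End.mem_maxGenEigenspace]
    refine ⟨2, ?_⟩
    rw [pow_two, Module.End.mul_apply]
    change LieModule.toEnd ℂ Sl3 V x (⁅x, w⁆ - t • w) - t • (⁅x, w⁆ - t • w) = 0
    rw [h4, sub_self]
  have hcT : ∀ x : Sl3, ⁅tracelessUnit 0 0 - tracelessUnit 1 1 +
        Complex.I • (tracelessUnit 1 1 - tracelessUnit 2 2), x⁆ = 0 →
      Commute (weightOp V) (LieModule.toEnd ℂ Sl3 V x) := by
    intro x hx
    rw [commute_iff_eq, ← sub_eq_zero, weightOp, toEnd_comm, hx, map_zero]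
  have hw1 := hsemi (tracelessUnit 0 0 - tracelessUnit 1 1) a hv'.lie_h₁
    (hcT _ (by rw [add_lie, lie_self, smul_lie, ← lie_skew, lie_h₁_h₂]; simp))
    fun y hy => hy.lie_h₁
  have hw2 := hsemi (tracelessUnit 1 1 - tracelessUnit 2 2) b hv'.lie_h₂
    (hcT _ (by rw [add_lie, smul_lie, lie_self, lie_h₁_h₂]; simp))
    fun y hy => hy.lie_h₂
  have hw0 : w ≠ 0 := fun h => hv'.ne_zero (by rw [h, map_zero])
  -- Once w is killed by the raising operators, the 𝔰𝔩₂ argument removes the possible Jordan blocks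
  -- of the coroots.
  have hprim : IsPrimitive w (a : ℂ) (b : ℂ) :=
    { ne_zero := hw0
      lie_e₁ := he1
      lie_e₂ := he2
      lie_h₁ := eigen_of_raise_eq_zero (e := LieModule.toEnd ℂ Sl3 V (tracelessUnit 0 1))
        (f := LieModule.toEnd ℂ Sl3 V (tracelessUnit 1 0)) (by rw [toEnd_comm, lie_e₁_f₁])
        (by rw [toEnd_comm, lie_h₁_f₁, map_smul]) (by rw [toEnd_comm, lie_h₁_e₁, map_smul]) he1 hw1
      lie_h₂ := eigen_of_raise_eq_zero (e := LieModule.toEnd ℂ Sl3 V (tracelessUnit 1 2))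
        (f := LieModule.toEnd ℂ Sl3 V (tracelessUnit 2 1)) (by rw [toEnd_comm, lie_e₂_f₂])
        (by rw [toEnd_comm, lie_h₂_f₂, map_smul]) (by rw [toEnd_comm, lie_h₂_e₂, map_smul])
        he2 hw2 }
  exact hv'.ne_zero ((LieSubmodule.Quotient.mk_eq_zero N).2 (hNcyc hprim))

/-- The generated submodule is irreducible and is not contained in the kernel, so it meets the
kernel trivially. -/
theorem IsPrimitive.injective_comp_incl [FiniteDimensional ℂ V] {U : Type*} [AddCommGroup U]
    [Module ℂ U] [LieRingModule Sl3 U] [LieModule ℂ Sl3 U] {p : V} {a b : ℂ}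
    (hp : IsPrimitive p a b) (π : V →ₗ⁅ℂ,Sl3⁆ U) (hπ : π p ≠ 0) :
    Function.Injective (π.comp hp.cyclic.incl) := by
  have hK : hp.cyclic ⊓ π.ker = ⊥ := by
    refine (hp.isAtom_cyclic.le_iff.1 inf_le_left).resolve_right fun h => hπ ?_
    have := hp.mem_cyclic
    rw [← h] at this
    exact this.2
  rw [injective_iff_map_eq_zero]
  intro x hx
  have : (x : V) ∈ hp.cyclic ⊓ π.ker := ⟨x.2, hx⟩
  rw [hK] at this
  exact Subtype.ext this

/-- Weyl's theorem for `𝔰𝔩₃`. -/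
theorem complementedLattice_lieSubmodule [FiniteDimensional ℂ V] :
    ComplementedLattice (LieSubmodule ℂ Sl3 V) :=
  complementedLattice_of_sSup_atoms_eq_top sSup_irreducible_eq_top

end Modules

/-! ### Irreducible modules are determined by their highest weights -/

section Product

variable {L V W : Type*} [LieRing L] [LieAlgebra ℂ L]
  [AddCommGroup V] [Module ℂ V] [LieRingModule L V] [LieModule ℂ L V]
  [AddCommGroup W] [Module ℂ W] [LieRingModule L W] [LieModule ℂ L W]

instance prodLieRingModule : LieRingModule L (V × W) where
  bracket x p := (⁅x, p.1⁆, ⁅x, p.2⁆)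
  add_lie x y p := Prod.ext (add_lie x y p.1) (add_lie x y p.2)
  lie_add x p q := Prod.ext (lie_add x p.1 q.1) (lie_add x p.2 q.2)
  leibniz_lie x y p := Prod.ext (leibniz_lie x y p.1) (leibniz_lie x y p.2)

instance prodLieModule : LieModule ℂ L (V × W) where
  smul_lie t x p := Prod.ext (smul_lie t x p.1) (smul_lie t x p.2)
  lie_smul t x p := Prod.ext (lie_smul t x p.1) (lie_smul t x p.2)

variable (L V W) in
/-- The first projection. -/
def lieFst : V × W →ₗ⁅ℂ,L⁆ V := { LinearMap.fst ℂ V W with map_lie' := rfl }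

variable (L V W) in
/-- The second projection. -/
def lieSnd : V × W →ₗ⁅ℂ,L⁆ W := { LinearMap.snd ℂ V W with map_lie' := rfl }

end Product

/-- An irreducible module embeds into every module with a primitive vector of the same weight. -/
theorem exists_injective_of_isPrimitive {V W : Type*} [AddCommGroup V] [Module ℂ V]
    [LieRingModule Sl3 V] [LieModule ℂ Sl3 V] [AddCommGroup W] [Module ℂ W] [LieRingModule Sl3 W]
    [LieModule ℂ Sl3 W] [FiniteDimensional ℂ V] [FiniteDimensional ℂ W]
    [LieModule.IsIrreducible ℂ Sl3 V] {v : V} {w : W} {a b : ℂ} (hv : IsPrimitive v a b)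
    (hw : IsPrimitive w a b) : ∃ φ : V →ₗ⁅ℂ,Sl3⁆ W, Function.Injective φ := by
  -- The irreducible submodule generated by (v, w) projects isomorphically onto V and injectively to
  -- W; it is the graph of the required embedding.
  have hp : IsPrimitive (v, w) a b :=
    { ne_zero := fun h => hv.ne_zero (congrArg Prod.fst h)
      lie_e₁ := Prod.ext hv.lie_e₁ hw.lie_e₁
      lie_e₂ := Prod.ext hv.lie_e₂ hw.lie_e₂
      lie_h₁ := Prod.ext hv.lie_h₁ hw.lie_h₁
      lie_h₂ := Prod.ext hv.lie_h₂ hw.lie_h₂ }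
  have h1 := hp.injective_comp_incl (lieFst Sl3 V W) hv.ne_zero
  have h2 := hp.injective_comp_incl (lieSnd Sl3 V W) hw.ne_zero
  have hsurj : Function.Surjective ((lieFst Sl3 V W).comp hp.cyclic.incl) := by
    rw [← LieModuleHom.range_eq_top]
    refine (IsSimpleOrder.eq_bot_or_eq_top _).resolve_left fun h => hv.ne_zero ?_
    have : v ∈ ((lieFst Sl3 V W).comp hp.cyclic.incl).range :=
      (LieModuleHom.mem_range _ _).2 ⟨⟨(v, w), hp.mem_cyclic⟩, rfl⟩
    rwa [h] at this
  let e := LinearEquiv.ofBijective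
    ((lieFst Sl3 V W).comp hp.cyclic.incl : hp.cyclic →ₗ[ℂ] V) ⟨h1, hsurj⟩
  let ψ : V →ₗ⁅ℂ,Sl3⁆ hp.cyclic :=
    { e.symm.toLinearMap with
      map_lie' := fun {x y} => by
        change e.symm ⁅x, y⁆ = ⁅x, e.symm y⁆
        rw [LinearEquiv.symm_apply_eq]
        change _ = (lieFst Sl3 V W).comp hp.cyclic.incl ⁅x, e.symm y⁆
        rw [LieModuleHom.map_lie]
        exact congrArg (fun z => ⁅x, z⁆) (e.apply_symm_apply y).symm }
  exact ⟨((lieSnd Sl3 V W).comp hp.cyclic.incl).comp ψ, h2.comp e.symm.injective⟩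

end

noncomputable section

attribute [local instance] hasBinaryBiproducts_of_finite_biproducts

/-! ### The category of finite dimensional modules -/

namespace FDLieMod

section General

variable {L : Type} [LieRing L] [LieAlgebra ℂ L]

theorem isIso_of_bijective {V W : FDLieMod L} (f : V ⟶ W) (h : Function.Bijective (toLie f)) :
    IsIso f := by
  let e := LinearEquiv.ofBijective (toLie f : V →ₗ[ℂ] W) h
  let g : W →ₗ⁅ℂ,L⁆ V :=
    { e.symm.toLinearMap with
      map_lie' := fun {x y} => by
        change e.symm ⁅x, y⁆ = ⁅x, e.symm y⁆
        rw [LinearEquiv.symm_apply_eq]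
        change _ = toLie f ⁅x, e.symm y⁆
        rw [LieModuleHom.map_lie]
        exact congrArg (fun z => ⁅x, z⁆) (e.apply_symm_apply y).symm }
  exact ⟨ofLie g, hom_ext fun v => e.symm_apply_apply v, hom_ext fun v => e.apply_symm_apply v⟩

instance finite_hom (V W : FDLieMod L) : Module.Finite ℂ (V ⟶ W) :=
  Module.Finite.of_injective
    ({ toFun := fun f => (toLie f : V →ₗ[ℂ] W), map_add' := fun _ _ => rfl,
       map_smul' := fun _ _ => rfl } : (V ⟶ W) →ₗ[ℂ] (V →ₗ[ℂ] W))
    fun _ _ h => hom_ext fun v => LinearMap.congr_fun h v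

/-- A Lie submodule, as an object. -/
def ofSubmodule {V : FDLieMod L} (N : LieSubmodule ℂ L V) : FDLieMod L where
  carrier := N

theorem isZero_of_subsingleton (V : FDLieMod L) [Subsingleton V] : IsZero V := by
  rw [IsZero.iff_id_eq_zero]
  exact hom_ext fun v => Subsingleton.elim _ _

theorem subsingleton_of_isZero {V : FDLieMod L} (h : IsZero V) : Subsingleton V := by
  refine subsingleton_of_forall_eq 0 fun v => ?_
  rw [IsZero.iff_id_eq_zero] at h
  exact congrArg (fun f => toLie f v) h

/-- Complementary submodules decompose the module. -/
theorem nonempty_iso_biprod {V : FDLieMod L} {N K : LieSubmodule ℂ L V} (h : IsCompl N K) :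
    Nonempty (V ≅ ofSubmodule N ⊞ ofSubmodule K) := by
  let f : ofSubmodule N ⊞ ofSubmodule K ⟶ V :=
    biprod.desc (ofLie (V := ofSubmodule N) N.incl) (ofLie (V := ofSubmodule K) K.incl)
  have hf : ∀ x, toLie f x = (toLie (biprod.fst : ofSubmodule N ⊞ ofSubmodule K ⟶ _) x : N).1 +
      (toLie (biprod.snd : ofSubmodule N ⊞ ofSubmodule K ⟶ _) x : K).1 := by
    intro x
    have : f = biprod.fst ≫ ofLie (V := ofSubmodule N) N.incl +
        biprod.snd ≫ ofLie (V := ofSubmodule K) K.incl := by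
      ext <;> simp [f]
    rw [this]; rfl
  have hx : ∀ x, x = toLie (biprod.inl : _ ⟶ ofSubmodule N ⊞ ofSubmodule K)
      (toLie (biprod.fst : ofSubmodule N ⊞ ofSubmodule K ⟶ _) x) +
      toLie (biprod.inr : _ ⟶ ofSubmodule N ⊞ ofSubmodule K)
      (toLie (biprod.snd : ofSubmodule N ⊞ ofSubmodule K ⟶ _) x) := fun x =>
    (congrArg (fun f => toLie f x) (biprod.total (X := ofSubmodule N) (Y := ofSubmodule K))).symm
  have hbij : Function.Bijective (toLie f) := by
    constructor
    · rw [injective_iff_map_eq_zero]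
      intro x h0
      rw [hf] at h0
      have h1 : (toLie (biprod.fst : ofSubmodule N ⊞ ofSubmodule K ⟶ _) x : N).1 ∈ N ⊓ K := by
        refine ⟨Subtype.property (p := (· ∈ N)) _, ?_⟩
        rw [eq_neg_of_add_eq_zero_left h0]
        exact K.neg_mem (Subtype.property (p := (· ∈ K)) _)
      rw [h.inf_eq_bot, LieSubmodule.mem_bot] at h1
      rw [h1, zero_add] at h0
      have h1' : toLie (biprod.fst : ofSubmodule N ⊞ ofSubmodule K ⟶ _) x = 0 :=
        Subtype.ext (p := (· ∈ N)) h1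
      have h2' : toLie (biprod.snd : ofSubmodule N ⊞ ofSubmodule K ⟶ _) x = 0 :=
        Subtype.ext (p := (· ∈ K)) h0
      rw [hx x, h1', h2', map_zero, map_zero, add_zero]
    · intro v
      have hv : v ∈ N ⊔ K := by rw [h.sup_eq_top]; trivial
      obtain ⟨n, hn, k, hk, rfl⟩ := (LieSubmodule.mem_sup _ _ _).1 hv
      refine ⟨toLie (biprod.inl : _ ⟶ ofSubmodule N ⊞ ofSubmodule K) (⟨n, hn⟩ : N) +
        toLie (biprod.inr : _ ⟶ ofSubmodule N ⊞ ofSubmodule K) (⟨k, hk⟩ : K), ?_⟩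
      rw [map_add]
      have h1 : toLie (biprod.inl ≫ f) (⟨n, hn⟩ : N) = n := by
        rw [show biprod.inl ≫ f = ofLie (V := ofSubmodule N) N.incl by simp [f]]; rfl
      have h2 : toLie (biprod.inr ≫ f) (⟨k, hk⟩ : K) = k := by
        rw [show biprod.inr ≫ f = ofLie (V := ofSubmodule K) K.incl by simp [f]]; rfl
      exact congrArg₂ (· + ·) h1 h2
  have := isIso_of_bijective f hbij
  exact ⟨(asIso f).symm⟩

/-- Schur's lemma: nonzero morphisms between irreducible modules are isomorphisms. -/
theorem isIso_of_ne_zero {V W : FDLieMod L} [LieModule.IsIrreducible ℂ L V]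
    [LieModule.IsIrreducible ℂ L W] {f : V ⟶ W} (hf : f ≠ 0) : IsIso f := by
  refine isIso_of_bijective f ⟨?_, ?_⟩
  · refine (LieModuleHom.ker_eq_bot (toLie f)).1 ?_
    refine (IsSimpleOrder.eq_bot_or_eq_top _).resolve_right fun h => hf (hom_ext fun v => ?_)
    have : v ∈ (toLie f).ker := by rw [h]; trivial
    exact this
  · rw [← LieModuleHom.range_eq_top]
    refine (IsSimpleOrder.eq_bot_or_eq_top _).resolve_left fun h => hf (hom_ext fun v => ?_)
    have : toLie f v ∈ (toLie f).range := (LieModuleHom.mem_range _ _).2 ⟨v, rfl⟩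
    rw [h] at this
    exact this

theorem isLocalRing_end_of_isIrreducible (V : FDLieMod L) [LieModule.IsIrreducible ℂ L V] :
    IsLocalRing (End V) where
  exists_pair_ne := by
    have : Nontrivial V := LieModule.nontrivial_of_isIrreducible ℂ L V
    obtain ⟨v, hv⟩ := exists_ne (0 : V)
    exact ⟨0, 1, fun h => hv (congrArg (fun f : V ⟶ V => toLie f v) h).symm⟩
  isUnit_or_isUnit_of_add_one {a b} h := by
    by_cases ha : a = 0
    · right
      rw [ha, zero_add] at h
      rw [h]
      exact isUnit_one
    · left
      rw [isUnit_iff_isIso]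
      exact isIso_of_ne_zero ha

theorem finrank_hom_le_one {V W : FDLieMod L} [LieModule.IsIrreducible ℂ L V]
    [LieModule.IsIrreducible ℂ L W] : Module.finrank ℂ (V ⟶ W) ≤ 1 := by
  by_cases h : ∃ f : V ⟶ W, f ≠ 0
  · obtain ⟨f, hf⟩ := h
    have := isIso_of_ne_zero hf
    have := isLocalRing_end_of_isIrreducible V
    refine finrank_le_one f fun g => ?_
    obtain ⟨c, hc⟩ := exists_not_isIso_sub_smul V (g ≫ inv f)
    refine ⟨c, ?_⟩
    have h0 : g ≫ inv f - c • 𝟙 V = 0 := by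
      by_contra h0
      exact hc (isIso_of_ne_zero h0)
    have h1 : g ≫ inv f = c • 𝟙 V := sub_eq_zero.1 h0
    calc c • f = (c • 𝟙 V) ≫ f := by rw [Linear.smul_comp, Category.id_comp]
      _ = g := by rw [← h1]; simp
  · push Not at h
    have : Subsingleton (V ⟶ W) := subsingleton_of_forall_eq 0 h
    rw [Module.finrank_zero_of_subsingleton]
    exact zero_le_one

/-! ### Trivial and dual modules, invariants of tensor products -/

instance isIrreducible_triv : LieModule.IsIrreducible ℂ L (triv : FDLieMod L) := by
  have : Nontrivial (triv : FDLieMod L) := inferInstanceAs (Nontrivial ℂ)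
  refine LieModule.IsIrreducible.mk fun N hN => ?_
  rw [← LieSubmodule.toSubmodule_inj]
  have : IsSimpleOrder (Submodule ℂ (triv : FDLieMod L).carrier) :=
    inferInstanceAs (IsSimpleOrder (Submodule ℂ ℂ))
  refine (IsSimpleOrder.eq_bot_or_eq_top N.toSubmodule).resolve_left fun h => hN ?_
  exact (LieSubmodule.toSubmodule_eq_bot N).1 h

/-- The dual of an irreducible module is irreducible. -/
instance isIrreducible_dual (V : FDLieMod L) [LieModule.IsIrreducible ℂ L V] :
    LieModule.IsIrreducible ℂ L V.dual := by
  have : Nontrivial V := LieModule.nontrivial_of_isIrreducible ℂ L V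
  have : Nontrivial V.dual := inferInstanceAs (Nontrivial (Module.Dual ℂ V))
  refine LieModule.IsIrreducible.mk fun N hN => ?_
  let N' : Submodule ℂ (Module.Dual ℂ V) := N.toSubmodule
  -- The common kernel of the functionals in N is a submodule of V, and double annihilators recover
  -- N from it.
  let K : LieSubmodule ℂ L V :=
    { N'.dualCoannihilator with
      lie_mem := fun {x v} hv => by
        change v ∈ N'.dualCoannihilator at hv
        change ⁅x, v⁆ ∈ N'.dualCoannihilator
        rw [Submodule.mem_dualCoannihilator] at hv ⊢
        intro φ hφ
        have h1 := hv ⁅x, φ⁆ (N.lie_mem hφ)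
        rw [Module.Dual.lie_apply, neg_eq_zero] at h1
        exact h1 }
  have hKN : N' = K.toSubmodule.dualAnnihilator :=
    (Subspace.dualCoannihilator_dualAnnihilator_eq (W := N')).symm
  rcases IsSimpleOrder.eq_bot_or_eq_top K with h | h
  · rw [h] at hKN
    have : N' = ⊤ := by rw [hKN]; simp
    exact LieSubmodule.toSubmodule_injective this
  · rw [h] at hKN
    have : N' = ⊥ := by rw [hKN]; simp
    exact absurd (LieSubmodule.toSubmodule_injective this) hN

/-- Contraction of the first tensor factor with a functional. -/
def contract {V S : FDLieMod L} (φ : V →ₗ[ℂ] ℂ) : TensorProduct ℂ V S →ₗ[ℂ] S :=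
  (TensorProduct.lid ℂ S).toLinearMap ∘ₗ LinearMap.rTensor S φ

theorem contract_tmul {V S : FDLieMod L} (φ : V →ₗ[ℂ] ℂ) (v : V) (s : S) :
    contract φ (v ⊗ₜ[ℂ] s) = φ v • s := by
  simp [contract]

theorem lie_contract {V S : FDLieMod L} (x : L) (φ : V →ₗ[ℂ] ℂ) (t : TensorProduct ℂ V S) :
    ⁅x, contract φ t⁆ = contract ⁅x, φ⁆ t + contract φ ⁅x, t⁆ := by
  induction t with
  | zero => simp
  | add a b ha hb => rw [lie_add, map_add, map_add, map_add, lie_add, ha, hb]; abel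
  | tmul v s =>
    rw [TensorProduct.LieModule.lie_tmul_right, map_add]
    simp only [contract_tmul, Module.Dual.lie_apply, lie_smul]
    module

theorem eq_zero_of_contract {V S : FDLieMod L} (t : TensorProduct ℂ V S)
    (h : ∀ φ : V →ₗ[ℂ] ℂ, contract φ t = 0) : t = 0 := by
  let b := Module.finBasis ℂ V
  have : ∀ t : TensorProduct ℂ V S, t = ∑ i, b i ⊗ₜ[ℂ] contract (b.coord i) t := by
    intro t
    induction t with
    | zero => simp
    | add x y hx hy =>
      simp only [map_add, TensorProduct.tmul_add, Finset.sum_add_distrib]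
      rw [← hx, ← hy]
    | tmul v s =>
      simp only [contract_tmul, TensorProduct.tmul_smul, TensorProduct.smul_tmul']
      rw [← TensorProduct.sum_tmul]
      simp [b.sum_repr]
  rw [this t]
  simp [h]

theorem contract_add {V S : FDLieMod L} (φ ψ : V →ₗ[ℂ] ℂ) (t : TensorProduct ℂ V S) :
    contract (φ + ψ) t = contract φ t + contract ψ t := by
  simp only [contract, LinearMap.rTensor_add, LinearMap.comp_add, LinearMap.add_apply]

theorem contract_smul {V S : FDLieMod L} (c : ℂ) (φ : V →ₗ[ℂ] ℂ) (t : TensorProduct ℂ V S) :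
    contract (c • φ) t = c • contract φ t := by
  simp only [contract, LinearMap.rTensor_smul, LinearMap.comp_smul, LinearMap.smul_apply]

/-- The generator of the trivial module. -/
def trivOne : (triv : FDLieMod L) := (1 : ℂ)

theorem lie_trivOne (x : L) : ⁅x, (trivOne : (triv : FDLieMod L))⁆ = 0 := rfl

theorem eq_smul_trivOne (c : (triv : FDLieMod L)) : ∃ r : ℂ, c = r • trivOne :=
  ⟨(show ℂ from c), (mul_one (show ℂ from c)).symm⟩

/-- The value of a morphism from the trivial module to a tensor product at the generator. -/
def invariantOf {V S : FDLieMod L} (t : (triv : FDLieMod L) ⟶ tensor V S) : TensorProduct ℂ V S :=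
  toLie t trivOne

theorem lie_invariantOf {V S : FDLieMod L} (t : (triv : FDLieMod L) ⟶ tensor V S) (x : L) :
    ⁅x, invariantOf t⁆ = 0 := by
  have := (toLie t).map_lie x trivOne
  rw [lie_trivOne, map_zero] at this
  exact this.symm

/-- An invariant of `V ⊗ S` as a morphism from the dual of `V` to `S`. -/
def homOfInvariant (V S : FDLieMod L) : ((triv : FDLieMod L) ⟶ tensor V S) →ₗ[ℂ] (V.dual ⟶ S) where
  toFun t := ofLie (V := V.dual)
    { toFun := fun φ : V →ₗ[ℂ] ℂ => contract φ (invariantOf t)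
      map_add' := fun φ ψ => contract_add (V := V) φ ψ _
      map_smul' := fun c φ => contract_smul (V := V) c φ _
      map_lie' := fun {x φ} => by
        have h1 := lie_contract (V := V) (S := S) x φ (invariantOf t)
        rw [lie_invariantOf, map_zero, add_zero] at h1
        exact h1.symm }
  map_add' t u := hom_ext fun φ =>
    map_add (contract (V := V) (S := S) φ) (invariantOf t) (invariantOf u)
  map_smul' c t := hom_ext fun φ => map_smul (contract (V := V) (S := S) φ) c (invariantOf t)

theorem homOfInvariant_apply {V S : FDLieMod L} (t : (triv : FDLieMod L) ⟶ tensor V S)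
    (φ : V.dual) : toLie (homOfInvariant V S t) φ =
      contract (V := V) (S := S) (show V →ₗ[ℂ] ℂ from φ) (invariantOf t) := rfl

theorem eq_zero_of_invariantOf {V S : FDLieMod L} {t : (triv : FDLieMod L) ⟶ tensor V S}
    (h : invariantOf t = 0) : t = 0 := by
  have h2 : toLie t trivOne = 0 := h
  refine hom_ext fun c => ?_
  obtain ⟨r, rfl⟩ := eq_smul_trivOne c
  rw [map_smul, h2, smul_zero]
  rfl

/-- An invariant tensor is determined by its contractions. With Schur's lemma for the dual of V and
S, this limits the trivial module to multiplicity one in a product of two simples. -/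
theorem homOfInvariant_injective (V S : FDLieMod L) :
    Function.Injective (homOfInvariant V S) := by
  rw [injective_iff_map_eq_zero]
  intro t ht
  refine eq_zero_of_invariantOf (eq_zero_of_contract (V := V) (S := S) _ fun φ => ?_)
  have h1 := homOfInvariant_apply t φ
  rw [ht] at h1
  exact h1.symm

/-- The evaluation pairing. -/
def evalHom (V : FDLieMod L) : tensor V.dual V ⟶ (triv : FDLieMod L) :=
  ofLie (V := tensor V.dual V) (W := triv)
    { (contractLeft ℂ V : TensorProduct ℂ (Module.Dual ℂ V) V →ₗ[ℂ] ℂ) with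
      map_lie' := fun {x t} =>
        map_lie_of_tmul (V := V.dual) (W := V) (X := triv)
          (contractLeft ℂ V : TensorProduct ℂ (Module.Dual ℂ V) V →ₗ[ℂ] ℂ)
          (fun x φ v => by
            change -(show V →ₗ[ℂ] ℂ from φ) ⁅x, v⁆ + (show V →ₗ[ℂ] ℂ from φ) ⁅x, v⁆ = 0
            ring) x t }

theorem evalHom_ne_zero (V : FDLieMod L) [Nontrivial V] : evalHom V ≠ 0 := by
  intro h
  obtain ⟨v, hv⟩ := exists_ne (0 : V)
  refine hv ((Module.forall_dual_apply_eq_zero_iff ℂ v).1 fun φ => ?_)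
  exact congrArg (fun f => toLie f (tmul (V := V.dual) φ v)) h

end General

end FDLieMod

end

noncomputable section

attribute [local instance] hasBinaryBiproducts_of_finite_biproducts

namespace FDLieMod

/-! ### Indecomposable `𝔰𝔩₃`-modules -/

/-- A nonzero module splits off an irreducible submodule. -/
theorem exists_isAtom_isCompl (V : FinSl3) [Nontrivial V] :
    ∃ N K : LieSubmodule ℂ Sl3 V, IsAtom N ∧ IsCompl N K := by
  obtain ⟨v, m, n, hv⟩ := exists_isPrimitive V
  have := complementedLattice_lieSubmodule (V := V)
  obtain ⟨K, hK⟩ := exists_isCompl hv.cyclic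
  exact ⟨_, K, hv.isAtom_cyclic, hK⟩

theorem isIrreducible_of_isAtom {V : FinSl3} {N : LieSubmodule ℂ Sl3 V} (hN : IsAtom N) :
    LieModule.IsIrreducible ℂ Sl3 (ofSubmodule N) := by
  have : Nontrivial N := (LieSubmodule.nontrivial_iff_ne_bot ℂ Sl3 V).2 hN.1
  have key : LieModule.IsIrreducible ℂ Sl3 N := by
    refine LieModule.IsIrreducible.mk fun K hK => ?_
    have hle : K.map N.incl ≤ N := LieSubmodule.map_incl_le
    rcases hN.le_iff.1 hle with h | h
    · refine absurd ?_ hK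
      rw [LieSubmodule.eq_bot_iff]
      intro x hx
      have : (x : V) ∈ K.map N.incl := LieSubmodule.mem_map_of_mem hx
      rw [h, LieSubmodule.mem_bot] at this
      exact Subtype.ext this
    · rw [eq_top_iff]
      intro x _
      have hx : (x : V) ∈ K.map N.incl := by rw [h]; exact x.2
      obtain ⟨y, hy, hyx⟩ := (LieSubmodule.mem_map _).1 hx
      have : y = x := Subtype.ext hyx
      rwa [← this]
  exact key

theorem eq_bot_of_isZero {V : FinSl3} {N : LieSubmodule ℂ Sl3 V} (h : IsZero (ofSubmodule N)) :
    N = ⊥ := by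
  by_contra hN
  have h1 : Nontrivial N := (LieSubmodule.nontrivial_iff_ne_bot ℂ Sl3 V).2 hN
  have h2 : Subsingleton N := subsingleton_of_isZero h
  exact not_subsingleton N h2

theorem isIrreducible_of_indecomposable {V : FinSl3} (hV : Indecomposable V) :
    LieModule.IsIrreducible ℂ Sl3 V := by
  have : Nontrivial V := by
    rw [← not_subsingleton_iff_nontrivial]
    exact fun h => hV.1 (isZero_of_subsingleton V)
  obtain ⟨N, K, hN, hNK⟩ := exists_isAtom_isCompl V
  obtain ⟨e⟩ := nonempty_iso_biprod hNK
  have hK : K = ⊥ := by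
    rcases hV.2 _ _ e with h | h
    · exact absurd (eq_bot_of_isZero h) hN.1
    · exact eq_bot_of_isZero h
  have hN' : N = ⊤ := by
    have := hNK.sup_eq_top
    rwa [hK, sup_bot_eq] at this
  rw [hN'] at hN
  refine LieModule.IsIrreducible.mk fun M hM => ?_
  exact (hN.le_iff.1 le_top).resolve_left hM

/-- Induction on dimension, splitting off one irreducible submodule by complete reducibility;
Schur's lemma makes its endomorphism ring local. -/
theorem isKrullSchmidt : IsKrullSchmidt FinSl3 := by
  have key : ∀ (d : ℕ) (V : FinSl3), Module.finrank ℂ V = d → ∃ (n : ℕ) (Y : Fin n → FinSl3),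
      (∀ i, IsLocalRing (End (Y i))) ∧ Nonempty (V ≅ ⨁ Y) := by
    intro d
    induction d using Nat.strong_induction_on with
    | _ d ih =>
      intro V hd
      rcases subsingleton_or_nontrivial V with hV | hV
      · exact ⟨0, Fin.elim0, fun i => i.elim0,
          ⟨(isZero_of_subsingleton V).iso (isZero_biproduct_fin_zero _)⟩⟩
      · obtain ⟨N, K, hN, hNK⟩ := exists_isAtom_isCompl V
        obtain ⟨e⟩ := nonempty_iso_biprod hNK
        have hK : K.toSubmodule ≠ ⊤ := fun h => hN.1 (by
          have := hNK.inf_eq_bot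
          rwa [(LieSubmodule.toSubmodule_eq_top K).1 h, inf_top_eq] at this)
        obtain ⟨n, Y, hY, ⟨f⟩⟩ := ih _ (hd ▸ Submodule.finrank_lt hK) (ofSubmodule K) rfl
        have := isIrreducible_of_isAtom hN
        refine ⟨n + 1, Fin.cons (ofSubmodule N) Y, fun i => ?_,
          ⟨e ≪≫ biprod.mapIso (Iso.refl _) f ≪≫ (biproductFinSuccIso
            (Fin.cons (ofSubmodule N) Y : Fin (n + 1) → FinSl3)).symm⟩⟩
        refine Fin.cases ?_ (fun i => ?_) i
        · exact isLocalRing_end_of_isIrreducible (ofSubmodule N)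
        · exact hY i
  exact fun V => key _ V rfl

instance : Fact (IsKrullSchmidt FinSl3) := ⟨isKrullSchmidt⟩

instance (i : IndecClass FinSl3) : LieModule.IsIrreducible ℂ Sl3 i.rep :=
  isIrreducible_of_indecomposable i.indecomposable_rep

theorem eq_of_rep_hom_ne_zero {i j : IndecClass FinSl3} {f : i.rep ⟶ j.rep} (hf : f ≠ 0) :
    i = j := by
  have := isIso_of_ne_zero hf
  exact IndecClass.eq_of_iso (asIso f)

theorem exists_iso_rep (V : FinSl3) [LieModule.IsIrreducible ℂ Sl3 V] :
    ∃ i : IndecClass FinSl3, Nonempty (V ≅ i.rep) := by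
  have := isLocalRing_end_of_isIrreducible V
  exact IndecClass.exists_iso (indecomposable_of_isLocalRing_end V)

/-- By semisimplicity the morphism is nonzero on some simple summand, which Schur's lemma identifies
with the target. -/
theorem indecMult_ne_zero_of_hom_to {V : FinSl3} {i : IndecClass FinSl3} {f : V ⟶ i.rep}
    (hf : f ≠ 0) : indecMult V i ≠ 0 := by
  revert hf
  induction V using krullSchmidt_induction with
  | iso X Y e h =>
    rw [← indecMult_congr e]
    intro hf
    refine h (f := e.hom ≫ f) fun h0 => hf ?_
    rwa [← cancel_epi e.hom, comp_zero]
  | zero X h => exact fun hf => absurd (h.eq_of_src f 0) hf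
  | add j Y h =>
    intro hf
    rw [indecMult_biprod, indecMult_rep, Finsupp.add_apply]
    by_cases h1 : biprod.inl ≫ f = 0
    · have h2 : biprod.inr ≫ f ≠ 0 := fun h2 => hf (by ext <;> simp [h1, h2])
      have := h h2
      omega
    · rw [eq_of_rep_hom_ne_zero h1, Finsupp.single_eq_same]
      omega

theorem indecMult_ne_zero_of_hom_from {V : FinSl3} {i : IndecClass FinSl3} {f : i.rep ⟶ V}
    (hf : f ≠ 0) : indecMult V i ≠ 0 := by
  revert hf
  induction V using krullSchmidt_induction with
  | iso X Y e h =>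
    rw [← indecMult_congr e]
    intro hf
    refine h (f := f ≫ e.inv) fun h0 => hf ?_
    rwa [← cancel_mono e.inv, zero_comp]
  | zero X h => exact fun hf => absurd (h.eq_of_tgt f 0) hf
  | add j Y h =>
    intro hf
    rw [indecMult_biprod, indecMult_rep, Finsupp.add_apply]
    by_cases h1 : f ≫ biprod.fst = 0
    · have h2 : f ≫ biprod.snd ≠ 0 := fun h2 => hf (by ext <;> simp [h1, h2])
      have := h h2
      omega
    · rw [← eq_of_rep_hom_ne_zero h1, Finsupp.single_eq_same]
      omega

/-! ### The class of the unit object -/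

/-- The class of the trivial module. -/
def trivClass : IndecClass FinSl3 := (exists_iso_rep triv).choose

/-- The trivial module is the unit object. -/
def trivIso : 𝟙_ FinSl3 ≅ trivClass.rep := (exists_iso_rep triv).choose_spec.some

theorem finrank_invariants_le_one (k i : IndecClass FinSl3) :
    Module.finrank ℂ (trivClass.rep ⟶ k.rep ⊗ i.rep) ≤ 1 := by
  have h1 : Module.finrank ℂ (trivClass.rep ⟶ k.rep ⊗ i.rep) =
      Module.finrank ℂ ((triv : FinSl3) ⟶ tensor k.rep i.rep) :=
    (Linear.homCongr ℂ trivIso.symm (Iso.refl _)).finrank_eq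
  rw [h1]
  exact (LinearMap.finrank_le_finrank_of_injective (homOfInvariant_injective k.rep i.rep)).trans
    finrank_hom_le_one

theorem exists_dual_hom_ne_zero {k i : IndecClass FinSl3}
    (h : indecMult (k.rep ⊗ i.rep) trivClass ≠ 0) : ∃ f : k.rep.dual ⟶ i.rep, f ≠ 0 := by
  obtain ⟨a, b, hab⟩ := exists_retract_of_indecMult_ne_zero h
  refine ⟨homOfInvariant k.rep i.rep (trivIso.hom ≫ a), fun h0 => ?_⟩
  have h1 : trivIso.hom ≫ a = 0 :=
    homOfInvariant_injective k.rep i.rep (h0.trans (map_zero _).symm)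
  have h2 : a = 0 := by rwa [← cancel_epi trivIso.hom, comp_zero]
  rw [h2, zero_comp] at hab
  exact trivClass.indecomposable_rep.1 ((IsZero.iff_id_eq_zero _).2 hab.symm)

/-- A simple module has at most one dual. -/
theorem eq_of_indecMult_tensor_ne_zero {k i j : IndecClass FinSl3}
    (hi : indecMult (k.rep ⊗ i.rep) trivClass ≠ 0) (hj : indecMult (k.rep ⊗ j.rep) trivClass ≠ 0) :
    i = j := by
  obtain ⟨f, hf⟩ := exists_dual_hom_ne_zero hi
  obtain ⟨g, hg⟩ := exists_dual_hom_ne_zero hj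
  have := isIso_of_ne_zero hf
  have := isIso_of_ne_zero hg
  exact IndecClass.eq_of_iso ((asIso f).symm ≪≫ asIso g)

/-- The class k is that of the dual, and the evaluation pairing is a nonzero map onto the trivial
module. -/
theorem exists_indecMult_tensor_ne_zero (i : IndecClass FinSl3) :
    ∃ k : IndecClass FinSl3, indecMult (k.rep ⊗ i.rep) trivClass ≠ 0 := by
  obtain ⟨k, ⟨e⟩⟩ := exists_iso_rep i.rep.dual
  have : Nontrivial i.rep := LieModule.nontrivial_of_isIrreducible ℂ Sl3 i.rep
  have e' : tensor i.rep.dual i.rep ≅ k.rep ⊗ i.rep := whiskerRightIso e i.rep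
  refine ⟨k, ?_⟩
  rw [← indecMult_congr e']
  refine indecMult_ne_zero_of_hom_to (f := evalHom i.rep ≫ trivIso.hom) fun h => ?_
  refine evalHom_ne_zero i.rep ?_
  rw [← cancel_mono trivIso.hom, zero_comp]
  exact h

/-! ### Tensor powers of the natural module -/

/-- Tensor powers of the natural module. -/
def tensorPow : ℕ → FinSl3
  | 0 => 𝟙_ FinSl3
  | n + 1 => natF ⊗ tensorPow n

theorem lie_tmul {V W : FinSl3} (x : Sl3) (v : V) (w : W) :
    ⁅x, tmul v w⁆ = tmul ⁅x, v⁆ w + tmul v ⁅x, w⁆ :=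
  TensorProduct.LieModule.lie_tmul_right x v w

/-- The standard basis of the natural module. -/
def stdVec (k : Fin 3) : natF := (Pi.single k 1 : Fin 3 → ℂ)

theorem lie_stdVec (i j k : Fin 3) : ⁅tracelessUnit i j, stdVec k⁆ =
    (if j = k then stdVec i else 0) - (if i = j then (1 / 3 : ℂ) else 0) • stdVec k := by
  have h : ⁅tracelessUnit i j, stdVec k⁆ =
    ((tracelessUnit i j).1.mulVec (Pi.single k 1) : Fin 3 → ℂ) := rfl
  rw [h, tracelessUnit_val, Matrix.sub_mulVec, Matrix.smul_mulVec, Matrix.one_mulVec]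
  congr 1
  by_cases hjk : j = k
  · subst hjk
    rw [if_pos rfl]
    change _ = (Pi.single i 1 : Fin 3 → ℂ)
    ext l
    simp [Matrix.single_apply, Pi.single_apply, eq_comm]
  · rw [if_neg hjk]
    change _ = (0 : Fin 3 → ℂ)
    ext l
    simp [hjk]

theorem tmul_zero {V W : FinSl3} (v : V) : tmul v (0 : W) = 0 := TensorProduct.tmul_zero _ _
theorem zero_tmul {V W : FinSl3} (w : W) : tmul (0 : V) w = 0 := TensorProduct.zero_tmul _ _
theorem smul_tmul' {V W : FinSl3} (c : ℂ) (v : V) (w : W) : tmul (c • v) w = c • tmul v w := rfl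
theorem tmul_smul {V W : FinSl3} (c : ℂ) (v : V) (w : W) : tmul v (c • w) = c • tmul v w :=
  TensorProduct.tmul_smul c v w
theorem tmul_add {V W : FinSl3} (v : V) (w u : W) : tmul v (w + u) = tmul v w + tmul v u :=
  TensorProduct.tmul_add v w u

/-- The coordinate functionals of the natural module. -/
def stdCoord (k : Fin 3) : natF →ₗ[ℂ] ℂ := (LinearMap.proj k : (Fin 3 → ℂ) →ₗ[ℂ] ℂ)

theorem stdCoord_stdVec (k l : Fin 3) : stdCoord k (stdVec l) = if k = l then 1 else 0 :=
  Pi.single_apply l (1 : ℂ) k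

theorem tmul_stdVec_ne_zero {W : FinSl3} (k : Fin 3) {w : W} (hw : w ≠ 0) :
    tmul (stdVec k) w ≠ 0 := by
  intro h
  have h1 := contract_tmul (V := natF) (S := W) (stdCoord k) (stdVec k) w
  have h2 : (stdVec k ⊗ₜ[ℂ] w : TensorProduct ℂ natF W) = 0 := h
  rw [h2, map_zero, stdCoord_stdVec, if_pos rfl, one_smul] at h1
  exact hw h1.symm

theorem isPrimitive_tmul_stdVec {W : FinSl3} {w : W} {a b : ℂ} (hw : IsPrimitive w a b) :
    IsPrimitive (tmul (stdVec 0) w) (a + 1) b where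
  ne_zero := tmul_stdVec_ne_zero 0 hw.ne_zero
  lie_e₁ := by
    rw [lie_tmul, hw.lie_e₁, lie_stdVec]
    simp [tmul_zero, zero_tmul]
  lie_e₂ := by
    rw [lie_tmul, hw.lie_e₂, lie_stdVec]
    simp [tmul_zero, zero_tmul]
  lie_h₁ := by
    rw [lie_tmul, hw.lie_h₁, sub_lie, lie_stdVec, lie_stdVec]
    simp only [Fin.isValue, if_true, one_ne_zero, if_false, zero_sub, tmul_smul]
    rw [show stdVec 0 - (1 / 3 : ℂ) • stdVec 0 - -((1 / 3 : ℂ) • stdVec 0) = stdVec 0 by module]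
    module
  lie_h₂ := by
    rw [lie_tmul, hw.lie_h₂, sub_lie, lie_stdVec, lie_stdVec]
    simp [zero_tmul, tmul_smul]

/-- The antisymmetric tensor of the first two basis vectors has the second fundamental weight (0,
1). Hence powers of the natural module alone reach every dominant weight. -/
theorem isPrimitive_wedge {W : FinSl3} {w : W} {a b : ℂ} (hw : IsPrimitive w a b) :
    IsPrimitive (tmul (stdVec 0) (tmul (stdVec 1) w) - tmul (stdVec 1) (tmul (stdVec 0) w))
      a (b + 1) where
  ne_zero h := by
    have h1 := contract_tmul (V := natF) (S := natF ⊗ W) (stdCoord 0) (stdVec 0) (tmul (stdVec 1) w)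
    have h2 := contract_tmul (V := natF) (S := natF ⊗ W) (stdCoord 0) (stdVec 1) (tmul (stdVec 0) w)
    rw [stdCoord_stdVec, if_pos rfl, one_smul] at h1
    rw [stdCoord_stdVec, if_neg (by decide), zero_smul] at h2
    have h5 : (stdVec 0 ⊗ₜ[ℂ] tmul (stdVec 1) w : TensorProduct ℂ natF (natF ⊗ W : FinSl3)) =
      stdVec 1 ⊗ₜ[ℂ] tmul (stdVec 0) w := sub_eq_zero.1 h
    rw [h5, h2] at h1
    exact tmul_stdVec_ne_zero 1 hw.ne_zero h1.symm
  lie_e₁ := by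
    simp only [lie_sub, lie_tmul, hw.lie_e₁, lie_stdVec]
    simp [tmul_zero, zero_tmul]
  lie_e₂ := by
    simp only [lie_sub, lie_tmul, hw.lie_e₂, lie_stdVec]
    simp [tmul_zero, zero_tmul]
  lie_h₁ := by
    have h0 : ⁅tracelessUnit 0 0 - tracelessUnit 1 1, stdVec 0⁆ = (1 : ℂ) • stdVec 0 := by
      rw [sub_lie, lie_stdVec, lie_stdVec]
      simp only [Fin.isValue, if_true, one_ne_zero, if_false]
      module
    have h1 : ⁅tracelessUnit 0 0 - tracelessUnit 1 1, stdVec 1⁆ = (-1 : ℂ) • stdVec 1 := by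
      rw [sub_lie, lie_stdVec, lie_stdVec]
      simp only [Fin.isValue, if_true, zero_ne_one, if_false]
      module
    rw [lie_sub, lie_tmul, lie_tmul, lie_tmul, lie_tmul, h0, h1, hw.lie_h₁]
    simp only [tmul_add, tmul_smul, smul_tmul']
    module
  lie_h₂ := by
    have h0 : ⁅tracelessUnit 1 1 - tracelessUnit 2 2, stdVec 0⁆ = (0 : ℂ) • stdVec 0 := by
      rw [sub_lie, lie_stdVec, lie_stdVec]
      simp
    have h1 : ⁅tracelessUnit 1 1 - tracelessUnit 2 2, stdVec 1⁆ = (1 : ℂ) • stdVec 1 := by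
      rw [sub_lie, lie_stdVec, lie_stdVec]
      simp only [Fin.isValue, if_true, show (2 : Fin 3) ≠ 1 by decide, if_false]
      module
    rw [lie_sub, lie_tmul, lie_tmul, lie_tmul, lie_tmul, h0, h1, hw.lie_h₂]
    simp only [tmul_add, tmul_smul, smul_tmul']
    module

theorem isPrimitive_trivOne : IsPrimitive (trivOne : (triv : FinSl3)) 0 0 where
  ne_zero := one_ne_zero (α := ℂ)
  lie_e₁ := lie_trivOne _
  lie_e₂ := lie_trivOne _
  lie_h₁ := by rw [zero_smul, lie_trivOne]
  lie_h₂ := by rw [zero_smul, lie_trivOne]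

theorem exists_isPrimitive_tensorPow (a b : ℕ) :
    ∃ (n : ℕ) (w : tensorPow n), IsPrimitive w (a : ℂ) (b : ℂ) := by
  induction b with
  | zero =>
    induction a with
    | zero =>
      rw [Nat.cast_zero]
      exact ⟨0, trivOne, isPrimitive_trivOne⟩
    | succ a ih =>
      obtain ⟨n, w, hw⟩ := ih
      refine ⟨n + 1, tmul (stdVec 0) w, ?_⟩
      rw [Nat.cast_succ]
      exact isPrimitive_tmul_stdVec hw
  | succ b ih =>
    obtain ⟨n, w, hw⟩ := ih
    have h := isPrimitive_wedge hw
    rw [← Nat.cast_succ] at h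
    exact ⟨n + 2, _, h⟩

/-- Every simple module occurs in a tensor power of the natural module. -/
theorem exists_indecMult_tensorPow_ne_zero (i : IndecClass FinSl3) :
    ∃ n, indecMult (tensorPow n) i ≠ 0 := by
  have : Nontrivial i.rep := LieModule.nontrivial_of_isIrreducible ℂ Sl3 i.rep
  obtain ⟨v, a, b, hv⟩ := exists_isPrimitive i.rep
  obtain ⟨n, w, hw⟩ := exists_isPrimitive_tensorPow a b
  obtain ⟨φ, hφ⟩ := exists_injective_of_isPrimitive hv hw
  refine ⟨n, indecMult_ne_zero_of_hom_from (f := ofLie φ) fun h => hv.ne_zero (hφ ?_)⟩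
  rw [map_zero]
  exact congrArg (fun f => toLie f v) h

end FDLieMod

end

noncomputable section

attribute [local instance] hasBinaryBiproducts_of_finite_biproducts

/-! ### The action functors -/

section Action

open MonoidalLeftAction Category

variable {C : Type*} [Category* C] [MonoidalCategory C]
variable {M : Type*} [Category* M] [MonoidalLeftAction C M]

variable (M) in
/-- The functor `X ↦ c X`. -/
def actLeft (c : C) : M ⥤ M where
  obj X := c ⊙ₗ X
  map f := c ⊴ₗ f

variable (C) in
/-- The functor `c ↦ c X`. -/
def actRight (X : M) : C ⥤ M where
  obj c := c ⊙ₗ X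
  map f := f ⊵ₗ X

/-- The functor `c ↦ c X` is a module functor on the left regular module category. -/
instance actRightLeftLinear (X : M) : (actRight C X).LeftLinear C where
  μₗ c d := (αₗ c d X).inv
  δₗ c d := (αₗ c d X).hom
  μₗ_naturality_left f d := by
    change f ⊵ₗ (d ⊙ₗ X) ≫ _ = _ ≫ (f ▷ d) ⊵ₗ X
    simp
  μₗ_naturality_right c _ _ f := by
    change c ⊴ₗ (f ⊵ₗ X) ≫ _ = _ ≫ (c ◁ f) ⊵ₗ X
    simp
  μₗ_associativity c c' d := by
    change (αₗ (c ⊗ c') d X).inv ≫ (α_ c c' d).hom ⊵ₗ X =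
      (αₗ c c' (d ⊙ₗ X)).hom ≫ c ⊴ₗ (αₗ c' d X).inv ≫ (αₗ c (c' ⊗ d) X).inv
    rw [Iso.inv_comp_eq, ← assoc, ← assoc, Iso.eq_comp_inv, ← cancel_mono (c ⊴ₗ (αₗ c' d X).hom)]
    simp
  μₗ_unitality d := by
    change (λₗ (d ⊙ₗ X)).hom = (αₗ (𝟙_ C) d X).inv ≫ (λ_ d).hom ⊵ₗ X
    simp
  δₗ_naturality_left f d := by
    change (f ▷ d) ⊵ₗ X ≫ _ = _ ≫ f ⊵ₗ (d ⊙ₗ X)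
    simp
  δₗ_naturality_right c _ _ f := by
    change (c ◁ f) ⊵ₗ X ≫ _ = _ ≫ c ⊴ₗ (f ⊵ₗ X)
    simp
  δₗ_associativity c c' d := (associator_actionHom c c' d X).symm
  δₗ_unitality_inv d := by
    change (λₗ (d ⊙ₗ X)).inv = (λ_ d).inv ⊵ₗ X ≫ (αₗ (𝟙_ C) d X).hom
    rw [← cancel_mono (λₗ (d ⊙ₗ X)).hom, assoc, ← leftUnitor_actionHom]
    simp only [Iso.inv_hom_id]
    exact (inv_hom_actionHomLeft (λ_ d) X).symm
  μₗ_comp_δₗ c d := (αₗ c d X).inv_hom_id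
  δₗ_comp_μₗ c d := (αₗ c d X).hom_inv_id

variable [Preadditive C] [Linear ℂ C] [Preadditive M] [Linear ℂ M] [IsBilinearAction C M]

instance (c : C) : (actLeft M c).Additive where
  map_add := IsBilinearAction.actionHomRight_add c _ _

instance (c : C) : (actLeft M c).Linear ℂ where
  map_smul f r := IsBilinearAction.actionHomRight_smul c r f

instance (X : M) : (actRight C X).Additive where
  map_add := IsBilinearAction.add_actionHomLeft _ _ X

instance (X : M) : (actRight C X).Linear ℂ where
  map_smul f r := IsBilinearAction.smul_actionHomLeft r f X

end Action

namespace FDLieMod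

instance {L : Type} [LieRing L] [LieAlgebra ℂ L] : IsBilinearAction (FDLieMod L) (FDLieMod L) where
  actionHomRight_add _ {_ _} _ _ := tensor_hom_ext fun _ _ => TensorProduct.tmul_add _ _ _
  actionHomRight_smul _ {_ _} _ _ := tensor_hom_ext fun _ _ => TensorProduct.tmul_smul _ _ _
  add_actionHomLeft {_ _} _ _ _ := tensor_hom_ext fun _ _ => TensorProduct.add_tmul _ _ _
  smul_actionHomLeft {_ _} _ _ _ := tensor_hom_ext fun _ _ => rfl

end FDLieMod
end

noncomputable section

attribute [local instance] hasBinaryBiproducts_of_finite_biproducts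

/-! ### Multiplicities in a module category with the regular graph -/

theorem exists_eq_single_of_degree_eq_one {α : Type*} {f : α →₀ ℕ} (h : f.degree = 1) :
    ∃ a, f = Finsupp.single a 1 := by
  have hf : f ≠ 0 := fun h0 => by simp [h0] at h
  obtain ⟨a, ha⟩ := Finsupp.ne_iff.1 hf
  rw [Finsupp.zero_apply] at ha
  have h1 := congrArg Finsupp.degree (Finsupp.single_add_erase a f)
  rw [map_add, Finsupp.degree_single, h] at h1
  have h2 : f.erase a = 0 := (Finsupp.degree_eq_zero_iff _).1 (by omega)
  refine ⟨a, ?_⟩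
  rw [← Finsupp.single_add_erase a f, h2, add_zero]
  congr 1
  rw [h2, map_zero] at h1
  omega

/-- An additive functor whose values on indecomposable objects are indecomposable. -/
theorem indecMult_functor_of_single {C M : Type*} [Category* C] [Preadditive C]
    [HasFiniteBiproducts C] [Linear ℂ C] [Fact (IsKrullSchmidt C)]
    [∀ X Y : C, Module.Finite ℂ (X ⟶ Y)] [Category* M] [Preadditive M] [HasFiniteBiproducts M]
    [Linear ℂ M] [Fact (IsKrullSchmidt M)] [∀ X Y : M, Module.Finite ℂ (X ⟶ Y)]
    (Φ : C ⥤ M) [Φ.Additive] {π : IndecClass C → IndecClass M}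
    (hπ : ∀ i, indecMult (Φ.obj i.rep) = Finsupp.single (π i) 1) (V : C) :
    indecMult (Φ.obj V) = (indecMult V).mapDomain π := by
  rw [indecMult_functor, Finsupp.mapDomain]
  refine Finsupp.sum_congr fun i _ => ?_
  rw [hπ, Finsupp.smul_single, smul_eq_mul, mul_one]

namespace FDLieMod

open MonoidalLeftAction

variable {M : Type*} [Category* M] [Preadditive M] [Linear ℂ M] [HasFiniteBiproducts M]
  [MonoidalLeftAction FinSl3 M] [IsBilinearAction FinSl3 M]

omit [HasFiniteBiproducts M] in
/-- No simple module annihilates a non-zero object. -/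
theorem not_isZero_rep_actionObj {X : M} (hX : ¬ IsZero X) (i : IndecClass FinSl3) :
    ¬ IsZero (i.rep ⊙ₗ X : M) := by
  intro h
  obtain ⟨k, hk⟩ := exists_indecMult_tensor_ne_zero i
  obtain ⟨a, b, hab⟩ := exists_retract_of_indecMult_ne_zero hk
  have h1 : IsZero ((k.rep ⊗ i.rep) ⊙ₗ X : M) :=
    ((actLeft M k.rep).map_isZero h).of_iso (αₗ k.rep i.rep X)
  -- The identity of the trivial module factors through k ⊗ i, which acts on X by zero.
  have h2 : IsZero (trivClass.rep ⊙ₗ X : M) := by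
    rw [IsZero.iff_id_eq_zero, ← id_actionHomLeft, ← hab, comp_actionHomLeft,
      h1.eq_of_tgt (a ⊵ₗ X) 0, zero_comp]
  exact hX (h2.of_iso ((λₗ[FinSl3] X).symm ≪≫ (actRight FinSl3 X).mapIso trivIso))

variable [Fact (IsKrullSchmidt M)] [∀ X Y : M, Module.Finite ℂ (X ⟶ Y)]

/-- Induction on n: by additivity, one more action of F is computed summand by summand, where the
graph prescribes it. -/
theorem indecMult_tensorPow_actionObj (σ : IndecClass FinSl3 → IndecClass M)
    (hσ : ∀ a, indecMult (natF ⊙ₗ (σ a).rep : M) = (indecMult (natF ⊗ a.rep)).mapDomain σ)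
    (n : ℕ) : indecMult (tensorPow n ⊙ₗ (σ trivClass).rep : M) =
      (indecMult (tensorPow n)).mapDomain σ := by
  induction n with
  | zero =>
    have h : indecMult (tensorPow 0) = Finsupp.single trivClass 1 := by
      rw [← indecMult_rep]
      exact indecMult_congr trivIso
    rw [h, Finsupp.mapDomain_single, ← indecMult_rep]
    exact indecMult_congr (λₗ[FinSl3] (σ trivClass).rep)
  | succ n ih =>
    have h1 := indecMult_functor (actLeft M natF) (tensorPow n ⊙ₗ (σ trivClass).rep)
    have h2 := indecMult_functor (actLeft FinSl3 natF) (tensorPow n)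
    refine (indecMult_congr (αₗ natF (tensorPow n) (σ trivClass).rep)).trans (h1.trans ?_)
    refine Eq.trans ?_ (congrArg (Finsupp.mapDomain σ) h2.symm)
    rw [ih, Finsupp.sum_mapDomain_index (by simp) (fun _ _ _ => add_smul _ _ _), Finsupp.sum,
      Finsupp.sum, Finsupp.mapDomain_finsetSum]
    refine Finset.sum_congr rfl fun a _ => ?_
    rw [Finsupp.mapDomain_smul]
    exact congrArg _ (hσ a)

/-- In a module category with the regular graph, simple modules send the object corresponding
to the trivial module to indecomposable objects. -/
theorem exists_indecMult_actionObj_eq_single (σ : IndecClass FinSl3 → IndecClass M)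
    (hσ : ∀ a, indecMult (natF ⊙ₗ (σ a).rep : M) = (indecMult (natF ⊗ a.rep)).mapDomain σ)
    (i : IndecClass FinSl3) :
    ∃ j, indecMult (i.rep ⊙ₗ (σ trivClass).rep : M) = Finsupp.single j 1 := by
  obtain ⟨n, hn⟩ := exists_indecMult_tensorPow_ne_zero i
  have h1 := indecMult_functor (actRight FinSl3 (σ trivClass).rep) (tensorPow n)
  have h2 := congrArg Finsupp.degree (h1.symm.trans (indecMult_tensorPow_actionObj σ hσ n))
  have hpos (k : IndecClass FinSl3) :
      1 ≤ (indecMult (k.rep ⊙ₗ (σ trivClass).rep : M)).degree := by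
    rw [Nat.one_le_iff_ne_zero, Ne, Finsupp.degree_eq_zero_iff]
    exact fun h => not_isZero_rep_actionObj (σ trivClass).indecomposable_rep.1 k
      (isZero_of_indecMult_eq_zero h)
  rw [Finsupp.degree_mapDomain, Finsupp.sum, map_sum, Finsupp.degree_apply] at h2
  simp only [map_nsmul, smul_eq_mul] at h2
  -- The total multiplicity of the power equals the sum of multiplicities weighted by the number of
  -- summands of k X. All weights are at least 1, so the terms agree one by one.
  have h3 := (Finset.sum_eq_sum_iff_of_le fun k _ =>
    Nat.le_mul_of_pos_right (indecMult (tensorPow n) k) (hpos k)).1 h2.symm i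
      (Finsupp.mem_support_iff.2 hn)
  have h4 : (indecMult (i.rep ⊙ₗ (σ trivClass).rep : M)).degree = 1 :=
    (Nat.eq_of_mul_eq_mul_left (Nat.pos_of_ne_zero hn) (by rw [mul_one]; exact h3)).symm
  exact exists_eq_single_of_degree_eq_one h4

-- Both `π` and `σ` push the multiplicities of a tensor power to those of its action on the same
-- object. Natural number coefficients cannot cancel, so supports are images.
open scoped Classical in
theorem support_mapDomain_eq {σ : IndecClass FinSl3 → IndecClass M}
    (hσ : ∀ a, indecMult (natF ⊙ₗ (σ a).rep : M) = (indecMult (natF ⊗ a.rep)).mapDomain σ)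
    {π : IndecClass FinSl3 → IndecClass M}
    (hπ : ∀ i, indecMult (i.rep ⊙ₗ (σ trivClass).rep : M) = Finsupp.single (π i) 1) (n : ℕ) :
    (indecMult (tensorPow n)).support.image π = (indecMult (tensorPow n)).support.image σ := by
  rw [← Finsupp.mapDomain_support_of_subsingletonAddUnits,
    ← Finsupp.mapDomain_support_of_subsingletonAddUnits, ← indecMult_tensorPow_actionObj σ hσ n]
  exact congrArg Finsupp.support
    (indecMult_functor_of_single (actRight FinSl3 (σ trivClass).rep) hπ (tensorPow n)).symm

theorem surjective_of_indecMult_actionObj {σ : IndecClass FinSl3 → IndecClass M}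
    (hs : Function.Surjective σ)
    (hσ : ∀ a, indecMult (natF ⊙ₗ (σ a).rep : M) = (indecMult (natF ⊗ a.rep)).mapDomain σ)
    {π : IndecClass FinSl3 → IndecClass M}
    (hπ : ∀ i, indecMult (i.rep ⊙ₗ (σ trivClass).rep : M) = Finsupp.single (π i) 1) :
    Function.Surjective π := by
  classical
  intro j
  obtain ⟨a, rfl⟩ := hs j
  obtain ⟨n, hn⟩ := exists_indecMult_tensorPow_ne_zero a
  have h : σ a ∈ (indecMult (tensorPow n)).support.image π := by
    rw [support_mapDomain_eq hσ hπ]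
    exact Finset.mem_image_of_mem _ (Finsupp.mem_support_iff.2 hn)
  obtain ⟨i, -, hi⟩ := Finset.mem_image.1 h
  exact ⟨i, hi⟩

/-- On the support of one tensor power injectivity is a cardinality count, but i and j need not lie
in a common power. Tensoring with the dual of j moves the question to the trivial class. -/
theorem injective_of_indecMult_actionObj {σ : IndecClass FinSl3 → IndecClass M}
    (hs : Function.Injective σ)
    (hσ : ∀ a, indecMult (natF ⊙ₗ (σ a).rep : M) = (indecMult (natF ⊗ a.rep)).mapDomain σ)
    {π : IndecClass FinSl3 → IndecClass M}
    (hπ : ∀ i, indecMult (i.rep ⊙ₗ (σ trivClass).rep : M) = Finsupp.single (π i) 1) :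
    Function.Injective π := by
  classical
  have htriv : π trivClass = σ trivClass := by
    have h := (indecMult_congr ((λₗ[FinSl3] (σ trivClass).rep).symm ≪≫
      (actRight FinSl3 (σ trivClass).rep).mapIso trivIso)).trans (hπ trivClass)
    rw [indecMult_rep] at h
    exact (Finsupp.single_left_injective one_ne_zero h).symm
  have hinj (n : ℕ) : Set.InjOn π (indecMult (tensorPow n)).support := by
    rw [← Finset.card_image_iff, support_mapDomain_eq hσ hπ, Finset.card_image_of_injective _ hs]
  have himage (k i : IndecClass FinSl3) :
      (indecMult (k.rep ⊗ i.rep : FinSl3)).mapDomain π = indecMult (k.rep ⊙ₗ (π i).rep : M) := by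
    obtain ⟨e⟩ := nonempty_iso_of_indecMult (hπ i)
    rw [← indecMult_functor_of_single (actRight FinSl3 (σ trivClass).rep) hπ]
    exact indecMult_congr (αₗ k.rep i.rep (σ trivClass).rep ≪≫ (actLeft M k.rep).mapIso e)
  intro i j hij
  obtain ⟨k, hk⟩ := exists_indecMult_tensor_ne_zero j
  -- Since π i = π j, the products k ⊗ i and k ⊗ j have the same image under `π`, and the latter
  -- contains the trivial class.
  have h : π trivClass ∈ (indecMult (k.rep ⊗ i.rep : FinSl3)).support.image π := by
    rw [← Finsupp.mapDomain_support_of_subsingletonAddUnits, himage, hij, ← himage,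
      Finsupp.mapDomain_support_of_subsingletonAddUnits]
    exact Finset.mem_image_of_mem _ (Finsupp.mem_support_iff.2 hk)
  obtain ⟨l, hl, hlo⟩ := Finset.mem_image.1 h
  obtain ⟨n, hn⟩ := exists_indecMult_tensorPow_ne_zero l
  -- Any power containing l also contains the trivial class, because π l = σ trivClass and `σ` is
  -- injective. So l and the trivial class can be compared within one power.
  have hl' : σ trivClass ∈ (indecMult (tensorPow n)).support.image σ := by
    rw [← support_mapDomain_eq hσ hπ, ← htriv, ← hlo]
    exact Finset.mem_image_of_mem _ (Finsupp.mem_support_iff.2 hn)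
  obtain ⟨o, ho, hoσ⟩ := Finset.mem_image.1 hl'
  rw [hs hoσ] at ho
  rw [hinj n (Finsupp.mem_support_iff.2 hn) ho hlo] at hl
  exact eq_of_indecMult_tensor_ne_zero (Finsupp.mem_support_iff.1 hl) hk

end FDLieMod
end

noncomputable section

attribute [local instance] hasBinaryBiproducts_of_finite_biproducts

/-! ### Functors between Krull–Schmidt categories -/

section KrullSchmidtFunctor

variable {C M : Type*} [Category* C] [Preadditive C] [HasFiniteBiproducts C]
  [Fact (IsKrullSchmidt C)] [Category* M] [Preadditive M] (Φ : C ⥤ M) [Φ.Additive]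

omit [Fact (IsKrullSchmidt C)] in
theorem map_fst_inl_add_map_snd_inr (A B : C) :
    Φ.map (biprod.fst : A ⊞ B ⟶ A) ≫ Φ.map biprod.inl +
      Φ.map (biprod.snd : A ⊞ B ⟶ B) ≫ Φ.map biprod.inr = 𝟙 (Φ.obj (A ⊞ B)) := by
  rw [← Φ.map_comp, ← Φ.map_comp, ← Φ.map_add, biprod.total, Φ.map_id]

theorem map_bijective_of_rep_left {W : C}
    (h : ∀ i : IndecClass C, Function.Bijective (Φ.map : (i.rep ⟶ W) → (Φ.obj i.rep ⟶ Φ.obj W)))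
    (V : C) : Function.Bijective (Φ.map : (V ⟶ W) → (Φ.obj V ⟶ Φ.obj W)) := by
  induction V using krullSchmidt_induction with
  | iso X Y e hX =>
    refine ⟨fun f g hfg => ?_, fun r => ?_⟩
    · rw [← cancel_epi e.hom]
      exact hX.1 (by rw [Φ.map_comp, Φ.map_comp, hfg])
    · obtain ⟨f, hf⟩ := hX.2 (Φ.map e.hom ≫ r)
      exact ⟨e.inv ≫ f, by rw [Φ.map_comp, hf, ← Category.assoc, ← Φ.map_comp, e.inv_hom_id,
        Φ.map_id, Category.id_comp]⟩
  | zero X hX =>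
    exact ⟨fun f g _ => hX.eq_of_src f g, fun r => ⟨0, (Φ.map_isZero hX).eq_of_src _ r⟩⟩
  | add i Y hY =>
    refine ⟨fun f g hfg => biprod.hom_ext' _ _ ((h i).1 ?_) (hY.1 ?_), fun r => ?_⟩
    · rw [Φ.map_comp, Φ.map_comp, hfg]
    · rw [Φ.map_comp, Φ.map_comp, hfg]
    · obtain ⟨u, hu⟩ := (h i).2 (Φ.map biprod.inl ≫ r)
      obtain ⟨v, hv⟩ := hY.2 (Φ.map biprod.inr ≫ r)
      refine ⟨biprod.fst ≫ u + biprod.snd ≫ v, ?_⟩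
      rw [Φ.map_add, Φ.map_comp, Φ.map_comp, hu, hv, ← Category.assoc, ← Category.assoc,
        ← Preadditive.add_comp, map_fst_inl_add_map_snd_inr, Category.id_comp]

theorem map_bijective_of_rep_right {V : C}
    (h : ∀ i : IndecClass C, Function.Bijective (Φ.map : (V ⟶ i.rep) → (Φ.obj V ⟶ Φ.obj i.rep)))
    (W : C) : Function.Bijective (Φ.map : (V ⟶ W) → (Φ.obj V ⟶ Φ.obj W)) := by
  induction W using krullSchmidt_induction with
  | iso X Y e hX =>
    refine ⟨fun f g hfg => ?_, fun r => ?_⟩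
    · rw [← cancel_mono e.inv]
      exact hX.1 (by rw [Φ.map_comp, Φ.map_comp, hfg])
    · obtain ⟨f, hf⟩ := hX.2 (r ≫ Φ.map e.inv)
      exact ⟨f ≫ e.hom, by rw [Φ.map_comp, hf, Category.assoc, ← Φ.map_comp, e.inv_hom_id,
        Φ.map_id, Category.comp_id]⟩
  | zero X hX =>
    exact ⟨fun f g _ => hX.eq_of_tgt f g, fun r => ⟨0, (Φ.map_isZero hX).eq_of_tgt _ r⟩⟩
  | add i Y hY =>
    refine ⟨fun f g hfg => biprod.hom_ext _ _ ((h i).1 ?_) (hY.1 ?_), fun r => ?_⟩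
    · rw [Φ.map_comp, Φ.map_comp, hfg]
    · rw [Φ.map_comp, Φ.map_comp, hfg]
    · obtain ⟨u, hu⟩ := (h i).2 (r ≫ Φ.map biprod.fst)
      obtain ⟨v, hv⟩ := hY.2 (r ≫ Φ.map biprod.snd)
      refine ⟨u ≫ biprod.inl + v ≫ biprod.inr, ?_⟩
      rw [Φ.map_add, Φ.map_comp, Φ.map_comp, hu, hv, Category.assoc, Category.assoc,
        ← Preadditive.comp_add, map_fst_inl_add_map_snd_inr, Category.comp_id]

attribute [local instance] preservesBinaryBiproducts_of_preservesBiproducts in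
omit [Fact (IsKrullSchmidt C)] in
theorem essSurj_of_rep [HasFiniteBiproducts M] [Fact (IsKrullSchmidt M)]
    (h : ∀ j : IndecClass M, ∃ V : C, Nonempty (Φ.obj V ≅ j.rep)) : Φ.EssSurj where
  mem_essImage Y := by
    induction Y using krullSchmidt_induction with
    | iso X Y e hX => exact Functor.essImage.ofIso e hX
    | zero X hX =>
      exact ⟨⨁ (Fin.elim0 : Fin 0 → C),
        ⟨(Φ.map_isZero (isZero_biproduct_fin_zero Fin.elim0)).iso hX⟩⟩
    | add j Y hY =>
      obtain ⟨V, ⟨e⟩⟩ := h j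
      obtain ⟨W, ⟨f⟩⟩ := hY
      exact ⟨V ⊞ W, ⟨Φ.mapBiprod V W ≪≫ biprod.mapIso e f⟩⟩

/-- An additive functor that is fully faithful on indecomposable objects and reaches all of
them is an equivalence. -/
theorem isEquivalence_of_rep [HasFiniteBiproducts M] [Fact (IsKrullSchmidt M)]
    (h : ∀ i j : IndecClass C,
      Function.Bijective (Φ.map : (i.rep ⟶ j.rep) → (Φ.obj i.rep ⟶ Φ.obj j.rep)))
    (hs : ∀ j : IndecClass M, ∃ V : C, Nonempty (Φ.obj V ≅ j.rep)) : Φ.IsEquivalence := by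
  have hb (V W : C) : Function.Bijective (Φ.map : (V ⟶ W) → (Φ.obj V ⟶ Φ.obj W)) :=
    map_bijective_of_rep_left Φ (fun i => map_bijective_of_rep_right Φ (h i) W) V
  exact
    { faithful := ⟨fun {V W} _ _ hfg => (hb V W).1 hfg⟩
      full := ⟨fun {V W} r => (hb V W).2 r⟩
      essSurj := essSurj_of_rep Φ hs }

end KrullSchmidtFunctor

/-! ### Ideals generated by a morphism -/

section GeneratedIdeal

open MonoidalLeftAction

variable {C : Type*} [Category* C] [MonoidalCategory C]
variable {M : Type*} [Category* M] [Preadditive M] [Linear ℂ M] [MonoidalLeftAction C M]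

variable (C) in
/-- The stable ideal generated by a morphism. -/
def CatIdeal.generated {X Y : M} (r : X ⟶ Y) : CatIdeal M where
  homs A B := Submodule.span ℂ {f | ∃ (c : C) (a : A ⟶ c ⊙ₗ X) (b : c ⊙ₗ Y ⟶ B),
    f = a ≫ c ⊴ₗ r ≫ b}
  precomp_mem {A B D} g {f} hf := by
    refine Submodule.span_le (p := (Submodule.span ℂ _).comap (Linear.leftComp ℂ D g)).2 ?_ hf
    rintro _ ⟨c, a, b, rfl⟩
    exact Submodule.subset_span ⟨c, g ≫ a, b, by simp⟩
  postcomp_mem {A B D} f hf g := by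
    refine Submodule.span_le (p := (Submodule.span ℂ _).comap (Linear.rightComp ℂ A g)).2 ?_ hf
    rintro _ ⟨c, a, b, rfl⟩
    exact Submodule.subset_span ⟨c, a, b ≫ g, by simp⟩

theorem CatIdeal.mem_generated {X Y : M} (r : X ⟶ Y) :
    r ∈ (CatIdeal.generated C r).homs X Y :=
  Submodule.subset_span ⟨𝟙_ C, (λₗ[C] X).inv, (λₗ[C] Y).hom, by simp⟩

variable [Preadditive C] [Linear ℂ C] [IsBilinearAction C M]

theorem CatIdeal.isStable_generated {X Y : M} (r : X ⟶ Y) :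
    (CatIdeal.generated C r).IsStable C := by
  intro d A B f hf
  refine Submodule.span_le
    (p := (Submodule.span ℂ _).comap ((actLeft M d).mapLinearMap ℂ (X := A) (Y := B))).2 ?_ hf
  rintro _ ⟨c, a, b, rfl⟩
  refine Submodule.subset_span
    ⟨d ⊗ c, d ⊴ₗ a ≫ (αₗ d c X).inv, (αₗ d c Y).hom ≫ d ⊴ₗ b, ?_⟩
  change d ⊴ₗ (a ≫ c ⊴ₗ r ≫ b) = _
  simp

/-- In a simple module category, every object with local endomorphism ring is split off by the
action on any non-zero morphism. -/
theorem exists_isIso_of_isSimple (hM : IsSimpleModuleCategory C M) {X Y : M} {r : X ⟶ Y}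
    (hr : r ≠ 0) (Z : M) [IsLocalRing (End Z)] :
    ∃ (c : C) (a : Z ⟶ c ⊙ₗ X) (b : c ⊙ₗ Y ⟶ Z), IsIso (a ≫ c ⊴ₗ r ≫ b) := by
  rcases hM.eq_bot_or_eq_top _ (CatIdeal.isStable_generated (C := C) r) with h | h
  · have := CatIdeal.mem_generated (C := C) r
    rw [h, Submodule.mem_bot] at this
    exact (hr this).elim
  · by_contra! hn
    -- If no generator splits off Z, all generators are radical, and so is their span; but the ideal
    -- contains the identity.
    have h1 : (CatIdeal.generated C r).homs Z Z ≤ radHom Z Z := by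
      refine Submodule.span_le.2 ?_
      rintro _ ⟨c, a, b, rfl⟩ g
      rw [Category.assoc, Category.assoc]
      exact hn c a (b ≫ g)
    have h2 : 𝟙 Z ∈ radHom Z Z := h1 (h Z Z ▸ Submodule.mem_top)
    exact h2 (𝟙 Z) inferInstance

/-- The object of `C` in `exists_isIso_of_isSimple` may be taken to be indecomposable. -/
theorem exists_rep_isIso [HasFiniteBiproducts C] [Fact (IsKrullSchmidt C)] {X Y : M} {r : X ⟶ Y}
    {Z : M} [IsLocalRing (End Z)] (c : C) (a : Z ⟶ c ⊙ₗ X) (b : c ⊙ₗ Y ⟶ Z)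
    (h : IsIso (a ≫ c ⊴ₗ r ≫ b)) :
    ∃ (k : IndecClass C) (a : Z ⟶ k.rep ⊙ₗ X) (b : k.rep ⊙ₗ Y ⟶ Z),
      IsIso (a ≫ k.rep ⊴ₗ r ≫ b) := by
  induction c using krullSchmidt_induction with
  | iso V W e ih =>
    refine ih (a ≫ e.inv ⊵ₗ X) (e.hom ⊵ₗ Y ≫ b) ?_
    rwa [Category.assoc, action_exchange_assoc, inv_hom_actionHomLeft_assoc]
  | zero V hV =>
    have ha : a = 0 := ((actRight C X).map_isZero hV).eq_of_tgt a 0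
    rw [ha, zero_comp] at h
    exact (not_isIso_zero_end Z h).elim
  | add i V ih =>
    -- The action of a direct sum on r is block diagonal, so locality selects one of the two blocks.
    have key : (i.rep ⊞ V) ⊴ₗ r =
        (biprod.fst : i.rep ⊞ V ⟶ _) ⊵ₗ X ≫ i.rep ⊴ₗ r ≫ biprod.inl ⊵ₗ Y +
          (biprod.snd : i.rep ⊞ V ⟶ _) ⊵ₗ X ≫ V ⊴ₗ r ≫ biprod.inr ⊵ₗ Y := by
      rw [action_exchange, action_exchange, ← Category.assoc, ← Category.assoc,
        ← Preadditive.add_comp]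
      have := map_fst_inl_add_map_snd_inr (actRight C X) i.rep V
      exact ((congrArg (· ≫ (i.rep ⊞ V) ⊴ₗ r) this).trans (Category.id_comp _)).symm
    rw [key, Preadditive.add_comp, Preadditive.comp_add] at h
    rw [← Category.comp_id (_ + _)] at h
    rcases isIso_or_isIso_of_isIso_add h with h1 | h1
    · exact ⟨i, a ≫ biprod.fst ⊵ₗ X, biprod.inl ⊵ₗ Y ≫ b, by simpa using h1⟩
    · exact ih (a ≫ biprod.snd ⊵ₗ X) (biprod.inr ⊵ₗ Y ≫ b) (by simpa using h1)

end GeneratedIdeal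
end

noncomputable section

attribute [local instance] hasBinaryBiproducts_of_finite_biproducts

/-! ### Simple module categories with the regular graph -/

namespace FDLieMod

open MonoidalLeftAction

variable {M : Type*} [Category* M] [Preadditive M] [Linear ℂ M] [HasFiniteBiproducts M]
  [MonoidalLeftAction FinSl3 M] [IsBilinearAction FinSl3 M]
  [Fact (IsKrullSchmidt M)] [∀ X Y : M, Module.Finite ℂ (X ⟶ Y)]
  {X : M} {π : IndecClass FinSl3 → IndecClass M}

omit [IsBilinearAction FinSl3 M] in
theorem isLocalRing_end_rep_actionObj
    (hπ : ∀ i, indecMult (i.rep ⊙ₗ X : M) = Finsupp.single (π i) 1) (i : IndecClass FinSl3) :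
    IsLocalRing (End (i.rep ⊙ₗ X : M)) :=
  isLocalRing_end_of_iso (nonempty_iso_of_indecMult (hπ i)).some.symm

/-- Splittings in the module category are reflected: the multiplicities in (k ⊗ i) X are those of k
⊗ i pushed along the injective `π`. -/
theorem indecMult_tensor_ne_zero_of_isIso
    (hπ : ∀ i, indecMult (i.rep ⊙ₗ X : M) = Finsupp.single (π i) 1) (hinj : Function.Injective π)
    {o k i : IndecClass FinSl3} (a : o.rep ⊙ₗ X ⟶ k.rep ⊙ₗ i.rep ⊙ₗ X)
    (b : k.rep ⊙ₗ i.rep ⊙ₗ X ⟶ o.rep ⊙ₗ X) (h : IsIso (a ≫ b)) :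
    indecMult (k.rep ⊗ i.rep) o ≠ 0 := by
  obtain ⟨e⟩ := nonempty_iso_of_indecMult (hπ o)
  have h1 := indecMult_functor_of_single (actRight FinSl3 X) hπ (k.rep ⊗ i.rep)
  have h2 := (indecMult_congr (αₗ k.rep i.rep X)).symm.trans h1
  rw [← Finsupp.mapDomain_apply hinj, ← h2]
  refine indecMult_ne_zero_of_retract (e.inv ≫ a) (b ≫ e.hom) ?_
  have h3 : (e.inv ≫ a) ≫ b ≫ e.hom = e.inv ≫ (a ≫ b) ≫ e.hom := by simp
  rw [h3]
  infer_instance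

/-- The data split off by the action on a non-zero morphism between the objects `i X`. -/
theorem exists_isIso_rep_actionObj (hM : IsSimpleModuleCategory FinSl3 M)
    (hπ : ∀ i, indecMult (i.rep ⊙ₗ X : M) = Finsupp.single (π i) 1) (hinj : Function.Injective π)
    {i j : IndecClass FinSl3} {r : i.rep ⊙ₗ X ⟶ j.rep ⊙ₗ X} (hr : r ≠ 0) :
    ∃ (k : IndecClass FinSl3) (a : trivClass.rep ⊙ₗ X ⟶ k.rep ⊙ₗ i.rep ⊙ₗ X)
      (b : k.rep ⊙ₗ j.rep ⊙ₗ X ⟶ trivClass.rep ⊙ₗ X), IsIso (a ≫ k.rep ⊴ₗ r ≫ b) ∧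
      indecMult (k.rep ⊗ i.rep) trivClass ≠ 0 ∧ indecMult (k.rep ⊗ j.rep) trivClass ≠ 0 := by
  have := isLocalRing_end_rep_actionObj hπ trivClass
  obtain ⟨c, a, b, h⟩ := exists_isIso_of_isSimple hM hr (trivClass.rep ⊙ₗ X)
  obtain ⟨k, a, b, h⟩ := exists_rep_isIso c a b h
  refine ⟨k, a, b, h, indecMult_tensor_ne_zero_of_isIso hπ hinj a (k.rep ⊴ₗ r ≫ b) h,
    indecMult_tensor_ne_zero_of_isIso hπ hinj (a ≫ k.rep ⊴ₗ r) b ?_⟩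
  rwa [Category.assoc]

/-- The k that splits off the trivial object is dual to both i and j, and duals are unique. -/
theorem eq_of_actionObj_hom_ne_zero (hM : IsSimpleModuleCategory FinSl3 M)
    (hπ : ∀ i, indecMult (i.rep ⊙ₗ X : M) = Finsupp.single (π i) 1) (hinj : Function.Injective π)
    {i j : IndecClass FinSl3} {r : i.rep ⊙ₗ X ⟶ j.rep ⊙ₗ X} (hr : r ≠ 0) : i = j := by
  obtain ⟨k, -, -, -, hi, hj⟩ := exists_isIso_rep_actionObj hM hπ hinj hr
  exact eq_of_indecMult_tensor_ne_zero hi hj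

/-- A morphism vanishing on the `o`-isotypic component still does so after acting on `X`. -/
theorem comp_actionHomLeft_eq_zero (hM : IsSimpleModuleCategory FinSl3 M)
    (hπ : ∀ i, indecMult (i.rep ⊙ₗ X : M) = Finsupp.single (π i) 1) (hinj : Function.Injective π)
    {o : IndecClass FinSl3} {V W : FinSl3} (e : V ⟶ W) (he : ∀ a : o.rep ⟶ V, a ≫ e = 0)
    (h : o.rep ⊙ₗ X ⟶ V ⊙ₗ X) : h ≫ e ⊵ₗ X = 0 := by
  induction V using krullSchmidt_induction with
  | iso V V' f ih =>
    have h1 := ih (f.hom ≫ e) (fun a => by rw [← Category.assoc]; exact he _) (h ≫ f.inv ⊵ₗ X)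
    rwa [Category.assoc, ← comp_actionHomLeft, f.inv_hom_id_assoc] at h1
  | zero V hV =>
    have hh : h = 0 := ((actRight FinSl3 X).map_isZero hV).eq_of_tgt h 0
    rw [hh, zero_comp]
  | add i V ih =>
    have key : (biprod.fst : i.rep ⊞ V ⟶ _) ⊵ₗ X ≫ biprod.inl ⊵ₗ X +
        (biprod.snd : i.rep ⊞ V ⟶ _) ⊵ₗ X ≫ biprod.inr ⊵ₗ X = 𝟙 _ :=
      map_fst_inl_add_map_snd_inr (actRight FinSl3 X) i.rep V
    have h2 : (h ≫ (biprod.snd : i.rep ⊞ V ⟶ _) ⊵ₗ X) ≫ (biprod.inr ≫ e) ⊵ₗ X = 0 :=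
      ih (biprod.inr ≫ e) (fun a => by rw [← Category.assoc]; exact he _) _
    -- A nonzero component of h into the summand i X forces i = o, and on that summand e is zero by
    -- assumption.
    have h1 : (h ≫ (biprod.fst : i.rep ⊞ V ⟶ _) ⊵ₗ X) ≫ (biprod.inl ≫ e) ⊵ₗ X = 0 := by
      by_cases h0 : h ≫ (biprod.fst : i.rep ⊞ V ⟶ _) ⊵ₗ X = 0
      · rw [h0, zero_comp]
      · obtain rfl := eq_of_actionObj_hom_ne_zero hM hπ hinj h0
        have h3 : (0 : o.rep ⟶ W) ⊵ₗ X = 0 := (actRight FinSl3 X).map_zero _ _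
        rw [he, h3, comp_zero]
    rw [comp_actionHomLeft] at h1 h2
    calc h ≫ e ⊵ₗ X = h ≫ 𝟙 _ ≫ e ⊵ₗ X := by rw [Category.id_comp]
      _ = (h ≫ biprod.fst ⊵ₗ X) ≫ biprod.inl ⊵ₗ X ≫ e ⊵ₗ X +
          (h ≫ biprod.snd ⊵ₗ X) ≫ biprod.inr ⊵ₗ X ≫ e ⊵ₗ X := by
        rw [← key]
        simp only [Preadditive.add_comp, Preadditive.comp_add, Category.assoc]
      _ = 0 := by rw [h1, h2, add_zero]

/-- The trivial summand of `k ⊗ i` gives a splitting through which all morphisms from `X`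
factor. -/
theorem exists_splitting (hM : IsSimpleModuleCategory FinSl3 M)
    (hπ : ∀ i, indecMult (i.rep ⊙ₗ X : M) = Finsupp.single (π i) 1) (hinj : Function.Injective π)
    {k i : IndecClass FinSl3} (hk : indecMult (k.rep ⊗ i.rep) trivClass ≠ 0) :
    ∃ (s : trivClass.rep ⊙ₗ X ⟶ k.rep ⊙ₗ i.rep ⊙ₗ X)
      (p : k.rep ⊙ₗ i.rep ⊙ₗ X ⟶ trivClass.rep ⊙ₗ X),
      s ≫ p = 𝟙 _ ∧ ∀ h : trivClass.rep ⊙ₗ X ⟶ k.rep ⊙ₗ i.rep ⊙ₗ X, h = (h ≫ p) ≫ s := by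
  obtain ⟨a, b, hab⟩ := exists_retract_of_indecMult_ne_zero hk
  have ha : a ≠ 0 := by
    rintro rfl
    rw [zero_comp] at hab
    exact trivClass.indecomposable_rep.1 ((IsZero.iff_id_eq_zero _).2 hab.symm)
  refine ⟨a ⊵ₗ X ≫ (αₗ k.rep i.rep X).hom, (αₗ k.rep i.rep X).inv ≫ b ⊵ₗ X, ?_, fun h => ?_⟩
  · rw [Category.assoc, Iso.hom_inv_id_assoc, ← comp_actionHomLeft, hab, id_actionHomLeft]
  -- The trivial module has multiplicity one in k ⊗ i, so the complementary idempotent vanishes on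
  -- its isotypic part.
  · have h1 := comp_actionHomLeft_eq_zero hM hπ hinj (𝟙 _ - b ≫ a) (fun c => ?_)
      (h ≫ (αₗ k.rep i.rep X).inv)
    · have h2 : (𝟙 (k.rep ⊗ i.rep) - b ≫ a) ⊵ₗ X = 𝟙 _ - b ⊵ₗ X ≫ a ⊵ₗ X := by
        have := (actRight FinSl3 X).map_sub (f := 𝟙 (k.rep ⊗ i.rep)) (g := b ≫ a)
        rw [CategoryTheory.Functor.map_id, Functor.map_comp] at this
        exact this
      rw [h2, Preadditive.comp_sub, Category.comp_id, sub_eq_zero] at h1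
      rw [← cancel_mono (αₗ k.rep i.rep X).inv]
      simpa using h1
    · have h3 : Module.finrank ℂ (trivClass.rep ⟶ k.rep ⊗ i.rep) = 1 :=
        le_antisymm (finrank_invariants_le_one k i)
          (Module.finrank_pos_iff_exists_ne_zero.2 ⟨a, ha⟩)
      obtain ⟨t, rfl⟩ := (finrank_eq_one_iff_of_nonzero' a ha).1 h3 c
      rw [Preadditive.comp_sub, Category.comp_id, Linear.smul_comp, ← Category.assoc a, hab,
        Category.id_comp, sub_self]

/-- The compression of k r to the trivial object is invertible, so it has a nonzero eigenvalue c. If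
r were not invertible, r - c would be, and so would its compression, which contradicts the choice of
c. -/
theorem isIso_of_actionObj_end_ne_zero (hM : IsSimpleModuleCategory FinSl3 M)
    (hπ : ∀ i, indecMult (i.rep ⊙ₗ X : M) = Finsupp.single (π i) 1) (hinj : Function.Injective π)
    {i : IndecClass FinSl3} {r : i.rep ⊙ₗ X ⟶ i.rep ⊙ₗ X} (hr : r ≠ 0) : IsIso r := by
  have := isLocalRing_end_rep_actionObj hπ trivClass
  have := isLocalRing_end_rep_actionObj hπ i
  obtain ⟨k, a, b, h, hk, -⟩ := exists_isIso_rep_actionObj hM hπ hinj hr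
  obtain ⟨s, p, hsp, hs⟩ := exists_splitting hM hπ hinj hk
  have hρ : IsIso (s ≫ k.rep ⊴ₗ r ≫ p) := by
    have h1 : a ≫ k.rep ⊴ₗ r ≫ b = (a ≫ p) ≫ (s ≫ k.rep ⊴ₗ r ≫ p) ≫ s ≫ b := by
      have h2 := hs (s ≫ k.rep ⊴ₗ r)
      calc a ≫ k.rep ⊴ₗ r ≫ b = ((a ≫ p) ≫ s) ≫ k.rep ⊴ₗ r ≫ b := by rw [← hs a]
        _ = (a ≫ p) ≫ (s ≫ k.rep ⊴ₗ r) ≫ b := by simp only [Category.assoc]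
        _ = (a ≫ p) ≫ (((s ≫ k.rep ⊴ₗ r) ≫ p) ≫ s) ≫ b := by rw [← h2]
        _ = _ := by simp only [Category.assoc]
    rw [h1] at h
    have h3 : IsIso (a ≫ p) := isIso_of_isIso_comp _ _ h
    have h4 := IsIso.of_isIso_comp_left (a ≫ p) ((s ≫ k.rep ⊴ₗ r ≫ p) ≫ s ≫ b)
    exact isIso_of_isIso_comp _ _ h4
  by_contra hn
  obtain ⟨c, hc⟩ := exists_not_isIso_sub_smul (trivClass.rep ⊙ₗ X) (s ≫ k.rep ⊴ₗ r ≫ p)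
  have hc0 : c ≠ 0 := by
    rintro rfl
    rw [zero_smul, sub_zero] at hc
    exact hc hρ
  -- In a local endomorphism ring, r and c - r sum to the invertible c, so the second is invertible
  -- if the first is not.
  have ht : IsIso (r - c • 𝟙 _) := by
    have h1 : IsIso ((r + (c • 𝟙 _ - r)) ≫ 𝟙 (i.rep ⊙ₗ X)) := by
      rw [add_sub_cancel, Category.comp_id]
      exact ⟨c⁻¹ • 𝟙 _, by simp [smul_smul, hc0], by simp [smul_smul, hc0]⟩
    rcases isIso_or_isIso_of_isIso_add h1 with h2 | h2 <;> rw [Category.comp_id] at h2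
    · exact (hn h2).elim
    · rw [← neg_sub]
      exact ⟨-inv (c • 𝟙 _ - r), by rw [Preadditive.neg_comp_neg, IsIso.hom_inv_id],
        by rw [Preadditive.neg_comp_neg, IsIso.inv_hom_id]⟩
  refine hc ?_
  have h1 : k.rep ⊴ₗ (r - c • 𝟙 _) = k.rep ⊴ₗ r - c • 𝟙 _ := by
    have h2 := (actLeft M k.rep).map_sub (f := r) (g := c • 𝟙 _)
    rw [Functor.map_smul, CategoryTheory.Functor.map_id] at h2
    exact h2
  have h2 : s ≫ k.rep ⊴ₗ r ≫ p - c • 𝟙 _ = s ≫ k.rep ⊴ₗ (r - c • 𝟙 _) ≫ p := by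
    rw [h1, Preadditive.sub_comp, Preadditive.comp_sub, Linear.smul_comp, Linear.comp_smul,
      Category.id_comp, hsp]
  rw [h2]
  refine isIso_of_isIso_comp _ (s ≫ k.rep ⊴ₗ inv (r - c • 𝟙 _) ≫ p) ?_
  -- Every map out of the trivial object factors through s, so compression is multiplicative and the
  -- compressed inverse is an inverse.
  have h3 := hs (s ≫ k.rep ⊴ₗ (r - c • 𝟙 _))
  have h4 : (s ≫ k.rep ⊴ₗ (r - c • 𝟙 _) ≫ p) ≫ s ≫ k.rep ⊴ₗ inv (r - c • 𝟙 _) ≫ p = 𝟙 _ :=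
    calc _ = (((s ≫ k.rep ⊴ₗ (r - c • 𝟙 _)) ≫ p) ≫ s) ≫ k.rep ⊴ₗ inv (r - c • 𝟙 _) ≫ p := by
          simp only [Category.assoc]
      _ = 𝟙 _ := by
        rw [← h3, Category.assoc, actionHomRight_hom_inv'_assoc, hsp]
  rw [h4]
  infer_instance

theorem actRight_map_bijective (hM : IsSimpleModuleCategory FinSl3 M)
    (hπ : ∀ i, indecMult (i.rep ⊙ₗ X : M) = Finsupp.single (π i) 1) (hinj : Function.Injective π)
    (i j : IndecClass FinSl3) : Function.Bijective ((actRight FinSl3 X).map :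
      (i.rep ⟶ j.rep) → ((actRight FinSl3 X).obj i.rep ⟶ (actRight FinSl3 X).obj j.rep)) := by
  have := isLocalRing_end_rep_actionObj hπ i
  refine ⟨(injective_iff_map_eq_zero ((actRight FinSl3 X).mapAddHom)).2 fun f hf => ?_,
    fun r => ?_⟩
  · by_contra h0
    obtain rfl := eq_of_rep_hom_ne_zero h0
    have := isIso_of_ne_zero h0
    have h1 : IsIso ((actRight FinSl3 X).map f) := inferInstance
    have h2 : (actRight FinSl3 X).map f = 0 := hf
    rw [h2] at h1
    exact not_isIso_zero_end (i.rep ⊙ₗ X) h1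
  · by_cases h0 : r = 0
    · exact ⟨0, by rw [h0, Functor.map_zero]⟩
    · obtain rfl := eq_of_actionObj_hom_ne_zero hM hπ hinj h0
      obtain ⟨c, hc⟩ := exists_not_isIso_sub_smul (i.rep ⊙ₗ X) r
      have h1 : r - c • 𝟙 _ = 0 := by
        by_contra h1
        exact hc (isIso_of_actionObj_end_ne_zero hM hπ hinj h1)
      refine ⟨c • 𝟙 _, ?_⟩
      rw [Functor.map_smul, CategoryTheory.Functor.map_id]
      exact (sub_eq_zero.1 h1).symm

end FDLieMod

end

/-- An admissible simple module category over the monoidal category of finite dimensional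
`𝔰𝔩₃(ℂ)`-modules with the same graph and the same dual graph as the left regular module
category is equivalent to the left regular module category. -/
theorem mainTheorem2 {M : Type*} [Category* M] [Preadditive M] [Linear ℂ M]
    [HasFiniteBiproducts M] [MonoidalLeftAction FinSl3 M] [IsBilinearAction FinSl3 M]
    (hadm : IsAdmissible M) (hsimple : IsSimpleModuleCategory FinSl3 M)
    (hgraph : (moduleGraph FinSl3).Isomorphic (moduleGraph M))
    (hdual : (moduleDualGraph FinSl3).Isomorphic (moduleDualGraph M)) :
    ModuleCategoriesEquivalent FinSl3 FinSl3 M := by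
  have : Fact (IsKrullSchmidt M) := ⟨hadm.krullSchmidt⟩
  have : ∀ X Y : M, Module.Finite ℂ (X ⟶ Y) := hadm.finiteDimensional
  obtain ⟨σ, hσ⟩ := hgraph
  have hσ' (a : IndecClass FinSl3) : indecMult (natF ⊙ₗ (σ a).rep : M) =
      (indecMult (natF ⊗ a.rep)).mapDomain σ := by
    ext j
    obtain ⟨b, rfl⟩ := σ.surjective j
    rw [Finsupp.mapDomain_apply σ.injective, ← summandMultiplicity_rep, ← summandMultiplicity_rep]
    exact hσ a b
  choose π hπ using FDLieMod.exists_indecMult_actionObj_eq_single σ hσ'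
  -- The equivalence is the action on the object corresponding to the trivial module; its module
  -- structure is given by the associativity isomorphisms of the action.
  refine ⟨actRight FinSl3 (σ FDLieMod.trivClass).rep, isEquivalence_of_rep _
    (FDLieMod.actRight_map_bijective hsimple hπ
      (FDLieMod.injective_of_indecMult_actionObj σ.injective hσ' hπ))
    fun j => ?_, inferInstance, inferInstance, ⟨inferInstance⟩⟩
  obtain ⟨i, rfl⟩ := FDLieMod.surjective_of_indecMult_actionObj σ.surjective hσ' hπ j
  exact ⟨i.rep, nonempty_iso_of_indecMult (hπ i)⟩
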